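/- Let $n\ge 0$ be an integer, let $\lambda_1\ge\lambda_2\ge\dots\ge\lambda_n$ be real numbers, and let $\mathcal{O}_\lambda$ be the set of all Hermitian $n\times n$ matrices of the form $U\,\mathrm{diag}(\lambda_1,\dots,\lambda_n)\,U^*$ with $U\in U(n)$. This is a co-adjoint orbit of $U(n)$ with tangent spaces $T_h\mathcal{O}_\lambda=\{[X,h] : X\in\mathfrak{u}(n)\}$; equip it with the Kirillov–Kostant–Souriau symplectic form $$\omega_h([X,h],[Y,h])=\mathrm{tr}\bigl(i\,h\,[X,Y]\bigr),\qquad h\in\mathcal{O}_\lambda,\ X,Y\in\mathfrak{u}(n).$$ Let $\Phi_\lambda=(\Phi_\lambda^{i,j})$, indexed by the integers $i,j\ge1$ with $i+j\le n+1$, be the Gelfand–Cetlin system on $\mathcal{O}_\lambda$: $\Phi_\lambda^{i,j}(x)$ is the $i$-th largest eigenvalue, counted with multiplicity, of the leading principal $(i+j-1)\times(i+j-1)$ submatrix of $x$. If $\mathcal{O}_\lambda$ is not diffeomorphic to any complex projective space $\mathbb{C}P^m$, $m\ge0$ (where $\mathbb{C}P^0$ is a point), then $\Phi_\lambda$ has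 a non-torus Lagrangian fiber: there is a nonempty fiber $\Phi_\lambda^{-1}(u)$ that is an embedded Lagrangian submanifold of $(\mathcal{O}_\lambda,\omega)$ and that is not homeomorphic (so in particular not diffeomorphic) to the torus $(S^1)^d$, where $d$ is its dimension. -/

import Mathlib

open scoped ContDiff Topology

noncomputable section GelfandCetlinDefs

/-! ### Smooth maps between subsets, embedded submanifolds, tangent vectors -/

/-- `f` is smooth on the subset `X` of the normed space `E`: near every point of `X` it coincides
on `X` with a smooth function defined on an open subset of `E`. -/
def SmoothMapOn {E F : Type*} [NormedAddCommGroup E] [NormedSpace ℝ E]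
    [NormedAddCommGroup F] [NormedSpace ℝ F] (f : E → F) (X : Set E) : Prop :=
  ∀ x ∈ X, ∃ U : Set E, IsOpen U ∧ x ∈ U ∧
    ∃ g : E → F, ContDiffOn ℝ ∞ g U ∧ Set.EqOn f g (X ∩ U)

/-- Diffeomorphic subsets of normed spaces: there are mutually inverse smooth maps. -/
def Diffeomorphic {E F : Type*} [NormedAddCommGroup E] [NormedSpace ℝ E]
    [NormedAddCommGroup F] [NormedSpace ℝ F] (X : Set E) (Y : Set F) : Prop :=
  ∃ (f : E → F) (g : F → E), SmoothMapOn f X ∧ SmoothMapOn g Y ∧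
    Set.MapsTo f X Y ∧ Set.MapsTo g Y X ∧ Set.LeftInvOn g f X ∧ Set.RightInvOn g f Y

/-- `X` is a `d`-dimensional (embedded, smooth) submanifold: every point of `X` has an open
neighbourhood in `X` that is diffeomorphic to an open subset of `ℝ ^ d`. -/
def IsSubmanifold {E : Type*} [NormedAddCommGroup E] [NormedSpace ℝ E]
    (X : Set E) (d : ℕ) : Prop :=
  ∀ x ∈ X, ∃ V : Set E, IsOpen V ∧ x ∈ V ∧
    ∃ W : Set (EuclideanSpace ℝ (Fin d)), IsOpen W ∧ Diffeomorphic (X ∩ V) W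

/-- The tangent space of `X` at `x`, as the set of velocities of smooth curves in `X`. -/
def tangentVectors {E : Type*} [NormedAddCommGroup E] [NormedSpace ℝ E]
    (X : Set E) (x : E) : Set E :=
  {v | ∃ γ : ℝ → E, ContDiffAt ℝ ∞ γ 0 ∧ (∀ᶠ t in 𝓝 0, γ t ∈ X) ∧ γ 0 = x ∧ HasDerivAt γ v 0}

/-! ### Co-adjoint orbits of the unitary group

The dual of `𝔲(n)` is identified with the Hermitian matrices. The norm on matrices is the
entrywise supremum norm; on this finite-dimensional space it only serves to speak of
smoothness, which does not depend on it. -/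

attribute [local instance] Matrix.normedAddCommGroup Matrix.normedSpace

/-- The orbit of `diag(l 0, …, l (n - 1))` under conjugation by unitary matrices. -/
def coadjointOrbit {n : ℕ} (l : Fin n → ℝ) : Set (Matrix (Fin n) (Fin n) ℂ) :=
  {x | ∃ U ∈ Matrix.unitaryGroup (Fin n) ℂ,
    x = U * Matrix.diagonal (fun i => (l i : ℂ)) * U.conjTranspose}

theorem coadjointOrbit_isHermitian {n : ℕ} {l : Fin n → ℝ} {x : Matrix (Fin n) (Fin n) ℂ}
    (hx : x ∈ coadjointOrbit l) : x.IsHermitian := by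
  obtain ⟨U, -, rfl⟩ := hx
  apply Matrix.isHermitian_mul_mul_conjTranspose
  rw [Matrix.isHermitian_diagonal_iff]
  intro i
  simp [isSelfAdjoint_iff]

/-- The skew-Hermitian matrices, i.e. the Lie algebra `𝔲(n)`. -/
def skewHermitian (n : ℕ) : Set (Matrix (Fin n) (Fin n) ℂ) :=
  {X | X.conjTranspose = -X}

/-- The form `(X, Y) ↦ tr(i h [X, Y])` on `𝔲(n)`; the trace is real. The tangent space of the orbit
at `h` is `{[X, h] | X ∈ 𝔲(n)}`, and the Kirillov-Kostant-Souriau symplectic form is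
`ω_h([X, h], [Y, h]) = kks h X Y`. -/
def kks {n : ℕ} (h X Y : Matrix (Fin n) (Fin n) ℂ) : ℝ :=
  (Complex.I * (h * ⁅X, Y⁆).trace).re

/-- A subset `L` of a co-adjoint orbit is a Lagrangian submanifold of dimension `d`: it is a
submanifold and each of its tangent spaces is its own orthogonal complement, with respect to the
Kirillov-Kostant-Souriau form, in the tangent space of the orbit. -/
def IsLagrangianIn {n : ℕ} (l : Fin n → ℝ) (L : Set (Matrix (Fin n) (Fin n) ℂ)) (d : ℕ) : Prop :=
  L ⊆ coadjointOrbit l ∧ IsSubmanifold L d ∧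
    ∀ h ∈ L, ∀ X ∈ skewHermitian n,
      (⁅X, h⁆ ∈ tangentVectors L h ↔
        ∀ Y ∈ skewHermitian n, ⁅Y, h⁆ ∈ tangentVectors L h → kks h X Y = 0)

/-! ### The Gelfand-Cetlin system -/

/-- The index set `{(i, j) | i, j ≥ 1, i + j ≤ n + 1}`. -/
abbrev GCIndex (n : ℕ) : Type :=
  {p : ℕ × ℕ // 1 ≤ p.1 ∧ 1 ≤ p.2 ∧ p.1 + p.2 ≤ n + 1}

/-- The leading principal `k × k` submatrix. -/
def leadingBlock {n : ℕ} (x : Matrix (Fin n) (Fin n) ℂ) (k : ℕ) (hk : k ≤ n) :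
    Matrix (Fin k) (Fin k) ℂ :=
  x.submatrix (Fin.castLE hk) (Fin.castLE hk)

theorem leadingBlock_isHermitian {n : ℕ} {x : Matrix (Fin n) (Fin n) ℂ} (hx : x.IsHermitian)
    (k : ℕ) (hk : k ≤ n) : (leadingBlock x k hk).IsHermitian :=
  hx.submatrix _

/-- The Gelfand-Cetlin system: its component at `(i, j)` sends `x` to the `i`-th largest eigenvalue
(with multiplicity) of the leading principal submatrix of size `i + j - 1`. Mathlib's
`eigenvalues₀` lists the eigenvalues in decreasing order, counting from `0`. -/
def gelfandCetlin {n : ℕ} (l : Fin n → ℝ) (x : coadjointOrbit l) : GCIndex n → ℝ :=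
  fun p =>
    (leadingBlock_isHermitian (coadjointOrbit_isHermitian x.2) (p.1.1 + p.1.2 - 1)
      (by have := p.2; omega)).eigenvalues₀
      ⟨p.1.1 - 1, by have := p.2; rw [Fintype.card_fin]; omega⟩

/-- The fiber of the Gelfand-Cetlin system over `u`. -/
def gcFiber {n : ℕ} (l : Fin n → ℝ) (u : GCIndex n → ℝ) : Set (Matrix (Fin n) (Fin n) ℂ) :=
  {x | ∃ hx : x ∈ coadjointOrbit l, gelfandCetlin l ⟨x, hx⟩ = u}

/-! ### Complex projective spaces -/

/-- The matrix `v v* / (v* v)` of the orthogonal projection onto the line `ℓ = ℂ v`. -/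
def lineProjector {m : ℕ} (ℓ : Projectivization ℂ (Fin (m + 1) → ℂ)) :
    Matrix (Fin (m + 1)) (Fin (m + 1)) ℂ :=
  (star ℓ.rep ⬝ᵥ ℓ.rep)⁻¹ • Matrix.vecMulVec ℓ.rep (star ℓ.rep)

/-- The complex projective space `ℂP^m`, as the image of its standard smooth embedding into the
Hermitian matrices that sends a line to the orthogonal projection onto it. -/
def complexProjectiveSpace (m : ℕ) : Set (Matrix (Fin (m + 1)) (Fin (m + 1)) ℂ) :=
  Set.range lineProjector

/-- The co-adjoint orbit is diffeomorphic to a complex projective space (possibly a point). -/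
def OrbitIsProjectiveSpace {n : ℕ} (l : Fin n → ℝ) : Prop :=
  ∃ m : ℕ, Diffeomorphic (coadjointOrbit l) (complexProjectiveSpace m)

end GelfandCetlinDefs

/-! The fiber through `h` consists of the matrices each of whose leading blocks is unitarily
equivalent to that of `h` (`gcFiber_eq_Fib`). A base point `h` is chosen whose fiber is Lagrangian
and homeomorphic to `S³ × (S¹)^r`.

Choice of `h`. If an eigenvalue had multiplicity at least `n - 1`, the orbit would be a point or, up
to an affine map, the set of rank one projectors (`card_add_two_le_of_not_projective`). With this
excluded, `exists_good` finds `h` whose `2 × 2` block is scalar, whose `3 × 3` block has a nonzero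
last column, and whose larger blocks are regular: each eigenvalue has an eigenvector with nonzero
last coordinate. Regularity means that each eigenvalue loses multiplicity in the next smaller block,
so the multiplicity bound descends to size three, where it says that the eigenvalues are distinct.

Topology. Once the smaller block is known, the trace fixes the corner, and the last column is
constrained exactly by the norms of its components in the eigenspaces of that block. Over the scalar
`2 × 2` block this leaves a three-sphere. At a regular step every nonzero component lies in a simple
eigenspace and leaves a circle. Conjugation by matrices `g ⊕ 1` trivializes each stage
(`exists_isFibParam`).

Lagrangian condition. The tangent space of the fiber is `InfFib` (`tangentVectors_Fib`). It contains
its orthogonal complement by duality for the trace form (`mem_InfFib_of_trace`). It is isotropic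
because, by `NondegAt`, each tangent vector is generated by the unitary algebra of the smaller
block, on which the form restricts to the form of that block; induction finishes
(`kks_eq_zero_of_mem_InfFib`).

Not a torus. The dimension is `d = r + 3`, but maps from `S³ × (S¹)^r` to the circle have only `r`
independent periods. Modulo two, the periods of the `d` coordinates of a homeomorphism to a torus
are dependent, so some product of coordinates has a continuous square root; restricted to a
coordinate circle, this would be a square root on the circle (`isEmpty_homeomorph_torus`). -/

open scoped ContDiff Topology
open Matrix

/-! ### Unitary equivalence -/

section UnitaryEquivalence

variable {n : ℕ}

/-- Unitary equivalence of square matrices. -/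
def UEq (x h : Matrix (Fin n) (Fin n) ℂ) : Prop :=
  ∃ U ∈ Matrix.unitaryGroup (Fin n) ℂ, x = U * h * Uᴴ

theorem unitary_conjTranspose_mul {U : Matrix (Fin n) (Fin n) ℂ}
    (hU : U ∈ Matrix.unitaryGroup (Fin n) ℂ) : Uᴴ * U = 1 :=
  Matrix.mem_unitaryGroup_iff'.1 hU

theorem unitary_mul_conjTranspose {U : Matrix (Fin n) (Fin n) ℂ}
    (hU : U ∈ Matrix.unitaryGroup (Fin n) ℂ) : U * Uᴴ = 1 :=
  Matrix.mem_unitaryGroup_iff.1 hU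

theorem unitary_of_conjTranspose_mul {U : Matrix (Fin n) (Fin n) ℂ} (hU : Uᴴ * U = 1) :
    U ∈ Matrix.unitaryGroup (Fin n) ℂ :=
  Matrix.mem_unitaryGroup_iff'.2 hU

theorem unitary_conjTranspose {U : Matrix (Fin n) (Fin n) ℂ}
    (hU : U ∈ Matrix.unitaryGroup (Fin n) ℂ) : Uᴴ ∈ Matrix.unitaryGroup (Fin n) ℂ :=
  unitary_of_conjTranspose_mul (by
    rw [conjTranspose_conjTranspose]; exact unitary_mul_conjTranspose hU)

theorem unitary_conj_cancel {U : Matrix (Fin n) (Fin n) ℂ}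
    (hU : U ∈ Matrix.unitaryGroup (Fin n) ℂ) (x : Matrix (Fin n) (Fin n) ℂ) :
    Uᴴ * (U * x * Uᴴ) * U = x := by
  have h := unitary_conjTranspose_mul hU
  calc Uᴴ * (U * x * Uᴴ) * U = (Uᴴ * U) * x * (Uᴴ * U) := by simp only [mul_assoc]
    _ = x := by rw [h]; simp

theorem unitary_conj_cancel' {U : Matrix (Fin n) (Fin n) ℂ}
    (hU : U ∈ Matrix.unitaryGroup (Fin n) ℂ) (x : Matrix (Fin n) (Fin n) ℂ) :
    U * (Uᴴ * x * U) * Uᴴ = x := by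
  simpa using unitary_conj_cancel (unitary_conjTranspose hU) x

theorem UEq.refl (x : Matrix (Fin n) (Fin n) ℂ) : UEq x x :=
  ⟨1, one_mem _, by simp⟩

theorem UEq.symm {x y : Matrix (Fin n) (Fin n) ℂ} (h : UEq x y) : UEq y x := by
  obtain ⟨U, hU, rfl⟩ := h
  exact ⟨Uᴴ, unitary_conjTranspose hU, by
    rw [conjTranspose_conjTranspose, unitary_conj_cancel hU]⟩

theorem UEq.trans {x y z : Matrix (Fin n) (Fin n) ℂ} (h : UEq x y) (h' : UEq y z) : UEq x z := by
  obtain ⟨U, hU, rfl⟩ := h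
  obtain ⟨V, hV, rfl⟩ := h'
  exact ⟨U * V, mul_mem hU hV, by simp only [conjTranspose_mul, mul_assoc]⟩

theorem UEq.of_conj {U : Matrix (Fin n) (Fin n) ℂ}
    (hU : U ∈ Matrix.unitaryGroup (Fin n) ℂ) (x : Matrix (Fin n) (Fin n) ℂ) :
    UEq (U * x * Uᴴ) x := ⟨U, hU, rfl⟩

theorem UEq.isHermitian {x y : Matrix (Fin n) (Fin n) ℂ} (h : UEq x y) (hy : y.IsHermitian) :
    x.IsHermitian := by
  obtain ⟨U, -, rfl⟩ := h
  exact Matrix.isHermitian_mul_mul_conjTranspose _ hy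

theorem UEq.charpoly_eq {x y : Matrix (Fin n) (Fin n) ℂ} (h : UEq x y) :
    x.charpoly = y.charpoly := by
  obtain ⟨U, hU, rfl⟩ := h
  rw [Matrix.charpoly_mul_comm, ← mul_assoc, unitary_conjTranspose_mul hU, one_mul]

theorem UEq.trace_eq {x y : Matrix (Fin n) (Fin n) ℂ} (h : UEq x y) : x.trace = y.trace := by
  obtain ⟨U, hU, rfl⟩ := h
  rw [Matrix.trace_mul_comm, ← mul_assoc, unitary_conjTranspose_mul hU, one_mul]

theorem UEq.smul_one {x : Matrix (Fin n) (Fin n) ℂ} {c : ℂ} (h : UEq x (c • 1)) : x = c • 1 := by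
  obtain ⟨U, hU, rfl⟩ := h
  simp [unitary_mul_conjTranspose hU]

/-- The diagonal matrix with prescribed real entries. -/
abbrev rdiag (d : Fin n → ℝ) : Matrix (Fin n) (Fin n) ℂ := Matrix.diagonal fun i => (d i : ℂ)

theorem rdiag_isHermitian (d : Fin n → ℝ) : (rdiag d).IsHermitian := by
  rw [Matrix.isHermitian_diagonal_iff]
  intro i
  simp [isSelfAdjoint_iff]

theorem ueq_rdiag_eigenvalues {h : Matrix (Fin n) (Fin n) ℂ} (hh : h.IsHermitian) :
    UEq h (rdiag hh.eigenvalues) :=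
  ⟨hh.eigenvectorUnitary, hh.eigenvectorUnitary.2, hh.spectral_theorem⟩

theorem exists_ueq_rdiag {h : Matrix (Fin n) (Fin n) ℂ} (hh : h.IsHermitian) :
    ∃ d : Fin n → ℝ, UEq h (rdiag d) := ⟨_, ueq_rdiag_eigenvalues hh⟩

/-- The characteristic polynomial fixes the sorted list of eigenvalues, hence a common diagonal
form. -/
theorem ueq_of_charpoly_eq {x y : Matrix (Fin n) (Fin n) ℂ} (hx : x.IsHermitian)
    (hy : y.IsHermitian) (h : x.charpoly = y.charpoly) : UEq x y := by
  have h1 := (hx.eigenvalues_eq_eigenvalues_iff hy).2 h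
  have h2 := ueq_rdiag_eigenvalues hx
  rw [h1] at h2
  exact h2.trans (ueq_rdiag_eigenvalues hy).symm

theorem mem_coadjointOrbit_iff {l : Fin n → ℝ} {x : Matrix (Fin n) (Fin n) ℂ} :
    x ∈ coadjointOrbit l ↔ UEq x (rdiag l) := Iff.rfl

end UnitaryEquivalence

/-! ### Bordered matrices -/

section Bordered

variable {n : ℕ}

/-- The matrix with upper left block `y`, last column `(v, t)` and last row `(w, t)`. -/
def bord (y : Matrix (Fin n) (Fin n) ℂ) (v w : Fin n → ℂ) (t : ℂ) :
    Matrix (Fin (n + 1)) (Fin (n + 1)) ℂ :=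
  Matrix.of (Fin.snoc (α := fun _ => Fin (n + 1) → ℂ)
    (fun i => Fin.snoc (α := fun _ => ℂ) (y i) (v i)) (Fin.snoc (α := fun _ => ℂ) w t))

/-- The upper left block of a bordered matrix. -/
def blk (x : Matrix (Fin (n + 1)) (Fin (n + 1)) ℂ) : Matrix (Fin n) (Fin n) ℂ :=
  x.submatrix Fin.castSucc Fin.castSucc

/-- The last column, without the corner. -/
def lcol (x : Matrix (Fin (n + 1)) (Fin (n + 1)) ℂ) : Fin n → ℂ := fun i =>
  x i.castSucc (Fin.last n)

section apply
variable (y : Matrix (Fin n) (Fin n) ℂ) (v w : Fin n → ℂ) (t : ℂ) (i j : Fin n)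

@[simp] theorem bord_castSucc_castSucc : bord y v w t i.castSucc j.castSucc = y i j := by
  simp [bord]
@[simp] theorem bord_castSucc_last : bord y v w t i.castSucc (Fin.last n) = v i := by
  simp [bord]
@[simp] theorem bord_last_castSucc : bord y v w t (Fin.last n) j.castSucc = w j := by
  simp [bord]
@[simp] theorem bord_last_last : bord y v w t (Fin.last n) (Fin.last n) = t := by
  simp [bord]
@[simp] theorem blk_bord : blk (bord y v w t) = y := by
  ext i j; simp [blk]
@[simp] theorem lcol_bord : lcol (bord y v w t) = v := by
  ext i; simp [lcol]
end apply

@[simp] theorem blk_apply (x : Matrix (Fin (n + 1)) (Fin (n + 1)) ℂ) (i j : Fin n) :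
    blk x i j = x i.castSucc j.castSucc := rfl

@[simp] theorem lcol_apply (x : Matrix (Fin (n + 1)) (Fin (n + 1)) ℂ) (i : Fin n) :
    lcol x i = x i.castSucc (Fin.last n) := rfl

theorem matrix_succ_ext {x y : Matrix (Fin (n + 1)) (Fin (n + 1)) ℂ}
    (h1 : ∀ i j : Fin n, x i.castSucc j.castSucc = y i.castSucc j.castSucc)
    (h2 : ∀ i : Fin n, x i.castSucc (Fin.last n) = y i.castSucc (Fin.last n))
    (h3 : ∀ i : Fin n, x (Fin.last n) i.castSucc = y (Fin.last n) i.castSucc)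
    (h4 : x (Fin.last n) (Fin.last n) = y (Fin.last n) (Fin.last n)) : x = y := by
  ext i j
  induction i using Fin.lastCases with
  | last => induction j using Fin.lastCases with
    | last => exact h4
    | cast j => exact h3 j
  | cast i => induction j using Fin.lastCases with
    | last => exact h2 i
    | cast j => exact h1 i j

theorem eq_bord (x : Matrix (Fin (n + 1)) (Fin (n + 1)) ℂ) :
    x = bord (blk x) (lcol x) (fun j => x (Fin.last n) j.castSucc) (x (Fin.last n) (Fin.last n)) :=
  matrix_succ_ext (by simp) (by simp) (by simp) (by simp)

theorem isHermitian_eq_bord {x : Matrix (Fin (n + 1)) (Fin (n + 1)) ℂ} (hx : x.IsHermitian) :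
    x = bord (blk x) (lcol x) (star (lcol x)) (x (Fin.last n) (Fin.last n)) := by
  refine matrix_succ_ext (by simp) (by simp) (fun i => ?_) (by simp)
  simpa using (hx.apply (Fin.last n) i.castSucc).symm

theorem blk_isHermitian {x : Matrix (Fin (n + 1)) (Fin (n + 1)) ℂ} (hx : x.IsHermitian) :
    (blk x).IsHermitian := hx.submatrix _

theorem bord_mul (y y' : Matrix (Fin n) (Fin n) ℂ) (v w v' w' : Fin n → ℂ) (t t' : ℂ) :
    bord y v w t * bord y' v' w' t' =
      bord (y * y' + vecMulVec v w') (y *ᵥ v' + t' • v) (w ᵥ* y' + t • w') (w ⬝ᵥ v' + t * t') := by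
  refine matrix_succ_ext (fun i j => ?_) (fun i => ?_) (fun i => ?_) ?_ <;>
  simp [mul_apply, Fin.sum_univ_castSucc, vecMulVec_apply, mulVec, vecMul, dotProduct, mul_comm]

theorem bord_conjTranspose (y : Matrix (Fin n) (Fin n) ℂ) (v w : Fin n → ℂ) (t : ℂ) :
    (bord y v w t)ᴴ = bord yᴴ (star w) (star v) (star t) :=
  matrix_succ_ext (by simp) (by simp) (by simp) (by simp)

theorem bord_add (y y' : Matrix (Fin n) (Fin n) ℂ) (v w v' w' : Fin n → ℂ) (t t' : ℂ) :
    bord y v w t + bord y' v' w' t' = bord (y + y') (v + v') (w + w') (t + t') :=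
  matrix_succ_ext (by simp) (by simp) (by simp) (by simp)

theorem bord_sub (y y' : Matrix (Fin n) (Fin n) ℂ) (v w v' w' : Fin n → ℂ) (t t' : ℂ) :
    bord y v w t - bord y' v' w' t' = bord (y - y') (v - v') (w - w') (t - t') :=
  matrix_succ_ext (by simp) (by simp) (by simp) (by simp)

theorem bord_one : bord (1 : Matrix (Fin n) (Fin n) ℂ) 0 0 1 = 1 := by
  refine matrix_succ_ext (fun i j => ?_) (fun i => ?_) (fun i => ?_) ?_
  · simp [one_apply]
  · simp [one_apply]
  · simp [one_apply, (Fin.castSucc_ne_last i).symm]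
  · simp

theorem trace_bord (y : Matrix (Fin n) (Fin n) ℂ) (v w : Fin n → ℂ) (t : ℂ) :
    (bord y v w t).trace = y.trace + t := by
  simp [trace, Fin.sum_univ_castSucc]

theorem trace_eq_blk (x : Matrix (Fin (n + 1)) (Fin (n + 1)) ℂ) :
    x.trace = (blk x).trace + x (Fin.last n) (Fin.last n) := by
  simp [trace, Fin.sum_univ_castSucc]

theorem bord_mulVec_snoc (y : Matrix (Fin n) (Fin n) ℂ) (v w : Fin n → ℂ) (t : ℂ)
    (u : Fin n → ℂ) (a : ℂ) :
    bord y v w t *ᵥ (Fin.snoc u a : Fin (n + 1) → ℂ) =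
      (Fin.snoc (y *ᵥ u + a • v) (w ⬝ᵥ u + t * a) : Fin (n + 1) → ℂ) := by
  ext i
  induction i using Fin.lastCases with
  | last => simp [mulVec, dotProduct, Fin.sum_univ_castSucc]
  | cast i => simp [mulVec, dotProduct, Fin.sum_univ_castSucc, mul_comm]

/-- `g ⊕ 1`. -/
abbrev extOne (g : Matrix (Fin n) (Fin n) ℂ) : Matrix (Fin (n + 1)) (Fin (n + 1)) ℂ :=
  bord g 0 0 1

/-- `A ⊕ 0`. -/
abbrev extZero (A : Matrix (Fin n) (Fin n) ℂ) : Matrix (Fin (n + 1)) (Fin (n + 1)) ℂ :=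
  bord A 0 0 0

theorem extOne_mul (g g' : Matrix (Fin n) (Fin n) ℂ) :
    extOne (g * g') = extOne g * extOne g' := by simp [bord_mul]

theorem extOne_conjTranspose (g : Matrix (Fin n) (Fin n) ℂ) : (extOne g)ᴴ = extOne gᴴ := by
  simp [bord_conjTranspose]

theorem extOne_mem {g : Matrix (Fin n) (Fin n) ℂ} (hg : g ∈ Matrix.unitaryGroup (Fin n) ℂ) :
    extOne g ∈ Matrix.unitaryGroup (Fin (n + 1)) ℂ :=
  unitary_of_conjTranspose_mul (by
    rw [extOne_conjTranspose, ← extOne_mul, unitary_conjTranspose_mul hg]; exact bord_one)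

theorem extOne_conj (g y : Matrix (Fin n) (Fin n) ℂ) (v w : Fin n → ℂ) (t : ℂ) :
    extOne g * bord y v w t * (extOne g)ᴴ = bord (g * y * gᴴ) (g *ᵥ v) (w ᵥ* gᴴ) t := by
  rw [extOne_conjTranspose, bord_mul, bord_mul]
  simp

theorem blk_extOne_conj (g : Matrix (Fin n) (Fin n) ℂ)
    (x : Matrix (Fin (n + 1)) (Fin (n + 1)) ℂ) :
    blk (extOne g * x * (extOne g)ᴴ) = g * blk x * gᴴ := by
  rw [eq_bord x, extOne_conj]; simp

theorem lcol_extOne_conj (g : Matrix (Fin n) (Fin n) ℂ)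
    (x : Matrix (Fin (n + 1)) (Fin (n + 1)) ℂ) :
    lcol (extOne g * x * (extOne g)ᴴ) = g *ᵥ lcol x := by
  rw [eq_bord x, extOne_conj]; simp

theorem extZero_bracket (A y : Matrix (Fin n) (Fin n) ℂ) (v w : Fin n → ℂ) (t : ℂ) :
    ⁅extZero A, bord y v w t⁆ = bord ⁅A, y⁆ (A *ᵥ v) (-(w ᵥ* A)) 0 := by
  rw [Ring.lie_def, Ring.lie_def, bord_mul, bord_mul, bord_sub]
  simp

theorem blk_extZero_bracket (A : Matrix (Fin n) (Fin n) ℂ)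
    (x : Matrix (Fin (n + 1)) (Fin (n + 1)) ℂ) :
    blk ⁅extZero A, x⁆ = ⁅A, blk x⁆ := by
  conv_lhs => rw [eq_bord x]
  rw [extZero_bracket]; simp

end Bordered

/-! ### Fibers -/

/-- The matrices all of whose leading principal submatrices are unitarily equivalent to the
corresponding ones of `h`. -/
def Fib : (n : ℕ) → Matrix (Fin n) (Fin n) ℂ → Set (Matrix (Fin n) (Fin n) ℂ)
  | 0, _ => Set.univ
  | n + 1, h => {x | UEq x h ∧ blk x ∈ Fib n (blk h)}

theorem self_mem_Fib : ∀ {n : ℕ} (h : Matrix (Fin n) (Fin n) ℂ), h ∈ Fib n h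
  | 0, _ => trivial
  | _ + 1, h => ⟨UEq.refl h, self_mem_Fib (blk h)⟩

theorem UEq.of_mem_Fib : ∀ {n : ℕ} {h x : Matrix (Fin n) (Fin n) ℂ}, x ∈ Fib n h → UEq x h
  | 0, _, _, _ => ⟨1, one_mem _, Subsingleton.elim _ _⟩
  | _ + 1, _, _, hx => hx.1

theorem mem_Fib_symm : ∀ {n : ℕ} {h x : Matrix (Fin n) (Fin n) ℂ}, x ∈ Fib n h → h ∈ Fib n x
  | 0, _, _, _ => trivial
  | _ + 1, _, _, hx => ⟨hx.1.symm, mem_Fib_symm hx.2⟩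

theorem mem_Fib_trans : ∀ {n : ℕ} {h x y : Matrix (Fin n) (Fin n) ℂ},
    y ∈ Fib n x → x ∈ Fib n h → y ∈ Fib n h
  | 0, _, _, _, _, _ => trivial
  | _ + 1, _, _, _, hy, hx => ⟨hy.1.trans hx.1, mem_Fib_trans hy.2 hx.2⟩

theorem mem_Fib_iff : ∀ {n : ℕ} {h x : Matrix (Fin n) (Fin n) ℂ},
    x ∈ Fib n h ↔ ∀ k (hk : k ≤ n), UEq (leadingBlock x k hk) (leadingBlock h k hk)
  | 0, h, x => by
    refine ⟨fun _ k hk => ?_, fun _ => trivial⟩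
    obtain rfl : k = 0 := by omega
    exact ⟨1, one_mem _, Subsingleton.elim _ _⟩
  | n + 1, h, x => by
    constructor
    · rintro ⟨h1, h2⟩ k hk
      rcases Nat.lt_or_ge n k with h3 | h3
      · obtain rfl : k = n + 1 := by omega
        exact h1
      · exact mem_Fib_iff.1 h2 k h3
    · intro H
      exact ⟨H (n + 1) le_rfl, mem_Fib_iff.2 fun k hk => H k (by omega)⟩

theorem eigenvalues₀_congr {k : ℕ} {x h : Matrix (Fin k) (Fin k) ℂ} (hx : x.IsHermitian)
    (hh : h.IsHermitian) : hx.eigenvalues₀ = hh.eigenvalues₀ ↔ UEq x h := by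
  constructor
  · intro H
    refine ueq_of_charpoly_eq hx hh ((hx.eigenvalues_eq_eigenvalues_iff hh).1 ?_)
    ext i
    simp only [Matrix.IsHermitian.eigenvalues, H]
  · intro H
    have h1 := (hx.eigenvalues_eq_eigenvalues_iff hh).2 H.charpoly_eq
    ext i
    have := congrFun h1 (Fintype.equivOfCardEq (Fintype.card_fin _) i)
    simpa [Matrix.IsHermitian.eigenvalues] using this

theorem gcFiber_eq_Fib {n : ℕ} {l : Fin n → ℝ} {h : Matrix (Fin n) (Fin n) ℂ}
    (hh : h ∈ coadjointOrbit l) : gcFiber l (gelfandCetlin l ⟨h, hh⟩) = Fib n h := by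
  ext x
  constructor
  · rintro ⟨hx, H⟩
    rw [mem_Fib_iff]
    intro k hk
    rw [← eigenvalues₀_congr (leadingBlock_isHermitian (coadjointOrbit_isHermitian hx) k hk)
      (leadingBlock_isHermitian (coadjointOrbit_isHermitian hh) k hk)]
    ext ⟨i, hi⟩
    have hi' : i < k := by simpa using hi
    -- The index `(i + 1, k - i)` belongs to block size `k` and, counting from `0`, to eigenvalue
    -- number `i`.
    have h1 := congrFun H ⟨(i + 1, k - i), by simp; omega⟩
    have h2 : i + 1 + (k - i) - 1 = k := by omega
    simp only [gelfandCetlin, Nat.add_sub_cancel] at h1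
    -- The size `i + 1 + (k - i) - 1` is only propositionally `k`; a general size `m` allows the
    -- substitution.
    have key : ∀ (m : ℕ) (e : m = k) (hm : m ≤ n) (p : i < Fintype.card (Fin m))
      (q : i < Fintype.card (Fin m)),
      (leadingBlock_isHermitian (coadjointOrbit_isHermitian hx) m hm).eigenvalues₀ ⟨i, p⟩ =
      (leadingBlock_isHermitian (coadjointOrbit_isHermitian hh) m hm).eigenvalues₀ ⟨i, q⟩ →
      (leadingBlock_isHermitian (coadjointOrbit_isHermitian hx) k hk).eigenvalues₀ ⟨i, hi⟩ =
      (leadingBlock_isHermitian (coadjointOrbit_isHermitian hh) k hk).eigenvalues₀ ⟨i, hi⟩ := by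
      rintro m rfl hm p q h
      exact h
    exact key _ h2 _ _ _ h1
  · intro H
    have hx : x ∈ coadjointOrbit l := (UEq.of_mem_Fib H).trans hh
    refine ⟨hx, ?_⟩
    ext p
    simp only [gelfandCetlin]
    rw [mem_Fib_iff] at H
    have hp := p.2
    rw [(eigenvalues₀_congr (leadingBlock_isHermitian (coadjointOrbit_isHermitian hx) _
      (by omega)) (leadingBlock_isHermitian (coadjointOrbit_isHermitian hh) _ (by omega))).2
      (H (p.1.1 + p.1.2 - 1) (by omega))]

/-! ### Linear algebra of the bracket -/

section Bracket

variable {n : ℕ}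

theorem sub_bracket (A B C : Matrix (Fin n) (Fin n) ℂ) : ⁅A - B, C⁆ = ⁅A, C⁆ - ⁅B, C⁆ := by
  simp only [Ring.lie_def]; noncomm_ring

theorem add_bracket (A B C : Matrix (Fin n) (Fin n) ℂ) : ⁅A + B, C⁆ = ⁅A, C⁆ + ⁅B, C⁆ := by
  simp only [Ring.lie_def]; noncomm_ring

theorem mem_skewHermitian {X : Matrix (Fin n) (Fin n) ℂ} : X ∈ skewHermitian n ↔ Xᴴ = -X := Iff.rfl

theorem conj_mem_skewHermitian {X : Matrix (Fin n) (Fin n) ℂ} (hX : X ∈ skewHermitian n)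
    (U : Matrix (Fin n) (Fin n) ℂ) : U * X * Uᴴ ∈ skewHermitian n := by
  rw [mem_skewHermitian] at *
  simp [conjTranspose_mul, hX, mul_assoc]

theorem extZero_mem_skewHermitian {A : Matrix (Fin n) (Fin n) ℂ} (hA : A ∈ skewHermitian n) :
    extZero A ∈ skewHermitian (n + 1) := by
  rw [mem_skewHermitian] at *
  rw [bord_conjTranspose, hA]
  exact matrix_succ_ext (by simp) (by simp) (by simp) (by simp)

theorem sub_mem_skewHermitian {A B : Matrix (Fin n) (Fin n) ℂ} (hA : A ∈ skewHermitian n)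
    (hB : B ∈ skewHermitian n) : A - B ∈ skewHermitian n := by
  rw [mem_skewHermitian] at *
  rw [conjTranspose_sub, hA, hB]; abel

theorem add_mem_skewHermitian {A B : Matrix (Fin n) (Fin n) ℂ} (hA : A ∈ skewHermitian n)
    (hB : B ∈ skewHermitian n) : A + B ∈ skewHermitian n := by
  rw [mem_skewHermitian] at *
  rw [conjTranspose_add, hA, hB]; abel

theorem bracket_isHermitian {X h : Matrix (Fin n) (Fin n) ℂ} (hX : X ∈ skewHermitian n)
    (hh : h.IsHermitian) : ⁅X, h⁆.IsHermitian := by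
  rw [mem_skewHermitian] at hX
  unfold Matrix.IsHermitian
  rw [Ring.lie_def, conjTranspose_sub, conjTranspose_mul, conjTranspose_mul, hX, hh.eq]
  simp; abel

theorem conj_bracket_conj {U : Matrix (Fin n) (Fin n) ℂ} (hU : U ∈ Matrix.unitaryGroup (Fin n) ℂ)
    (X D : Matrix (Fin n) (Fin n) ℂ) : ⁅U * X * Uᴴ, U * D * Uᴴ⁆ = U * ⁅X, D⁆ * Uᴴ := by
  have h := unitary_conjTranspose_mul hU
  rw [Ring.lie_def, Ring.lie_def, mul_sub, sub_mul]
  congr 1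
  · calc U * X * Uᴴ * (U * D * Uᴴ) = U * X * (Uᴴ * U) * D * Uᴴ := by simp only [mul_assoc]
      _ = _ := by rw [h]; simp only [mul_assoc, mul_one]
  · calc U * D * Uᴴ * (U * X * Uᴴ) = U * D * (Uᴴ * U) * X * Uᴴ := by simp only [mul_assoc]
      _ = _ := by rw [h]; simp only [mul_assoc, mul_one]

theorem bracket_rdiag_apply (X : Matrix (Fin n) (Fin n) ℂ) (d : Fin n → ℝ) (i j : Fin n) :
    ⁅X, rdiag d⁆ i j = X i j * ((d j : ℂ) - d i) := by
  simp [Ring.lie_def, mul_diagonal, diagonal_mul]; ring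

theorem exists_bracket_of_apply_eq_zero {U δ : Matrix (Fin n) (Fin n) ℂ}
    (hU : U ∈ Matrix.unitaryGroup (Fin n) ℂ) (d : Fin n → ℝ) (hδ : δ.IsHermitian)
    (H : ∀ i j, d i = d j → (Uᴴ * δ * U) i j = 0) :
    ∃ X ∈ skewHermitian n, δ = ⁅X, U * rdiag d * Uᴴ⁆ := by
  set δ' := Uᴴ * δ * U with hδ'
  have hδ'h : δ'.IsHermitian := by
    have := Matrix.isHermitian_mul_mul_conjTranspose Uᴴ hδ
    rwa [conjTranspose_conjTranspose] at this
  -- In the eigenbasis the bracket multiplies the entry `(i, j)` by `d j - d i`. Where this is zero,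
  -- so is `δ'`, and division by zero gives `0`.
  let X' : Matrix (Fin n) (Fin n) ℂ := Matrix.of fun i j => δ' i j / ((d j : ℂ) - d i)
  have hX' : X' ∈ skewHermitian n := by
    rw [mem_skewHermitian]
    ext i j
    change star (X' j i) = -(X' i j)
    simp only [X', of_apply, star_div₀, hδ'h.apply, star_sub]
    rw [← div_neg]
    simp
  refine ⟨U * X' * Uᴴ, conj_mem_skewHermitian hX' U, ?_⟩
  rw [conj_bracket_conj hU]
  have : ⁅X', rdiag d⁆ = δ' := by
    ext i j
    rw [bracket_rdiag_apply]
    by_cases hij : d i = d j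
    · rw [H i j hij, hij]; simp
    · have : (d j : ℂ) - d i ≠ 0 := by
        rw [sub_ne_zero]; exact_mod_cast Ne.symm hij
      simp [X', this]
  rw [this, hδ', unitary_conj_cancel' hU]

/-- The tangent space of the orbit is the orthogonal complement of the commutant for the trace form.
-/
theorem exists_bracket_of_trace {h δ : Matrix (Fin n) (Fin n) ℂ} (hh : h.IsHermitian)
    (hδ : δ.IsHermitian) (H : ∀ Z ∈ skewHermitian n, ⁅Z, h⁆ = 0 → (δ * Z).trace = 0) :
    ∃ X ∈ skewHermitian n, δ = ⁅X, h⁆ := by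
  obtain ⟨d, U, hU, rfl⟩ := exists_ueq_rdiag hh
  refine exists_bracket_of_apply_eq_zero hU d hδ ?_
  set δ' := Uᴴ * δ * U with hδ'
  have hδ'h : δ'.IsHermitian := by
    have := Matrix.isHermitian_mul_mul_conjTranspose Uᴴ hδ
    rwa [conjTranspose_conjTranspose] at this
  -- The obstruction itself serves as test element: `Z'` is `i` times the part of `δ'` commuting
  -- with `rdiag d`, and its pairing with `δ'` is `i` times a sum of squares.
  let Z' : Matrix (Fin n) (Fin n) ℂ := Matrix.of fun i j => if d i = d j then Complex.I * δ' i j else 0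
  have hZ' : Z' ∈ skewHermitian n := by
    rw [mem_skewHermitian]
    ext i j
    by_cases hij : d i = d j
    · change star (Z' j i) = -(Z' i j)
      simp only [Z', of_apply, hij, if_true, star_mul',
        hδ'h.apply]
      simp
    · simp [Z', hij, Ne.symm hij]
  have h0 : ⁅Z', rdiag d⁆ = 0 := by
    ext i j
    rw [bracket_rdiag_apply]
    by_cases hij : d i = d j
    · simp [hij]
    · simp [Z', hij]
  have h1 := H _ (conj_mem_skewHermitian hZ' U) (by rw [conj_bracket_conj hU, h0]; simp)
  have h2 : (δ * (U * Z' * Uᴴ)).trace = (δ' * Z').trace := by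
    rw [hδ', ← mul_assoc, trace_mul_comm]
    simp only [mul_assoc]
  rw [h2] at h1
  have h3 : (δ' * Z').trace = Complex.I *
      ((∑ i, ∑ j, if d i = d j then ‖δ' i j‖ ^ 2 else 0 : ℝ) : ℂ) := by
    push_cast
    simp only [trace, diag_apply, mul_apply, Finset.mul_sum]
    refine Finset.sum_congr rfl fun i _ => Finset.sum_congr rfl fun j _ => ?_
    by_cases hij : d i = d j
    · have : δ' j i = star (δ' i j) := (hδ'h.apply j i).symm
      simp only [Z', of_apply, hij, if_true, this]
      have h4 : δ' i j * star (δ' i j) = ((‖δ' i j‖ ^ 2 : ℝ) : ℂ) := by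
        rw [Complex.star_def, Complex.mul_conj']; push_cast; rfl
      rw [mul_left_comm, h4]
    · simp [Z', hij, Ne.symm hij]
  rw [h3, mul_eq_zero] at h1
  have h4 := Complex.ofReal_eq_zero.1 (h1.resolve_left Complex.I_ne_zero)
  rw [Finset.sum_eq_zero_iff_of_nonneg
    (fun i _ => Finset.sum_nonneg fun j _ => by split_ifs <;> positivity)] at h4
  intro i j hij
  have h5 := h4 i (Finset.mem_univ i)
  rw [Finset.sum_eq_zero_iff_of_nonneg (fun j _ => by split_ifs <;> positivity)] at h5
  have h6 := h5 j (Finset.mem_univ j)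
  simpa [hij] using h6

theorem trace_mul_bracket (h X Y : Matrix (Fin n) (Fin n) ℂ) :
    (h * ⁅X, Y⁆).trace = -(⁅X, h⁆ * Y).trace := by
  simp only [Ring.lie_def, mul_sub, sub_mul, trace_sub]
  rw [← mul_assoc h Y X, trace_mul_comm (h * Y) X]
  simp only [mul_assoc]; ring

theorem kks_eq (h X Y : Matrix (Fin n) (Fin n) ℂ) : kks h X Y = (⁅X, h⁆ * Y).trace.im := by
  rw [kks, trace_mul_bracket]; simp

theorem kks_comm (h X Y : Matrix (Fin n) (Fin n) ℂ) : kks h X Y = -kks h Y X := by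
  have : ⁅X, Y⁆ = -⁅Y, X⁆ := by simp [Ring.lie_def]
  rw [kks, kks, this]; simp

/-- With `kks_eq`, this makes vanishing of the symplectic form equivalent to vanishing of the
complex trace. -/
theorem trace_re_eq_zero {δ Y : Matrix (Fin n) (Fin n) ℂ} (hδ : δ.IsHermitian)
    (hY : Y ∈ skewHermitian n) : (δ * Y).trace.re = 0 := by
  rw [mem_skewHermitian] at hY
  have h1 : star (δ * Y).trace = -(δ * Y).trace := by
    rw [← trace_conjTranspose, conjTranspose_mul, hY, hδ.eq, neg_mul, trace_neg, trace_mul_comm]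
  have h2 := congrArg Complex.re h1
  rw [Complex.star_def, Complex.conj_re, Complex.neg_re] at h2
  linarith

theorem trace_bord_mul_extZero (B C : Matrix (Fin n) (Fin n) ℂ) (v w : Fin n → ℂ) (t : ℂ) :
    (bord B v w t * extZero C).trace = (B * C).trace := by
  rw [bord_mul, trace_bord]; simp

end Bracket

/-! ### Infinitesimal fibers -/

/-- The matrices whose leading principal submatrices are tangent to the orbits of those of `h`. -/
def InfFib : (n : ℕ) → Matrix (Fin n) (Fin n) ℂ → Set (Matrix (Fin n) (Fin n) ℂ)
  | 0, _ => Set.univ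
  | n + 1, h => {δ | (∃ X ∈ skewHermitian (n + 1), δ = ⁅X, h⁆) ∧ blk δ ∈ InfFib n (blk h)}

theorem blk_zero {n : ℕ} : blk (0 : Matrix (Fin (n + 1)) (Fin (n + 1)) ℂ) = 0 := rfl

theorem zero_mem_skewHermitian (n : ℕ) : (0 : Matrix (Fin n) (Fin n) ℂ) ∈ skewHermitian n := by
  simp [skewHermitian]

theorem zero_mem_InfFib : ∀ {n : ℕ} (h : Matrix (Fin n) (Fin n) ℂ), 0 ∈ InfFib n h
  | 0, _ => trivial
  | n + 1, h => ⟨⟨0, zero_mem_skewHermitian _, by simp [Ring.lie_def]⟩, by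
      rw [blk_zero]; exact zero_mem_InfFib (blk h)⟩

/-- The coisotropic half. Elements commuting with `h` have zero bracket, hence are admissible tests,
and they force `δ` to be tangent to the orbit; tests of the form `extZero Y` pass the hypothesis on
to the smaller block. -/
theorem mem_InfFib_of_trace : ∀ {n : ℕ} {h δ : Matrix (Fin n) (Fin n) ℂ}, h.IsHermitian →
    δ.IsHermitian → (∀ Y ∈ skewHermitian n, ⁅Y, h⁆ ∈ InfFib n h → (δ * Y).trace = 0) →
    δ ∈ InfFib n h
  | 0, _, _, _, _, _ => trivial
  | n + 1, h, δ, hh, hδ, H => by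
    refine ⟨exists_bracket_of_trace hh hδ fun Z hZ h0 => H Z hZ ?_,
      mem_InfFib_of_trace (blk_isHermitian hh) (blk_isHermitian hδ) fun Y hY hm => ?_⟩
    · rw [h0]; exact zero_mem_InfFib h
    · have h1 := H (extZero Y) (extZero_mem_skewHermitian hY)
        ⟨⟨_, extZero_mem_skewHermitian hY, rfl⟩, by rwa [blk_extZero_bracket]⟩
      rw [eq_bord δ, trace_bord_mul_extZero] at h1
      exact h1

/-! ### Nondegeneracy -/

/-- Every eigenvalue of the upper left block either pairs nontrivially with the last column, or has
an eigenvector of the whole matrix with nonzero last coordinate. -/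
def NondegAt {n : ℕ} (h : Matrix (Fin (n + 1)) (Fin (n + 1)) ℂ) : Prop :=
  ∀ (θ : ℝ) (u : Fin n → ℂ), u ≠ 0 → blk h *ᵥ u = (θ : ℂ) • u →
    (∃ u', blk h *ᵥ u' = (θ : ℂ) • u' ∧ star (lcol h) ⬝ᵥ u' ≠ 0) ∨
    ∃ p : Fin n → ℂ, h *ᵥ (Fin.snoc p 1 : Fin (n + 1) → ℂ) =
      (θ : ℂ) • (Fin.snoc p 1 : Fin (n + 1) → ℂ)

/-- Nondegeneracy of all leading principal submatrices. -/
def Nondeg : (n : ℕ) → Matrix (Fin n) (Fin n) ℂ → Prop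
  | 0, _ => True
  | n + 1, h => Nondeg n (blk h) ∧ NondegAt h

section Step

variable {n : ℕ}

/-- Vanishing moments give vanishing sums against every polynomial, in particular against one that
vanishes at all values of `μ` except `θ`. -/
theorem sum_fiber_eq_zero_of_moments {μ r : Fin n → ℝ} (H : ∀ m : ℕ, ∑ i, μ i ^ m * r i = 0)
    (θ : ℝ) : ∑ i with μ i = θ, r i = 0 := by
  have h1 : ∀ q : Polynomial ℝ, ∑ i, q.eval (μ i) * r i = 0 := by
    intro q
    induction q using Polynomial.induction_on' with
    | add p q hp hq => simp only [Polynomial.eval_add, add_mul, Finset.sum_add_distrib, hp, hq,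
        add_zero]
    | monomial m a =>
      simp only [Polynomial.eval_monomial, mul_assoc, ← Finset.mul_sum, H, mul_zero]
  set q : Polynomial ℝ := ∏ η ∈ (Finset.univ.image μ).erase θ, (Polynomial.X - Polynomial.C η)
    with hq
  have h2 := h1 q
  have h3 : q.eval θ ≠ 0 := by
    rw [hq, Polynomial.eval_prod, Finset.prod_ne_zero_iff]
    intro η hη
    simpa [sub_eq_zero] using (Finset.ne_of_mem_erase hη).symm
  have h4 : ∑ i, q.eval (μ i) * r i = q.eval θ * ∑ i with μ i = θ, r i := by
    rw [Finset.mul_sum, Finset.sum_filter]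
    refine Finset.sum_congr rfl fun i _ => ?_
    split_ifs with hi
    · rw [hi]
    · have : q.eval (μ i) = 0 := by
        rw [hq, Polynomial.eval_prod]
        exact Finset.prod_eq_zero (i := μ i) (by simp [hi]) (by simp)
      rw [this, zero_mul]
  rw [h4] at h2
  exact (mul_eq_zero.1 h2).resolve_left h3

/-- These commuting matrices are tests for tangency to the orbit. The product `h * B` has last
column `blk h *ᵥ lcol B + a • lcol h`, with `a` the real corner of `B`; subtracting `a • h` removes
the second term. -/
theorem exists_commuting_with_lcol {h : Matrix (Fin (n + 1)) (Fin (n + 1)) ℂ}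
    (hh : h.IsHermitian) (m : ℕ) : ∃ B : Matrix (Fin (n + 1)) (Fin (n + 1)) ℂ,
      B.IsHermitian ∧ Commute B h ∧ lcol B = (blk h ^ m) *ᵥ lcol h := by
  induction m with
  | zero => exact ⟨h, hh, Commute.refl h, by simp⟩
  | succ m ih =>
    obtain ⟨B, hB, hc, hl⟩ := ih
    set a := B (Fin.last n) (Fin.last n) with ha
    have har : star a = a := hB.apply _ _
    refine ⟨h * B - a • h, ?_, ?_, ?_⟩
    · unfold Matrix.IsHermitian
      rw [conjTranspose_sub, conjTranspose_mul, conjTranspose_smul, hB.eq, hh.eq, har, hc.eq]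
    · exact ((Commute.refl h).mul_left hc).sub_left ((Commute.refl h).smul_left a)
    · have h1 : lcol (h * B) = blk h *ᵥ lcol B + a • lcol h := by
        conv_lhs => rw [eq_bord h, eq_bord B, bord_mul, lcol_bord]
      have h2 : lcol (h * B - a • h) = lcol (h * B) - a • lcol h := rfl
      rw [h2, h1, hl, pow_succ', mulVec_mulVec]; simp

/-- A bracket with `h` is trace-orthogonal to everything commuting with `h`; the pairing with the
preceding matrices is twice this real part. -/
theorem re_dotProduct_pow_mulVec_eq_zero {X h : Matrix (Fin (n + 1)) (Fin (n + 1)) ℂ}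
    {w : Fin n → ℂ} (hh : h.IsHermitian) (hδ : ⁅X, h⁆ = bord 0 w (star w) 0) (m : ℕ) :
    (star w ⬝ᵥ (blk h ^ m) *ᵥ lcol h).re = 0 := by
  obtain ⟨B, hB, hc, hl⟩ := exists_commuting_with_lcol hh m
  have h1 : (⁅X, h⁆ * B).trace = 0 := by
    rw [← neg_eq_zero, ← trace_mul_bracket, Ring.lie_def, mul_sub, trace_sub, ← mul_assoc,
      ← mul_assoc, trace_mul_comm (h * X) B, ← mul_assoc, hc.eq, sub_self]
  rw [hδ, isHermitian_eq_bord hB, bord_mul, trace_bord, hl] at h1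
  simp only [zero_mul, zero_add, add_zero, trace_vecMulVec] at h1
  set z := star w ⬝ᵥ (blk h ^ m) *ᵥ lcol h with hz
  have h2 : w ⬝ᵥ star ((blk h ^ m) *ᵥ lcol h) = star z := by
    rw [hz, star_dotProduct, star_star, dotProduct_comm]
  rw [h2] at h1
  have := congrArg Complex.re h1
  simp at this
  linarith

theorem star_dotProduct_unitary_mulVec {U : Matrix (Fin n) (Fin n) ℂ}
    (hU : U ∈ Matrix.unitaryGroup (Fin n) ℂ) (a b : Fin n → ℂ) :
    star (Uᴴ *ᵥ a) ⬝ᵥ (Uᴴ *ᵥ b) = star a ⬝ᵥ b := by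
  rw [star_mulVec, conjTranspose_conjTranspose, ← dotProduct_mulVec, mulVec_mulVec,
    unitary_mul_conjTranspose hU, one_mulVec]

theorem conjTranspose_mulVec_mulVec {U : Matrix (Fin n) (Fin n) ℂ}
    (hU : U ∈ Matrix.unitaryGroup (Fin n) ℂ) (a : Fin n → ℂ) : Uᴴ *ᵥ (U *ᵥ a) = a := by
  rw [mulVec_mulVec, unitary_conjTranspose_mul hU, one_mulVec]

theorem mulVec_conjTranspose_mulVec {U : Matrix (Fin n) (Fin n) ℂ}
    (hU : U ∈ Matrix.unitaryGroup (Fin n) ℂ) (a : Fin n → ℂ) : U *ᵥ (Uᴴ *ᵥ a) = a := by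
  rw [mulVec_mulVec, unitary_mul_conjTranspose hU, one_mulVec]

/-- The problem splits over the eigenspaces. On each, a skew-Hermitian map taking `v` to `w` exists
when their inner product is imaginary and `w` vanishes whenever `v` does. -/
theorem exists_skew_diagonal_commuting {μ : Fin n → ℝ} {v w : Fin n → ℂ}
    (h1 : ∀ i, (∀ j, μ j = μ i → v j = 0) → w i = 0)
    (h2 : ∀ θ, ∑ i with μ i = θ, (star (w i) * v i).re = 0) :
    ∃ A ∈ skewHermitian n, ⁅A, rdiag μ⁆ = 0 ∧ A *ᵥ v = w := by
  let N : ℝ → ℝ := fun θ => ∑ k with μ k = θ, ‖v k‖ ^ 2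
  let S : ℝ → ℂ := fun θ => ∑ k with μ k = θ, star (w k) * v k
  have hS : ∀ θ, star (S θ) = -S θ := by
    intro θ
    have : (S θ).re = 0 := by simp only [S, Complex.re_sum]; exact h2 θ
    apply Complex.ext <;> simp [this]
  have hN : ∀ θ, ((N θ : ℝ) : ℂ) = ∑ k with μ k = θ, star (v k) * v k := by
    intro θ
    simp only [N]; push_cast
    refine Finset.sum_congr rfl fun k _ => ?_
    rw [← Complex.conj_mul']; rfl
  -- On an eigenspace this is `(w v* - v w*) / N + S v v* / N²` with `N = v* v` and `S = w* v`. The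
  -- last term is skew because `S` is imaginary, and it cancels the error `-(S / N) v` of the first.
  let A : Matrix (Fin n) (Fin n) ℂ := Matrix.of fun i j => if μ i = μ j then
    (w i * star (v j) - v i * star (w j)) / (N (μ i)) + S (μ i) * v i * star (v j) / (N (μ i)) ^ 2
    else 0
  refine ⟨A, ?_, ?_, ?_⟩
  · rw [mem_skewHermitian]
    ext i j
    by_cases hij : μ i = μ j
    · change star (A j i) = -(A i j)
      simp only [A, of_apply, hij, if_true, star_add, star_div₀,
        star_sub, star_mul', star_star, hS, star_pow]
      simp only [Complex.star_def, Complex.conj_ofReal]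
      ring
    · simp [A, hij, Ne.symm hij]
  · ext i j
    rw [bracket_rdiag_apply]
    by_cases hij : μ i = μ j
    · simp [hij]
    · simp [A, hij]
  · ext i
    have h3 : (A *ᵥ v) i = w i * (N (μ i) / N (μ i)) - v i * S (μ i) / N (μ i) +
        S (μ i) * v i * N (μ i) / (N (μ i)) ^ 2 := by
      have e1 : (A *ᵥ v) i = ∑ j with μ j = μ i, (w i * (star (v j) * v j) / N (μ i)
          - v i * (star (w j) * v j) / N (μ i) + S (μ i) * v i * (star (v j) * v j) / N (μ i) ^ 2)
          := by
        simp only [mulVec, dotProduct, Finset.sum_filter]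
        refine Finset.sum_congr rfl fun j _ => ?_
        by_cases hij : μ j = μ i
        · simp only [A, of_apply, hij, if_true]; ring
        · simp [A, hij, Ne.symm hij]
      rw [e1, Finset.sum_add_distrib, Finset.sum_sub_distrib, ← Finset.sum_div, ← Finset.sum_div,
        ← Finset.sum_div, ← Finset.mul_sum, ← Finset.mul_sum, ← Finset.mul_sum, ← hN, mul_div_assoc]
    rw [h3]
    by_cases hz : N (μ i) = 0
    · have : ∀ j, μ j = μ i → v j = 0 := by
        intro j hj
        have := (Finset.sum_eq_zero_iff_of_nonneg (fun k _ => by positivity)).1 hz j (by simp [hj])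
        simpa using this
      rw [h1 i this, hz]; simp
    · have : ((N (μ i) : ℝ) : ℂ) ≠ 0 := by exact_mod_cast hz
      field_simp
      ring

/-- A tangent vector of the orbit with zero block and corner comes from the commutant of the block.
The moments give the orthogonality condition of `exists_skew_diagonal_commuting`, and `NondegAt`
gives the vanishing of `w` where `lcol h` vanishes. -/
theorem exists_commuting_skew {X h : Matrix (Fin (n + 1)) (Fin (n + 1)) ℂ} {w : Fin n → ℂ}
    (hh : h.IsHermitian) (hnd : NondegAt h)
    (hδ : ⁅X, h⁆ = bord 0 w (star w) 0) :
    ∃ A ∈ skewHermitian n, ⁅A, blk h⁆ = 0 ∧ A *ᵥ lcol h = w := by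
  obtain ⟨μ, U, hU, hy⟩ := exists_ueq_rdiag (blk_isHermitian hh)
  have hpow : ∀ m, blk h ^ m = U * (rdiag μ) ^ m * Uᴴ := by
    intro m
    induction m with
    | zero => simp [unitary_mul_conjTranspose hU]
    | succ m ih =>
      rw [pow_succ, ih, hy, pow_succ]
      calc U * rdiag μ ^ m * Uᴴ * (U * rdiag μ * Uᴴ)
          = U * rdiag μ ^ m * (Uᴴ * U) * rdiag μ * Uᴴ := by simp only [mul_assoc]
        _ = _ := by rw [unitary_conjTranspose_mul hU]; simp only [mul_assoc, one_mul]
  have hydiag : ∀ a : Fin n → ℂ, Uᴴ *ᵥ (blk h *ᵥ a) = rdiag μ *ᵥ (Uᴴ *ᵥ a) := by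
    intro a
    rw [hy, mulVec_mulVec, ← mul_assoc, ← mul_assoc, unitary_conjTranspose_mul hU, one_mul,
      mulVec_mulVec]
  set v' := Uᴴ *ᵥ lcol h with hv'
  set w' := Uᴴ *ᵥ w with hw'
  have H2 : ∀ θ, ∑ i with μ i = θ, (star (w' i) * v' i).re = 0 := by
    refine sum_fiber_eq_zero_of_moments fun m => ?_
    have h1 := re_dotProduct_pow_mulVec_eq_zero hh hδ m
    have h2 : Uᴴ *ᵥ (blk h ^ m *ᵥ lcol h) = (rdiag μ) ^ m *ᵥ v' := by
      rw [hpow, mulVec_mulVec, ← mul_assoc, ← mul_assoc, unitary_conjTranspose_mul hU, one_mul,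
        hv', mulVec_mulVec]
    rw [← star_dotProduct_unitary_mulVec hU, h2, diagonal_pow] at h1
    simp only [dotProduct, mulVec_diagonal, Complex.re_sum] at h1
    rw [← h1]
    refine Finset.sum_congr rfl fun i _ => ?_
    have : star (w' i) * (((μ i : ℝ) : ℂ) ^ m * v' i) =
      (((μ i) ^ m : ℝ) : ℂ) * (star (w' i) * v' i) := by push_cast; ring
    simp only [Pi.star_apply, Pi.pow_apply]
    rw [this, Complex.re_ofReal_mul]
  have H1 : ∀ i, (∀ j, μ j = μ i → v' j = 0) → w' i = 0 := by
    intro i hi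
    set u : Fin n → ℂ := U *ᵥ Pi.single i 1 with hu
    have hUu : Uᴴ *ᵥ u = Pi.single i 1 := conjTranspose_mulVec_mulVec hU _
    have hu0 : u ≠ 0 := by
      intro h0
      rw [h0, mulVec_zero] at hUu
      have := congrFun hUu i
      simp at this
    have hyu : blk h *ᵥ u = (μ i : ℂ) • u := by
      have h1 : rdiag μ *ᵥ Pi.single i 1 = (μ i : ℂ) • (Pi.single i 1 : Fin n → ℂ) := by
        rw [diagonal_mulVec_single]
        rw [← Pi.single_smul]; simp
      rw [← mulVec_conjTranspose_mulVec hU (blk h *ᵥ u), hydiag, hUu, h1, mulVec_smul]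
    rcases hnd (μ i) u hu0 hyu with ⟨u', hu', hne⟩ | ⟨p, hp⟩
    · exfalso
      apply hne
      rw [← star_dotProduct_unitary_mulVec hU]
      refine Finset.sum_eq_zero fun j _ => ?_
      by_cases hj : μ j = μ i
      · have := hi j hj
        rw [Pi.star_apply, ← hv', this]; simp
      · have h1 := congrFun (hydiag u') j
        rw [hu', mulVec_smul, mulVec_diagonal] at h1
        simp only [Pi.smul_apply, smul_eq_mul] at h1
        have h2 : ((μ i : ℂ) - μ j) * (Uᴴ *ᵥ u') j = 0 := by rw [sub_mul, h1, sub_self]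
        have h3 : ((μ i : ℂ) - μ j) ≠ 0 := by
          rw [sub_ne_zero]; exact_mod_cast Ne.symm hj
        rw [(mul_eq_zero.1 h2).resolve_left h3, mul_zero]
    · have hvu : star (lcol h) ⬝ᵥ u = 0 := by
        rw [← star_dotProduct_unitary_mulVec hU, hUu, ← hv', dotProduct_single_one, Pi.star_apply,
          hi i rfl, star_zero]
      have h1 : h *ᵥ (Fin.snoc u 0 : Fin (n + 1) → ℂ) =
          (μ i : ℂ) • (Fin.snoc u 0 : Fin (n + 1) → ℂ) := by
        rw [isHermitian_eq_bord hh, bord_mulVec_snoc, hvu, hyu]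
        ext j
        induction j using Fin.lastCases <;> simp
      -- Both `(u, 0)` and `(p, 1)` are eigenvectors of `h` for `μ i`, so a bracket with `h` pairs
      -- them to zero. By `hδ` this pairing is `star u ⬝ᵥ w`.
      have h2 : star (Fin.snoc u 0 : Fin (n + 1) → ℂ) ⬝ᵥ
          (⁅X, h⁆ *ᵥ (Fin.snoc p 1 : Fin (n + 1) → ℂ)) = 0 := by
        have h3 : star (Fin.snoc u 0 : Fin (n + 1) → ℂ) ᵥ* h =
            (μ i : ℂ) • star (Fin.snoc u 0 : Fin (n + 1) → ℂ) := by
          have := congrArg star h1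
          rw [star_mulVec, hh.eq, star_smul] at this
          rw [this]; simp
        rw [Ring.lie_def, sub_mulVec, dotProduct_sub, ← mulVec_mulVec, ← mulVec_mulVec, hp,
          dotProduct_mulVec _ h, h3, mulVec_smul]
        simp
      rw [hδ, bord_mulVec_snoc] at h2
      simp only [zero_mulVec, one_smul, zero_add, zero_mul, add_zero] at h2
      have h4 : star u ⬝ᵥ w = 0 := by
        simp only [dotProduct, Fin.sum_univ_castSucc, Pi.star_apply, Fin.snoc_castSucc,
          Fin.snoc_last, star_zero, zero_mul, add_zero] at h2
        exact h2
      rw [← star_dotProduct_unitary_mulVec hU, hUu, ← hw'] at h4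
      simpa [dotProduct, Pi.single_apply] using h4
  obtain ⟨A', hA', hc, hAv⟩ := exists_skew_diagonal_commuting H1 H2
  refine ⟨U * A' * Uᴴ, conj_mem_skewHermitian hA' U, ?_, ?_⟩
  · rw [hy, conj_bracket_conj hU, hc]; simp
  · rw [← mulVec_mulVec, ← mulVec_mulVec, ← hv', hAv, hw', mulVec_conjTranspose_mulVec hU]

/-- After `extZero Z` is subtracted from `X`, the bracket has zero block, hence zero corner since
its trace is zero. The remaining last column is produced by an element commuting with the block,
which is added to `Z`. -/
theorem exists_extZero_bracket {X h : Matrix (Fin (n + 1)) (Fin (n + 1)) ℂ}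
    {Z : Matrix (Fin n) (Fin n) ℂ}
    (hh : h.IsHermitian) (hnd : NondegAt h) (hX : X ∈ skewHermitian (n + 1))
    (hZ : Z ∈ skewHermitian n) (hXZ : blk ⁅X, h⁆ = ⁅Z, blk h⁆) :
    ∃ A ∈ skewHermitian n, ⁅A, blk h⁆ = ⁅Z, blk h⁆ ∧ ⁅X, h⁆ = ⁅extZero A, h⁆ := by
  set δ := ⁅X - extZero Z, h⁆ with hδ
  have hsk := sub_mem_skewHermitian hX (extZero_mem_skewHermitian hZ)
  have hδh : δ.IsHermitian := bracket_isHermitian hsk hh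
  have hδ' : δ = ⁅X, h⁆ - ⁅extZero Z, h⁆ := by rw [hδ, sub_bracket]
  have hb : blk δ = 0 := by
    have : blk δ = blk ⁅X, h⁆ - blk ⁅extZero Z, h⁆ := by rw [hδ']; rfl
    rw [this, blk_extZero_bracket, hXZ, sub_self]
  have ht : δ (Fin.last n) (Fin.last n) = 0 := by
    have h1 : δ.trace = 0 := by
      rw [hδ, Ring.lie_def, trace_sub, trace_mul_comm, sub_self]
    rw [trace_eq_blk, hb] at h1
    simpa using h1
  have hform : δ = bord 0 (lcol δ) (star (lcol δ)) 0 := by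
    have := isHermitian_eq_bord hδh
    rwa [hb, ht] at this
  obtain ⟨A, hA, hc, hv⟩ := exists_commuting_skew hh hnd hform
  refine ⟨A + Z, add_mem_skewHermitian hA hZ, by rw [add_bracket, hc, zero_add], ?_⟩
  have h1 : ⁅extZero A, h⁆ = δ := by
    have h2 := isHermitian_eq_bord hh
    have h3 : ⁅extZero A, h⁆ = bord ⁅A, blk h⁆ (A *ᵥ lcol h) (-(star (lcol h) ᵥ* A)) 0 := by
      conv_lhs => rw [h2]
      rw [extZero_bracket]
    have h4 := isHermitian_eq_bord (bracket_isHermitian (extZero_mem_skewHermitian hA) hh)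
    rw [hform, h4, h3]
    simp [hc, hv]
  have h5 : extZero (A + Z) = extZero A + extZero Z := by
    rw [extZero, extZero, extZero, bord_add]; simp
  rw [h5, add_bracket, h1, hδ', sub_add_cancel]

theorem kks_extZero (h : Matrix (Fin (n + 1)) (Fin (n + 1)) ℂ) (A B : Matrix (Fin n) (Fin n) ℂ) :
    kks h (extZero A) (extZero B) = kks (blk h) A B := by
  rw [kks_eq, kks_eq, eq_bord h, extZero_bracket, trace_bord_mul_extZero, blk_bord]

end Step

/-- The form is well defined on tangent vectors. -/
theorem kks_congr {n : ℕ} {h X Y X' Y' : Matrix (Fin n) (Fin n) ℂ} (hX : ⁅X, h⁆ = ⁅X', h⁆)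
    (hY : ⁅Y, h⁆ = ⁅Y', h⁆) : kks h X Y = kks h X' Y' := by
  rw [kks_eq, hX, ← kks_eq, kks_comm, kks_eq, hY, ← kks_eq, ← kks_comm]

/-- The isotropic half: both generators can be replaced by elements of the smaller unitary algebra,
and the form becomes that of the smaller block. -/
theorem kks_eq_zero_of_mem_InfFib : ∀ {n : ℕ} {h X Y : Matrix (Fin n) (Fin n) ℂ}, h.IsHermitian →
    Nondeg n h → X ∈ skewHermitian n → Y ∈ skewHermitian n → ⁅X, h⁆ ∈ InfFib n h →
    ⁅Y, h⁆ ∈ InfFib n h → kks h X Y = 0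
  | 0, h, X, Y, _, _, _, _, _, _ => by simp [kks, trace]
  | n + 1, h, X, Y, hh, hnd, hX, hY, hXi, hYi => by
    have key : ∀ W ∈ skewHermitian (n + 1), ⁅W, h⁆ ∈ InfFib (n + 1) h → ∃ A ∈ skewHermitian n,
        ⁅A, blk h⁆ ∈ InfFib n (blk h) ∧ ⁅W, h⁆ = ⁅extZero A, h⁆ := by
      intro W hW hWi
      have h1 : ∃ Z ∈ skewHermitian n, blk ⁅W, h⁆ = ⁅Z, blk h⁆ := by
        -- `InfFib` of size zero carries no bracket, so a block of size zero is treated separately.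
        cases n with
        | zero => exact ⟨0, zero_mem_skewHermitian _, Subsingleton.elim _ _⟩
        | succ n => exact hWi.2.1
      obtain ⟨Z, hZ, hb⟩ := h1
      obtain ⟨A, hA, hAZ, he⟩ := exists_extZero_bracket hh hnd.2 hW hZ hb
      exact ⟨A, hA, by rw [hAZ, ← hb]; exact hWi.2, he⟩
    obtain ⟨A, hA, hAi, hXA⟩ := key X hX hXi
    obtain ⟨B, hB, hBi, hYB⟩ := key Y hY hYi
    rw [kks_congr hXA hYB, kks_extZero]
    exact kks_eq_zero_of_mem_InfFib (blk_isHermitian hh) hnd.1 hA hB hAi hBi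

/-! ### Tangent vectors of fibers -/

section ExpCurve

attribute [local instance] Matrix.linftyOpNormedRing Matrix.linftyOpNormedAlgebra

theorem contDiff_exp_smul_apply {n : ℕ} (B : Matrix (Fin n) (Fin n) ℂ) (i j : Fin n) :
    ContDiff ℝ ∞ fun s : ℝ => NormedSpace.exp (s • B) i j := by
  have h1 : ContDiff ℝ ∞ fun s : ℝ => NormedSpace.exp (s • B) :=
    (contDiff_iff_contDiffAt.2
      fun x => (NormedSpace.exp_analytic (𝕂 := ℝ) x).contDiffAt).comp (contDiff_id.smul contDiff_const)
  exact (LinearMap.toContinuousLinearMap (Matrix.entryLinearMap ℝ ℂ i j)).contDiff.comp h1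

theorem hasDerivAt_exp_smul_apply {n : ℕ} (B : Matrix (Fin n) (Fin n) ℂ) (i j : Fin n) :
    HasDerivAt (fun s : ℝ => NormedSpace.exp (s • B) i j) (B i j) 0 := by
  have h1 := hasDerivAt_exp_smul_const (𝕂 := ℝ) B 0
  rw [zero_smul, NormedSpace.exp_zero, one_mul] at h1
  exact (LinearMap.toContinuousLinearMap
    (Matrix.entryLinearMap ℝ ℂ i j)).hasFDerivAt.comp_hasDerivAt 0 h1

end ExpCurve

section Tangent

variable {n : ℕ}

theorem exp_smul_mem_unitaryGroup {B : Matrix (Fin n) (Fin n) ℂ} (hB : B ∈ skewHermitian n)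
    (s : ℝ) : NormedSpace.exp (s • B) ∈ Matrix.unitaryGroup (Fin n) ℂ := by
  apply unitary_of_conjTranspose_mul
  rw [mem_skewHermitian] at hB
  have h1 : (s • B)ᴴ = -(s • B) := by simp [conjTranspose_smul, hB]
  rw [← Matrix.exp_conjTranspose, h1, ← Matrix.exp_add_of_commute _ _ (Commute.refl (s • B)).neg_left]
  simp

/-- Entrywise smoothness of a family of matrices. -/
def EntryContDiff {E : Type*} [NormedAddCommGroup E] [NormedSpace ℝ E] (g : E → Matrix (Fin n) (Fin n) ℂ) : Prop :=
  ∀ i j, ContDiff ℝ ∞ fun s => g s i j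

/-- Entrywise differentiability of a curve of matrices at `0`. -/
def EntryHasDeriv (g : ℝ → Matrix (Fin n) (Fin n) ℂ) (δ : Matrix (Fin n) (Fin n) ℂ) : Prop :=
  ∀ i j, HasDerivAt (fun s => g s i j) (δ i j) 0

theorem EntryContDiff.mul {E : Type*} [NormedAddCommGroup E] [NormedSpace ℝ E]
    {g g' : E → Matrix (Fin n) (Fin n) ℂ} (hg : EntryContDiff g)
    (hg' : EntryContDiff g') : EntryContDiff fun s => g s * g' s := fun i j => by
  simp only [mul_apply]
  exact ContDiff.sum fun k _ => (hg i k).mul (hg' k j)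

theorem EntryContDiff.conjTranspose {E : Type*} [NormedAddCommGroup E] [NormedSpace ℝ E]
    {g : E → Matrix (Fin n) (Fin n) ℂ} (hg : EntryContDiff g) :
    EntryContDiff fun s => (g s)ᴴ := fun i j => by
  simp only [conjTranspose_apply]
  exact Complex.conjCLE.contDiff.comp (hg j i)

theorem EntryHasDeriv.mul {g g' : ℝ → Matrix (Fin n) (Fin n) ℂ} {δ δ' : Matrix (Fin n) (Fin n) ℂ}
    (hg : EntryHasDeriv g δ) (hg' : EntryHasDeriv g' δ') :
    EntryHasDeriv (fun s => g s * g' s) (δ * g' 0 + g 0 * δ') := fun i j => by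
  simp only [mul_apply, Matrix.add_apply, ← Finset.sum_add_distrib]
  exact HasDerivAt.fun_sum fun k _ => (hg i k).mul (hg' k j)

theorem EntryHasDeriv.conjTranspose {g : ℝ → Matrix (Fin n) (Fin n) ℂ}
    {δ : Matrix (Fin n) (Fin n) ℂ} (hg : EntryHasDeriv g δ) :
    EntryHasDeriv (fun s => (g s)ᴴ) δᴴ := fun i j => by
  simp only [conjTranspose_apply]
  exact (hg j i).star

theorem entryHasDeriv_const (M : Matrix (Fin n) (Fin n) ℂ) : EntryHasDeriv (fun _ => M) 0 :=
  fun _ _ => hasDerivAt_const _ _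

theorem entryContDiff_const {E : Type*} [NormedAddCommGroup E] [NormedSpace ℝ E]
    (M : Matrix (Fin n) (Fin n) ℂ) : EntryContDiff fun _ : E => M :=
  fun _ _ => contDiff_const

theorem EntryHasDeriv.extOne {g : ℝ → Matrix (Fin n) (Fin n) ℂ} {δ : Matrix (Fin n) (Fin n) ℂ}
    (hg : EntryHasDeriv g δ) : EntryHasDeriv (fun s => extOne (g s)) (extZero δ) := by
  intro i j
  induction i using Fin.lastCases with
  | last => induction j using Fin.lastCases with
    | last => simpa using hasDerivAt_const _ _
    | cast j => simpa using hasDerivAt_const _ _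
  | cast i => induction j using Fin.lastCases with
    | last => simpa using hasDerivAt_const _ _
    | cast j => simpa using hg i j

theorem EntryContDiff.extOne {E : Type*} [NormedAddCommGroup E] [NormedSpace ℝ E]
    {g : E → Matrix (Fin n) (Fin n) ℂ}
    (hg : EntryContDiff g) : EntryContDiff (fun s => extOne (g s)) := by
  intro i j
  induction i using Fin.lastCases with
  | last => induction j using Fin.lastCases with
    | last => simpa using contDiff_const
    | cast j => simpa using contDiff_const
  | cast i => induction j using Fin.lastCases with
    | last => simpa using contDiff_const
    | cast j => simpa using hg i j

theorem aeval_conj_rdiag {V : Matrix (Fin n) (Fin n) ℂ} (hV : V ∈ Matrix.unitaryGroup (Fin n) ℂ)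
    (d : Fin n → ℝ) (q : Polynomial ℂ) :
    Polynomial.aeval (V * rdiag d * Vᴴ) q =
      V * Matrix.diagonal (fun i => q.eval (d i : ℂ)) * Vᴴ := by
  induction q using Polynomial.induction_on' with
  | add p q hp hq =>
    rw [map_add, hp, hq, ← add_mul, ← mul_add, diagonal_add]
    simp
  | monomial m a =>
    have hpow : (V * rdiag d * Vᴴ) ^ m = V * (rdiag d) ^ m * Vᴴ := by
      induction m with
      | zero => simp [unitary_mul_conjTranspose hV]
      | succ m ih =>
        rw [pow_succ, ih, pow_succ]
        calc V * rdiag d ^ m * Vᴴ * (V * rdiag d * Vᴴ)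
            = V * rdiag d ^ m * (Vᴴ * V) * rdiag d * Vᴴ := by simp only [mul_assoc]
          _ = _ := by rw [unitary_conjTranspose_mul hV]; simp only [mul_assoc, one_mul]
    rw [Polynomial.aeval_monomial, hpow, diagonal_pow, ← Algebra.smul_def, ← smul_mul_assoc,
      ← mul_smul_comm, ← diagonal_smul]
    congr 3
    ext i
    simp

/-- With `θ = d i` and `q` vanishing at the other eigenvalues but not at `θ`, isospectrality gives
`q(M s) (M s - θ) = 0`. Column `j` of `M 0 - θ` is zero, so dividing by `s` and letting `s → 0`
gives `q(θ) δ i j = 0`. No eigenvector has to be differentiated. -/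
theorem apply_eq_zero_of_isospectral {M : ℝ → Matrix (Fin n) (Fin n) ℂ} {d : Fin n → ℝ}
    {δ : Matrix (Fin n) (Fin n) ℂ} (hM : EntryHasDeriv M δ) (h0 : M 0 = rdiag d)
    (hu : ∀ᶠ s in 𝓝 0, UEq (M s) (rdiag d)) {i j : Fin n} (hij : d i = d j) : δ i j = 0 := by
  set q : Polynomial ℂ := ∏ η ∈ (Finset.univ.image d).erase (d i),
    (Polynomial.X - Polynomial.C (η : ℂ)) with hq
  have hqi : q.eval (d i : ℂ) ≠ 0 := by
    rw [hq, Polynomial.eval_prod, Finset.prod_ne_zero_iff]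
    intro η hη
    simp only [Polynomial.eval_sub, Polynomial.eval_X, Polynomial.eval_C, sub_ne_zero]
    exact_mod_cast (Finset.ne_of_mem_erase hη).symm
  have hqd : ∀ k, q.eval (d k : ℂ) * ((d k : ℂ) - d i) = 0 := by
    intro k
    by_cases hk : d k = d i
    · simp [hk]
    · have : q.eval (d k : ℂ) = 0 := by
        rw [hq, Polynomial.eval_prod]
        exact Finset.prod_eq_zero (i := d k) (by simp [hk]) (by simp)
      rw [this, zero_mul]
  have hann : ∀ᶠ s in 𝓝 0, Polynomial.aeval (M s) q * (M s - (d i : ℂ) • 1) = 0 := by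
    filter_upwards [hu] with s ⟨V, hV, hs⟩
    have h1 : Polynomial.aeval (M s) (q * (Polynomial.X - Polynomial.C (d i : ℂ))) = 0 := by
      rw [hs, aeval_conj_rdiag hV]
      have : (fun k => Polynomial.eval (d k : ℂ) (q * (Polynomial.X - Polynomial.C (d i : ℂ)))) =
        fun _ => 0 := by ext k; simpa using hqd k
      rw [this]; simp
    simpa [Algebra.algebraMap_eq_smul_one] using h1
  have hcont : ContinuousAt M 0 :=
    continuousAt_pi.2 fun a => continuousAt_pi.2 fun b => (hM a b).continuousAt
  have hqc : ContinuousAt (fun s => Polynomial.aeval (M s) q) 0 :=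
    (Polynomial.continuous_aeval q).continuousAt.comp hcont
  have hq0 : Polynomial.aeval (M 0) q = Matrix.diagonal (fun i => q.eval (d i : ℂ)) := by
    have := aeval_conj_rdiag (one_mem (Matrix.unitaryGroup (Fin n) ℂ)) d q
    rw [h0]; simpa using this
  have hlim : Filter.Tendsto (fun s : ℝ => ∑ k, Polynomial.aeval (M s) q i k *
      (s⁻¹ • (M s k j - M 0 k j))) (𝓝[≠] 0) (𝓝 (∑ k, Polynomial.aeval (M 0) q i k * δ k j)) := by
    refine tendsto_finsetSum _ fun k _ => Filter.Tendsto.mul ?_ ?_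
    · have h1 := continuousAt_pi.1 (continuousAt_pi.1 hqc i) k
      exact h1.tendsto.mono_left nhdsWithin_le_nhds
    · have := (hM k j).tendsto_slope_zero
      simpa using this
  have hzero : ∀ᶠ s in 𝓝[≠] (0 : ℝ), ∑ k, Polynomial.aeval (M s) q i k *
      (s⁻¹ • (M s k j - M 0 k j)) = 0 := by
    filter_upwards [hann.filter_mono nhdsWithin_le_nhds] with s hs
    have h1 := congrFun (congrFun hs i) j
    have h2 : ∀ k, M 0 k j = ((d i : ℂ) • (1 : Matrix (Fin n) (Fin n) ℂ)) k j := by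
      intro k
      rw [h0]
      by_cases hk : k = j
      · subst hk; simp [hij]
      · simp [hk]
    simp only [mul_smul_comm, ← Finset.smul_sum, h2]
    rw [mul_apply] at h1
    simp only [Matrix.sub_apply] at h1
    rw [h1]; simp
  have h1 := tendsto_nhds_unique (hlim.congr' hzero) tendsto_const_nhds
  rw [hq0] at h1
  simp only [diagonal_apply, ite_mul, zero_mul, Finset.sum_ite_eq, Finset.mem_univ, if_true] at h1
  exact (mul_eq_zero.1 h1).resolve_left hqi

theorem exists_bracket_of_isospectral {γ : ℝ → Matrix (Fin n) (Fin n) ℂ}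
    {h δ : Matrix (Fin n) (Fin n) ℂ} (hh : h.IsHermitian) (hγ : EntryHasDeriv γ δ) (h0 : γ 0 = h)
    (hu : ∀ᶠ s in 𝓝 0, UEq (γ s) h) : ∃ X ∈ skewHermitian n, δ = ⁅X, h⁆ := by
  have hδ : δ.IsHermitian := by
    ext i j
    have h1 := hγ.conjTranspose i j
    have h2 : (fun s => (γ s)ᴴ i j) =ᶠ[𝓝 0] fun s => γ s i j := by
      filter_upwards [hu] with s hs
      rw [(hs.isHermitian hh).eq]
    exact (h1.congr_of_eventuallyEq h2.symm).unique (hγ i j)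
  obtain ⟨d, U, hU, rfl⟩ := exists_ueq_rdiag hh
  refine exists_bracket_of_apply_eq_zero hU d hδ fun i j hij => ?_
  have hM : EntryHasDeriv (fun s => Uᴴ * γ s * U) (Uᴴ * δ * U) := by
    have := ((entryHasDeriv_const Uᴴ).mul hγ).mul (entryHasDeriv_const U)
    simpa using this
  refine apply_eq_zero_of_isospectral hM (by simp only [h0, unitary_conj_cancel hU]) ?_ hij
  filter_upwards [hu] with s hs
  have h1 := UEq.of_conj (unitary_conjTranspose hU) (γ s)
  rw [conjTranspose_conjTranspose] at h1
  exact h1.trans (hs.trans (UEq.of_conj hU _))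

theorem mem_InfFib_of_hasDeriv : ∀ {n : ℕ} {γ : ℝ → Matrix (Fin n) (Fin n) ℂ}
    {h δ : Matrix (Fin n) (Fin n) ℂ}, h.IsHermitian → EntryHasDeriv γ δ → γ 0 = h →
    (∀ᶠ s in 𝓝 0, γ s ∈ Fib n h) → δ ∈ InfFib n h
  | 0, _, _, _, _, _, _, _ => trivial
  | n + 1, γ, h, δ, hh, hγ, h0, hF =>
    ⟨exists_bracket_of_isospectral hh hγ h0 (hF.mono fun _ hs => hs.1),
      mem_InfFib_of_hasDeriv (γ := fun s => blk (γ s)) (blk_isHermitian hh)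
        (fun i j => hγ i.castSucc j.castSucc) (by rw [h0]) (hF.mono fun _ hs => hs.2)⟩

/-- Infinitesimal solutions integrate: the curve of unitary matrices for the smaller block is
corrected to have the required velocity without changing its action on that block. -/
theorem exists_curve_of_mem_InfFib : ∀ {n : ℕ} {h δ : Matrix (Fin n) (Fin n) ℂ}, h.IsHermitian →
    Nondeg n h → δ ∈ InfFib n h → ∃ (g : ℝ → Matrix (Fin n) (Fin n) ℂ), ∃ Z ∈ skewHermitian n,
      EntryContDiff g ∧ EntryHasDeriv g Z ∧ g 0 = 1 ∧
      (∀ s, g s ∈ Matrix.unitaryGroup (Fin n) ℂ) ∧ δ = ⁅Z, h⁆ ∧ ∀ s, g s * h * (g s)ᴴ ∈ Fib n h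
  | 0, h, δ, _, _, _ => ⟨fun _ => 1, 0, zero_mem_skewHermitian 0, fun _ _ => contDiff_const,
      entryHasDeriv_const _, rfl, fun _ => one_mem _, Subsingleton.elim _ _, fun _ => trivial⟩
  | n + 1, h, δ, hh, hnd, hδ => by
    obtain ⟨⟨X, hX, rfl⟩, hb⟩ := hδ
    obtain ⟨g, Z, hZ, hgc, hgd, hg0, hgu, hZδ, hgF⟩ :=
      exists_curve_of_mem_InfFib (blk_isHermitian hh) hnd.1 hb
    obtain ⟨A, hA, hAZ, hXA⟩ := exists_extZero_bracket hh hnd.2 hX hZ hZδ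
    -- `A` and `Z` have the same bracket with the block, so `exp (s • B)` fixes the block under
    -- conjugation, while it changes the velocity of `g` from `Z` to `A`.
    set B := A - Z with hB
    have hBs : B ∈ skewHermitian n := sub_mem_skewHermitian hA hZ
    have hcomm : Commute B (blk h) := by
      have : ⁅B, blk h⁆ = 0 := by rw [hB, sub_bracket, hAZ, sub_self]
      rwa [Ring.lie_def, sub_eq_zero] at this
    set e : ℝ → Matrix (Fin n) (Fin n) ℂ := fun s => NormedSpace.exp (s • B) with he
    have heu : ∀ s, e s ∈ Matrix.unitaryGroup (Fin n) ℂ := exp_smul_mem_unitaryGroup hBs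
    have hec : ∀ s, e s * blk h * (e s)ᴴ = blk h := by
      intro s
      have : Commute (e s) (blk h) := (hcomm.smul_left s).exp_left
      rw [this.eq, mul_assoc, unitary_mul_conjTranspose (heu s), mul_one]
    have hd : EntryHasDeriv (fun s => g s * e s) A := by
      have h1 := hgd.mul (fun i j => hasDerivAt_exp_smul_apply B i j : EntryHasDeriv e B)
      have h2 : Z * e 0 + g 0 * B = A := by simp [he, hg0, hB]
      rwa [h2] at h1
    refine ⟨fun s => extOne (g s * e s), extZero A, extZero_mem_skewHermitian hA, ?_, hd.extOne,
      ?_, fun s => extOne_mem (mul_mem (hgu s) (heu s)), hXA, fun s => ⟨?_, ?_⟩⟩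
    · exact (hgc.mul fun i j => contDiff_exp_smul_apply B i j).extOne
    · simp only [hg0, he, zero_smul, NormedSpace.exp_zero, mul_one]; exact bord_one
    · exact UEq.of_conj (extOne_mem (mul_mem (hgu s) (heu s))) h
    · rw [blk_extOne_conj, conjTranspose_mul]
      have : g s * e s * blk h * ((e s)ᴴ * (g s)ᴴ) = g s * (e s * blk h * (e s)ᴴ) * (g s)ᴴ := by
        simp only [mul_assoc]
      rw [this, hec]
      exact hgF s

attribute [local instance] Matrix.normedAddCommGroup Matrix.normedSpace

theorem hasDerivAt_matrix_iff {γ : ℝ → Matrix (Fin n) (Fin n) ℂ} {δ : Matrix (Fin n) (Fin n) ℂ} :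
    HasDerivAt γ δ 0 ↔ EntryHasDeriv γ δ :=
  Iff.trans (hasDerivAt_pi (E' := fun _ : Fin n => Fin n → ℂ))
    (forall_congr' fun _ => hasDerivAt_pi (E' := fun _ : Fin n => ℂ))

theorem contDiff_matrix_iff {E : Type*} [NormedAddCommGroup E] [NormedSpace ℝ E]
    {γ : E → Matrix (Fin n) (Fin n) ℂ} :
    ContDiff ℝ ∞ γ ↔ EntryContDiff γ :=
  Iff.trans (contDiff_pi (F' := fun _ : Fin n => Fin n → ℂ))
    (forall_congr' fun _ => contDiff_pi (F' := fun _ : Fin n => ℂ))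

theorem tangentVectors_Fib {h : Matrix (Fin n) (Fin n) ℂ} (hh : h.IsHermitian)
    (hnd : Nondeg n h) : tangentVectors (Fib n h) h = InfFib n h := by
  ext δ
  constructor
  · rintro ⟨γ, -, hF, h0, hd⟩
    have hd' : EntryHasDeriv γ δ := hasDerivAt_matrix_iff.1 hd
    exact mem_InfFib_of_hasDeriv hh hd' h0 hF
  · intro hδ
    obtain ⟨g, Z, hZ, hgc, hgd, hg0, hgu, hZδ, hgF⟩ := exists_curve_of_mem_InfFib hh hnd hδ
    have hc : EntryContDiff fun s => g s * h * (g s)ᴴ :=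
      (hgc.mul (entryContDiff_const h)).mul hgc.conjTranspose
    have hd : EntryHasDeriv (fun s => g s * h * (g s)ᴴ) δ := by
      have h1 := (hgd.mul (entryHasDeriv_const h)).mul hgd.conjTranspose
      rw [mem_skewHermitian] at hZ
      have h2 : (Z * h + g 0 * 0) * (g 0)ᴴ + g 0 * h * Zᴴ = δ := by
        rw [hg0, hZ, hZδ, Ring.lie_def]; simp [sub_eq_add_neg]
      rwa [h2] at h1
    refine ⟨fun s => g s * h * (g s)ᴴ, ?_, Filter.Eventually.of_forall hgF, by simp [hg0], ?_⟩
    · exact (contDiff_matrix_iff.2 hc).contDiffAt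
    · exact hasDerivAt_matrix_iff.2 hd

theorem lagrangian_condition_Fib {h : Matrix (Fin n) (Fin n) ℂ} (hh : h.IsHermitian)
    (hnd : Nondeg n h) {X : Matrix (Fin n) (Fin n) ℂ} (hX : X ∈ skewHermitian n) :
    ⁅X, h⁆ ∈ tangentVectors (Fib n h) h ↔
      ∀ Y ∈ skewHermitian n, ⁅Y, h⁆ ∈ tangentVectors (Fib n h) h → kks h X Y = 0 := by
  rw [tangentVectors_Fib hh hnd]
  constructor
  · exact fun h1 Y hY h2 => kks_eq_zero_of_mem_InfFib hh hnd hX hY h1 h2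
  · intro H
    refine mem_InfFib_of_trace hh (bracket_isHermitian hX hh) fun Y hY hi => ?_
    apply Complex.ext
    · exact trace_re_eq_zero (bracket_isHermitian hX hh) hY
    · have := H Y hY hi
      rwa [kks_eq] at this

end Tangent

/-! ### Eigenspaces of bordered matrices -/

section Eigenspace

variable {n : ℕ}

/-- The eigenspace of a matrix for a real number. -/
def eigSp (x : Matrix (Fin n) (Fin n) ℂ) (θ : ℝ) : Submodule ℂ (Fin n → ℂ) :=
  LinearMap.ker (x - (θ : ℂ) • (1 : Matrix (Fin n) (Fin n) ℂ)).mulVecLin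

theorem mem_eigSp {x : Matrix (Fin n) (Fin n) ℂ} {θ : ℝ} {u : Fin n → ℂ} :
    u ∈ eigSp x θ ↔ x *ᵥ u = (θ : ℂ) • u := by
  simp [eigSp, sub_eq_zero]

theorem UEq.finrank_eigSp {x y : Matrix (Fin n) (Fin n) ℂ} (h : UEq x y) (θ : ℝ) :
    Module.finrank ℂ (eigSp x θ) = Module.finrank ℂ (eigSp y θ) := by
  have key : ∀ {x y : Matrix (Fin n) (Fin n) ℂ}, UEq x y →
      Module.finrank ℂ (eigSp x θ) ≤ Module.finrank ℂ (eigSp y θ) := by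
    rintro x y ⟨U, hU, rfl⟩
    let f : eigSp (U * y * Uᴴ) θ →ₗ[ℂ] eigSp y θ :=
      (Uᴴ.mulVecLin).restrict fun u hu => by
        rw [mem_eigSp] at hu ⊢
        rw [mulVecLin_apply, ← mulVec_smul, ← hu, mulVec_mulVec, mulVec_mulVec, ← mul_assoc,
          ← mul_assoc, unitary_conjTranspose_mul hU, one_mul]
    refine LinearMap.finrank_le_finrank_of_injective (f := f) fun a b hab => ?_
    have h1 : Uᴴ *ᵥ (a : Fin n → ℂ) = Uᴴ *ᵥ (b : Fin n → ℂ) := congrArg Subtype.val hab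
    have h2 := congrArg (U *ᵥ ·) h1
    simp only [mulVec_conjTranspose_mulVec hU] at h2
    exact Subtype.ext h2
  exact le_antisymm (key h) (key h.symm)

theorem finrank_eigSp_rdiag (d : Fin n → ℝ) (θ : ℝ) :
    Module.finrank ℂ (eigSp (rdiag d) θ) = Fintype.card {i // d i = θ} := by
  have h1 : rdiag d - (θ : ℂ) • (1 : Matrix (Fin n) (Fin n) ℂ) =
      Matrix.diagonal fun i => (d i : ℂ) - θ := by
    rw [← Matrix.diagonal_one, ← diagonal_smul, diagonal_sub]
    congr 1; ext i; simp
  have h2 := LinearMap.finrank_range_add_finrank_ker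
    (rdiag d - (θ : ℂ) • (1 : Matrix (Fin n) (Fin n) ℂ)).mulVecLin
  have h3 : Module.finrank ℂ (LinearMap.range
      (rdiag d - (θ : ℂ) • (1 : Matrix (Fin n) (Fin n) ℂ)).mulVecLin) =
      Fintype.card {i // ¬ d i = θ} := by
    change Matrix.rank _ = _
    rw [h1, rank_diagonal]
    refine Fintype.card_congr (Equiv.subtypeEquivRight fun i => ?_)
    rw [not_iff_not, sub_eq_zero]; norm_cast
  rw [h3, Module.finrank_fin_fun] at h2
  have h4 := Fintype.card_subtype_compl (fun i => d i = θ)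
  have h5 := Fintype.card_subtype_le (fun i => d i = θ)
  rw [Fintype.card_fin] at h4 h5
  have h6 : Module.finrank ℂ (eigSp (rdiag d) θ) = Module.finrank ℂ (LinearMap.ker
    (rdiag d - (θ : ℂ) • (1 : Matrix (Fin n) (Fin n) ℂ)).mulVecLin) := rfl
  omega

theorem eigSp_eq_bot_iff {x : Matrix (Fin n) (Fin n) ℂ} {θ : ℝ} :
    eigSp x θ = ⊥ ↔ ∀ u, x *ᵥ u = (θ : ℂ) • u → u = 0 := by
  simp only [Submodule.eq_bot_iff, mem_eigSp]

theorem star_dotProduct_eq_of_eigenvector {x : Matrix (Fin n) (Fin n) ℂ} (hx : x.IsHermitian)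
    {θ : ℝ} {u : Fin n → ℂ} (hu : x *ᵥ u = (θ : ℂ) • u) (p : Fin n → ℂ) :
    star u ⬝ᵥ (x *ᵥ p) = θ * (star u ⬝ᵥ p) := by
  have h1 := congrArg star hu
  rw [star_mulVec, hx.eq, star_smul] at h1
  rw [dotProduct_mulVec, h1]; simp

theorem mulVec_snoc_eq {h : Matrix (Fin (n + 1)) (Fin (n + 1)) ℂ} (hh : h.IsHermitian)
    (p : Fin n → ℂ) (a : ℂ) : h *ᵥ (Fin.snoc p a : Fin (n + 1) → ℂ) =
      (Fin.snoc (blk h *ᵥ p + a • lcol h)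
        (star (lcol h) ⬝ᵥ p + h (Fin.last n) (Fin.last n) * a) : Fin (n + 1) → ℂ) := by
  conv_lhs => rw [isHermitian_eq_bord hh]
  rw [bord_mulVec_snoc]

theorem smul_snoc (c a : ℂ) (p : Fin n → ℂ) : c • (Fin.snoc p a : Fin (n + 1) → ℂ) =
    (Fin.snoc (c • p) (c * a) : Fin (n + 1) → ℂ) := by
  ext j; induction j using Fin.lastCases <;> simp

theorem snoc_zero_mem_eigSp {h : Matrix (Fin (n + 1)) (Fin (n + 1)) ℂ} (hh : h.IsHermitian)
    {θ : ℝ} {u : Fin n → ℂ} (hu : blk h *ᵥ u = (θ : ℂ) • u) (hv : star (lcol h) ⬝ᵥ u = 0) :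
    h *ᵥ (Fin.snoc u 0 : Fin (n + 1) → ℂ) = (θ : ℂ) • (Fin.snoc u 0 : Fin (n + 1) → ℂ) := by
  rw [mulVec_snoc_eq hh, hu, hv, smul_snoc]; simp

theorem lcol_orthogonal_of_eigenvector {h : Matrix (Fin (n + 1)) (Fin (n + 1)) ℂ}
    (hh : h.IsHermitian) {θ : ℝ} {p u : Fin n → ℂ}
    (hp : h *ᵥ (Fin.snoc p 1 : Fin (n + 1) → ℂ) = (θ : ℂ) • (Fin.snoc p 1 : Fin (n + 1) → ℂ))
    (hu : blk h *ᵥ u = (θ : ℂ) • u) : star (lcol h) ⬝ᵥ u = 0 := by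
  rw [mulVec_snoc_eq hh, smul_snoc] at hp
  have h1 : blk h *ᵥ p + lcol h = (θ : ℂ) • p := by
    ext i
    have := congrFun hp i.castSucc
    simpa using this
  have h2 : star u ⬝ᵥ lcol h = 0 := by
    have h3 := congrArg (star u ⬝ᵥ ·) h1
    simp only [dotProduct_add, star_dotProduct_eq_of_eigenvector (blk_isHermitian hh) hu,
      dotProduct_smul, smul_eq_mul] at h3
    simpa using h3
  rw [star_dotProduct, h2, star_zero]

/-- Every eigenvalue has an eigenvector whose last coordinate does not vanish. -/
def RegAt (h : Matrix (Fin (n + 1)) (Fin (n + 1)) ℂ) : Prop :=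
  ∀ θ : ℝ, eigSp h θ ≠ ⊥ → ∃ p : Fin n → ℂ, h *ᵥ (Fin.snoc p 1 : Fin (n + 1) → ℂ) =
      (θ : ℂ) • (Fin.snoc p 1 : Fin (n + 1) → ℂ)

/-- Given an eigenvector `(p, 1)`, the last column is orthogonal to the eigenspace of the block,
which therefore embeds by `u ↦ (u, 0)` and misses `(p, 1)`. Without one, all eigenvectors end in
zero and embed into the eigenspace of the block. Stated through dimensions, regularity is visibly
constant along the fiber. -/
theorem regAt_iff_finrank {h : Matrix (Fin (n + 1)) (Fin (n + 1)) ℂ} (hh : h.IsHermitian) :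
    RegAt h ↔ ∀ θ : ℝ, eigSp h θ ≠ ⊥ →
      Module.finrank ℂ (eigSp (blk h) θ) < Module.finrank ℂ (eigSp h θ) := by
  refine forall_congr' fun θ => imp_congr_right fun _ => ⟨?_, ?_⟩
  · rintro ⟨p, hp⟩
    let f : (Fin n → ℂ) →ₗ[ℂ] (Fin (n + 1) → ℂ) :=
      { toFun := fun u => Fin.snoc u 0
        map_add' := fun a b => by ext j; induction j using Fin.lastCases <;> simp
        map_smul' := fun c a => by ext j; induction j using Fin.lastCases <;> simp }
    have hf : Function.Injective f := fun a b hab => by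
      ext i; simpa [f] using congrFun hab i.castSucc
    rw [(Submodule.equivMapOfInjective f hf _).finrank_eq]
    refine Submodule.finrank_lt_finrank_of_lt (lt_of_le_of_ne ?_ fun heq => ?_)
    · rintro _ ⟨u, hu, rfl⟩
      have hu' := mem_eigSp.1 hu
      exact mem_eigSp.2 (snoc_zero_mem_eigSp hh hu' (lcol_orthogonal_of_eigenvector hh hp hu'))
    · have h1 : (Fin.snoc p 1 : Fin (n + 1) → ℂ) ∈ eigSp h θ := mem_eigSp.2 hp
      rw [← heq] at h1
      obtain ⟨u, -, hu⟩ := h1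
      have := congrFun hu (Fin.last n)
      simp [f] at this
  · intro hlt
    by_contra hne
    push Not at hne
    have hlast : ∀ u ∈ eigSp h θ, u (Fin.last n) = 0 := by
      intro u hu
      by_contra h0
      refine hne (fun i => (u (Fin.last n))⁻¹ * u i.castSucc) ?_
      have h1 : (Fin.snoc (fun i => (u (Fin.last n))⁻¹ * u i.castSucc) 1 : Fin (n + 1) → ℂ) =
          (u (Fin.last n))⁻¹ • u := by
        ext j; induction j using Fin.lastCases <;> simp [h0]
      rw [h1, mulVec_smul, mem_eigSp.1 hu, smul_comm]
    let f : eigSp h θ →ₗ[ℂ] eigSp (blk h) θ :=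
      (LinearMap.funLeft ℂ ℂ Fin.castSucc).restrict fun u hu => by
        have h0 := hlast u hu
        rw [mem_eigSp] at hu ⊢
        ext i
        have h1 := congrFun hu i.castSucc
        simp only [mulVec, dotProduct, Fin.sum_univ_castSucc, h0, mul_zero, add_zero] at h1
        simpa [mulVec, dotProduct, LinearMap.funLeft] using h1
    refine absurd (LinearMap.finrank_le_finrank_of_injective (f := f) fun a b hab => ?_) hlt.not_ge
    have h1 : LinearMap.funLeft ℂ ℂ Fin.castSucc (a : Fin (n + 1) → ℂ) =
      LinearMap.funLeft ℂ ℂ Fin.castSucc (b : Fin (n + 1) → ℂ) := congrArg Subtype.val hab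
    apply Subtype.ext
    ext j
    induction j using Fin.lastCases with
    | last => rw [hlast _ a.2, hlast _ b.2]
    | cast i => exact congrFun h1 i

theorem RegAt.of_ueq {h x : Matrix (Fin (n + 1)) (Fin (n + 1)) ℂ} (hh : h.IsHermitian)
    (hr : RegAt h) (hx : UEq x h) (hb : UEq (blk x) (blk h)) : RegAt x := by
  rw [regAt_iff_finrank (hx.isHermitian hh)]
  rw [regAt_iff_finrank hh] at hr
  intro θ hθ
  rw [hx.finrank_eigSp, hb.finrank_eigSp]
  refine hr θ fun h0 => hθ ?_
  rw [← Submodule.finrank_eq_zero] at h0 ⊢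
  rw [hx.finrank_eigSp, h0]

/-- An eigenvector of the block orthogonal to the last column pads to an eigenvector of `h`, so
pairing with the last column is injective here. -/
theorem finrank_eigSp_blk_le_one {h : Matrix (Fin (n + 1)) (Fin (n + 1)) ℂ} (hh : h.IsHermitian)
    {θ : ℝ} (h0 : eigSp h θ = ⊥) : Module.finrank ℂ (eigSp (blk h) θ) ≤ 1 := by
  let f : eigSp (blk h) θ →ₗ[ℂ] ℂ :=
    (dotProductBilin ℂ ℂ (star (lcol h))).comp (eigSp (blk h) θ).subtype
  have hf : Function.Injective f := by
    rw [injective_iff_map_eq_zero]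
    rintro ⟨u, hu⟩ h1
    have h2 := eigSp_eq_bot_iff.1 h0 _ (snoc_zero_mem_eigSp hh (mem_eigSp.1 hu) h1)
    ext i
    simpa using congrFun h2 i.castSucc
  simpa using LinearMap.finrank_le_finrank_of_injective hf

theorem RegAt.nondegAt {h : Matrix (Fin (n + 1)) (Fin (n + 1)) ℂ} (hh : h.IsHermitian)
    (hr : RegAt h) : NondegAt h := by
  intro θ u hu0 hu
  by_cases hv : star (lcol h) ⬝ᵥ u = 0
  · refine Or.inr (hr θ fun hb => hu0 ?_)
    have h2 := eigSp_eq_bot_iff.1 hb _ (snoc_zero_mem_eigSp hh hu hv)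
    ext i
    simpa using congrFun h2 i.castSucc
  · exact Or.inl ⟨u, hu, hv⟩

end Eigenspace

/-! ### Base points -/

/-- The `2 × 2` block is scalar, the `3 × 3` block is not, and all larger blocks are regular. -/
def Good : (k : ℕ) → Matrix (Fin (k + 3)) (Fin (k + 3)) ℂ → Prop
  | 0, h => (∃ c : ℝ, blk h = (c : ℂ) • 1) ∧ lcol h ≠ 0
  | k + 1, h => Good k (blk h) ∧ RegAt h

theorem blk_smul_one {n : ℕ} (c : ℂ) :
    blk (c • (1 : Matrix (Fin (n + 1)) (Fin (n + 1)) ℂ)) = c • 1 := by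
  ext i j
  simp [one_apply]

theorem smul_one_mulVec_eq_iff {n : ℕ} {c θ : ℝ} {u : Fin n → ℂ} (hu0 : u ≠ 0) :
    ((c : ℂ) • (1 : Matrix (Fin n) (Fin n) ℂ)) *ᵥ u = (θ : ℂ) • u ↔ c = θ := by
  rw [smul_mulVec, one_mulVec]
  refine ⟨fun h => ?_, fun h => by rw [h]⟩
  exact_mod_cast smul_left_injective ℂ hu0 h

theorem nondeg_two_smul_one (c : ℝ) : Nondeg 2 ((c : ℂ) • 1) := by
  refine ⟨⟨trivial, fun θ u hu0 => absurd (Subsingleton.elim _ _) hu0⟩, fun θ u hu0 hu => ?_⟩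
  rw [blk_smul_one, smul_one_mulVec_eq_iff hu0] at hu
  subst hu
  exact Or.inr ⟨0, by rw [smul_mulVec, one_mulVec]⟩

-- Over the scalar `2 × 2` block, the last column is itself an eigenvector and pairs nontrivially
-- with itself. Inside the scalar block, the last basis vector is an eigenvector with nonzero last
-- coordinate. Larger blocks are nondegenerate by regularity.
open scoped ComplexOrder in
theorem Good.nondeg : ∀ {k : ℕ} {h : Matrix (Fin (k + 3)) (Fin (k + 3)) ℂ}, h.IsHermitian →
    Good k h → Nondeg (k + 3) h
  | 0, h, hh, ⟨⟨c, hc⟩, hv⟩ => by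
    refine ⟨by rw [hc]; exact nondeg_two_smul_one c, fun θ u hu0 hu => Or.inl ⟨lcol h, ?_, ?_⟩⟩
    · rw [hc, smul_one_mulVec_eq_iff hu0] at hu
      rw [hc, smul_mulVec, one_mulVec, hu]
    · rwa [Ne, dotProduct_star_self_eq_zero]
  | k + 1, h, hh, ⟨hg, hr⟩ => ⟨Good.nondeg (blk_isHermitian hh) hg, hr.nondegAt hh⟩

/-- The traces of a matrix and its square, compared with those of the block, determine the corner
and then the norm of the last column. -/
theorem sum_norm_lcol_sq_eq {n : ℕ} {x h : Matrix (Fin (n + 1)) (Fin (n + 1)) ℂ}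
    (hh : h.IsHermitian) (hx : UEq x h) (hb : UEq (blk x) (blk h)) :
    ∑ i, ‖lcol x i‖ ^ 2 = ∑ i, ‖lcol h i‖ ^ 2 := by
  have hsq : ∀ {m : ℕ} {a b : Matrix (Fin m) (Fin m) ℂ}, UEq a b → UEq (a * a) (b * b) := by
    rintro m _ b ⟨U, hU, rfl⟩
    refine ⟨U, hU, ?_⟩
    calc U * b * Uᴴ * (U * b * Uᴴ) = U * b * (Uᴴ * U) * b * Uᴴ := by simp only [mul_assoc]
      _ = _ := by rw [unitary_conjTranspose_mul hU]; simp only [mul_assoc, one_mul]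
  have htr : ∀ {z : Matrix (Fin (n + 1)) (Fin (n + 1)) ℂ}, z.IsHermitian →
      (z * z).trace = (blk z * blk z).trace + 2 * ((∑ i, ‖lcol z i‖ ^ 2 : ℝ) : ℂ) +
        z (Fin.last n) (Fin.last n) ^ 2 := by
    intro z hz
    have h1 : star (lcol z) ⬝ᵥ lcol z = ((∑ i, ‖lcol z i‖ ^ 2 : ℝ) : ℂ) := by
      push_cast
      exact Finset.sum_congr rfl fun i _ => Complex.conj_mul' _
    conv_lhs => rw [isHermitian_eq_bord hz, bord_mul, trace_bord]
    rw [trace_add, trace_vecMulVec, dotProduct_comm, h1]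
    ring
  have hc : x (Fin.last n) (Fin.last n) = h (Fin.last n) (Fin.last n) := by
    have h1 := hx.trace_eq
    rw [trace_eq_blk, trace_eq_blk h, hb.trace_eq] at h1
    exact add_left_cancel h1
  have h1 := (hsq hx).trace_eq
  rw [htr (hx.isHermitian hh), htr hh, (hsq hb).trace_eq, hc] at h1
  have h2 := mul_left_cancel₀ two_ne_zero (add_left_cancel (add_right_cancel h1))
  exact_mod_cast h2

/-- Needed because the Lagrangian condition is checked at every point of the fiber. -/
theorem Good.of_mem_Fib : ∀ {k : ℕ} {h x : Matrix (Fin (k + 3)) (Fin (k + 3)) ℂ}, h.IsHermitian →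
    Good k h → x ∈ Fib (k + 3) h → Good k x
  | 0, h, x, hh, ⟨⟨c, hc⟩, hv⟩, hx => by
    have h1 : UEq (blk x) (blk h) := UEq.of_mem_Fib hx.2
    refine ⟨⟨c, ?_⟩, fun h0 => hv ?_⟩
    · rw [hc] at h1; exact h1.smul_one
    · have h2 := sum_norm_lcol_sq_eq hh hx.1 h1
      rw [h0] at h2
      simp only [Pi.zero_apply, norm_zero, ne_eq, OfNat.ofNat_ne_zero, not_false_eq_true,
        zero_pow, Finset.sum_const_zero] at h2
      ext i
      have := (Finset.sum_eq_zero_iff_of_nonneg (fun k _ => by positivity)).1 h2.symm i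
        (Finset.mem_univ i)
      simpa using this
  | k + 1, h, x, hh, ⟨hg, hr⟩, hx =>
    ⟨Good.of_mem_Fib (blk_isHermitian hh) hg hx.2, hr.of_ueq hh hx.1 (UEq.of_mem_Fib hx.2)⟩

/-! ### Existence of base points -/

theorem exists_unitary_last_row_ne_zero (n : ℕ) :
    ∃ U ∈ Matrix.unitaryGroup (Fin (n + 1)) ℂ, ∀ i, U (Fin.last n) i ≠ 0 := by
  -- `U` will be the Householder reflection in `w`. Its last row has no zero because `w` has none
  -- and `w ⬝ᵥ w = n + (n + 1) ^ 2` differs from `2 * (n + 1) ^ 2`.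
  set w : Fin (n + 1) → ℂ := Fin.snoc (fun _ : Fin n => (1 : ℂ)) (n + 1 : ℂ) with hw
  have hww : w ⬝ᵥ w = n + (n + 1) ^ 2 := by
    simp [hw, dotProduct, Fin.sum_univ_castSucc]; ring
  have hne : w ⬝ᵥ w ≠ 0 := by
    rw [hww]; norm_cast; positivity
  have hsw : star w = w := by
    ext i; induction i using Fin.lastCases <;> simp [hw]
  set U : Matrix (Fin (n + 1)) (Fin (n + 1)) ℂ := 1 - (2 / (w ⬝ᵥ w)) • vecMulVec w w with hU
  have hr : star (2 / (w ⬝ᵥ w)) = 2 / (w ⬝ᵥ w) := by rw [hww]; simp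
  have hUh : Uᴴ = U := by
    rw [hU, conjTranspose_sub, conjTranspose_smul, conjTranspose_vecMulVec, hsw, hr]; simp
  refine ⟨U, unitary_of_conjTranspose_mul ?_, fun i => ?_⟩
  · rw [hUh, hU]
    have h1 : vecMulVec w w * vecMulVec w w = (w ⬝ᵥ w) • vecMulVec w w := by
      rw [vecMulVec_mul_vecMulVec]; ext i j; simp [vecMulVec_apply]; ring
    rw [sub_mul, mul_sub, mul_sub, smul_mul_smul_comm, h1, smul_smul]
    have h2 : 2 / (w ⬝ᵥ w) * (2 / (w ⬝ᵥ w)) * (w ⬝ᵥ w) = 2 / (w ⬝ᵥ w) + 2 / (w ⬝ᵥ w) := by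
      field_simp; ring
    rw [h2, add_smul]; simp
  · have hU' : U (Fin.last n) i = (1 : Matrix (Fin (n + 1)) (Fin (n + 1)) ℂ) (Fin.last n) i -
      2 / (w ⬝ᵥ w) * (w (Fin.last n) * w i) := rfl
    have hl : w (Fin.last n) = n + 1 := by simp [hw]
    rw [hU', hl]
    induction i using Fin.lastCases with
    | last =>
      rw [hl, one_apply_eq]
      intro h0
      have h1 : (w ⬝ᵥ w) = 2 * ((n + 1) * (n + 1)) := by
        field_simp at h0
        linear_combination h0
      rw [hww] at h1
      have h2 : (n : ℂ) = (n + 1) ^ 2 := by linear_combination h1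
      have h3 : n = (n + 1) ^ 2 := by exact_mod_cast h2
      nlinarith
    | cast i =>
      have : w i.castSucc = 1 := by simp [hw]
      rw [this, one_apply_ne (Fin.castSucc_ne_last i).symm]
      have h1 : (n + 1 : ℂ) ≠ 0 := by norm_cast
      rw [zero_sub, neg_ne_zero]
      exact mul_ne_zero (div_ne_zero two_ne_zero hne) (mul_ne_zero h1 one_ne_zero)

/-- The columns of `U` are eigenvectors; they are rescaled to end in `1`. -/
theorem regAt_of_last_row {n : ℕ} {U : Matrix (Fin (n + 1)) (Fin (n + 1)) ℂ}
    (hU : U ∈ Matrix.unitaryGroup (Fin (n + 1)) ℂ) (hl : ∀ i, U (Fin.last n) i ≠ 0)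
    (d : Fin (n + 1) → ℝ) : RegAt (U * rdiag d * Uᴴ) := by
  intro θ hθ
  have h1 : ∃ i, d i = θ := by
    by_contra! hne
    apply hθ
    rw [← Submodule.finrank_eq_zero, (UEq.of_conj hU _).finrank_eigSp, finrank_eigSp_rdiag,
      Fintype.card_eq_zero_iff]
    exact ⟨fun i => hne i.1 i.2⟩
  obtain ⟨i, rfl⟩ := h1
  set u : Fin (n + 1) → ℂ := fun j => U j i with hu
  have hui : u = U *ᵥ Pi.single i 1 := by
    ext j; simp [hu]
  have h2 : (U * rdiag d * Uᴴ) *ᵥ u = (d i : ℂ) • u := by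
    rw [hui, mulVec_mulVec, mul_assoc, unitary_conjTranspose_mul hU, mul_one, ← mulVec_mulVec,
      diagonal_mulVec_single, mul_one, ← mulVec_smul, ← Pi.single_smul]
    simp
  refine ⟨fun j => (u (Fin.last n))⁻¹ * u j.castSucc, ?_⟩
  have h3 : (Fin.snoc (fun i => (u (Fin.last n))⁻¹ * u i.castSucc) 1 : Fin (n + 1) → ℂ) =
      (u (Fin.last n))⁻¹ • u := by
    ext j; induction j using Fin.lastCases <;> simp [hu, hl i]
  rw [h3, mulVec_smul, h2, smul_comm]

theorem exists_good_three {a b c : ℝ} (hbc : b < c) (hca : c < a) :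
    ∃ h : Matrix (Fin 3) (Fin 3) ℂ, h.IsHermitian ∧ Good 0 h ∧
      h.charpoly = (Polynomial.X - Polynomial.C (b : ℂ)) * (Polynomial.X - Polynomial.C (c : ℂ)) *
        (Polynomial.X - Polynomial.C (a : ℂ)) := by
  set s : ℝ := √((a - c) * (c - b)) with hs
  have hpos : 0 < (a - c) * (c - b) := mul_pos (by linarith) (by linarith)
  have hss : (s : ℂ) * s = (a - c) * (c - b) := by
    have := Real.mul_self_sqrt hpos.le
    rw [← hs] at this
    exact_mod_cast this
  have hs0 : (s : ℂ) ≠ 0 := by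
    have := (Real.sqrt_pos.2 hpos).ne'
    exact_mod_cast this
  -- The second basis vector has eigenvalue `c`. On the span of the other two the trace is `a + b`
  -- and the determinant is `c (a + b - c) - s² = a b`.
  refine ⟨!![(c : ℂ), 0, s; 0, c, 0; s, 0, (a + b - c : ℝ)], ?_, ⟨⟨c, ?_⟩, fun h0 => ?_⟩, ?_⟩
  · ext i j
    fin_cases i <;> fin_cases j <;> simp
  · ext i j
    fin_cases i <;> fin_cases j <;> simp [blk]
  · have := congrFun h0 0
    simp [lcol, hs0, Fin.last] at this
  · rw [Matrix.charpoly, det_fin_three]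
    simp only [charmatrix_apply]
    have hC : (Polynomial.C (s : ℂ)) * Polynomial.C (s : ℂ) =
        (Polynomial.C (a : ℂ) - Polynomial.C (c : ℂ)) *
          (Polynomial.C (c : ℂ) - Polynomial.C (b : ℂ)) := by
      rw [← map_mul, hss]; simp
    simp
    linear_combination (-(Polynomial.X - Polynomial.C (c : ℂ))) * hC

theorem exists_good : ∀ (k : ℕ) (l : Fin (k + 3) → ℝ),
    (∀ θ, Fintype.card {i // l i = θ} + 2 ≤ k + 3) →
    ∃ h : Matrix (Fin (k + 3)) (Fin (k + 3)) ℂ, UEq h (rdiag l) ∧ Good k h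
  | 0, l, hl => by
    have hinj : Function.Injective l := by
      intro i j hij
      have h1 := hl (l j)
      have h2 : Fintype.card {i // l i = l j} ≤ 1 := by omega
      rw [Fintype.card_le_one_iff_subsingleton] at h2
      exact congrArg Subtype.val (Subsingleton.elim (⟨i, hij⟩ : {i // l i = l j}) ⟨j, rfl⟩)
    set σ := Tuple.sort l with hσ
    have hmono : StrictMono (l ∘ σ) :=
      (Tuple.monotone_sort l).strictMono_of_injective (hinj.comp σ.injective)
    obtain ⟨h, hh, hg, hc⟩ := exists_good_three (a := l (σ 2)) (b := l (σ 0)) (c := l (σ 1))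
      (hmono (by decide)) (hmono (by decide))
    refine ⟨h, ueq_of_charpoly_eq hh (rdiag_isHermitian l) ?_, hg⟩
    rw [hc, charpoly_diagonal, ← Equiv.prod_comp σ, Fin.prod_univ_three]
  | k + 1, l, hl => by
    obtain ⟨U, hU, hrow⟩ := exists_unitary_last_row_ne_zero (k + 3)
    set x := U * rdiag l * Uᴴ with hx
    have hxl : UEq x (rdiag l) := UEq.of_conj hU _
    have hxh : x.IsHermitian := hxl.isHermitian (rdiag_isHermitian l)
    have hreg : RegAt x := regAt_of_last_row hU hrow l
    obtain ⟨μ, hμ⟩ := exists_ueq_rdiag (blk_isHermitian hxh)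
    -- The multiplicity bound descends to the block: an eigenvalue of `x` loses multiplicity by
    -- regularity, and any other number has multiplicity at most one.
    obtain ⟨h', hh', hg⟩ := exists_good k μ fun θ => by
      rw [← finrank_eigSp_rdiag, ← hμ.finrank_eigSp]
      by_cases h0 : eigSp x θ = ⊥
      · have := finrank_eigSp_blk_le_one hxh h0
        omega
      · have h1 := (regAt_iff_finrank hxh).1 hreg θ h0
        rw [hxl.finrank_eigSp, finrank_eigSp_rdiag] at h1
        rw [← Nat.card_eq_fintype_card] at h1
        have h2 : Nat.card {i : Fin (k + 3 + 1) // l i = θ} + 2 ≤ k + 4 := by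
          rw [Nat.card_eq_fintype_card]; exact hl θ
        omega
    -- Conjugation by `W ⊕ 1` puts the good matrix `h'` in place of the block and keeps `x` in its
    -- orbit.
    obtain ⟨W, hW, hWe⟩ := hh'.trans hμ.symm
    have he : UEq (extOne W * x * (extOne W)ᴴ) x := UEq.of_conj (extOne_mem hW) x
    have hb : blk (extOne W * x * (extOne W)ᴴ) = h' := by rw [blk_extOne_conj, hWe]
    refine ⟨_, he.trans hxl, by rw [hb]; exact hg, hreg.of_ueq hxh he ?_⟩
    rw [hb]
    exact hh'.trans hμ.symm

/-! ### Orbits that are projective spaces -/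

theorem ContDiff.smoothMapOn {E F : Type*} [NormedAddCommGroup E] [NormedSpace ℝ E]
    [NormedAddCommGroup F] [NormedSpace ℝ F] {f : E → F} (hf : ContDiff ℝ ∞ f) (X : Set E) :
    SmoothMapOn f X :=
  fun _ _ => ⟨Set.univ, isOpen_univ, trivial, f, hf.contDiffOn, fun _ _ => rfl⟩

section Projective

variable {m : ℕ}

theorem charpoly_vecMulVec_eq {n : ℕ} (u v u' v' : Fin n → ℂ) (h : u ⬝ᵥ v = u' ⬝ᵥ v') :
    (vecMulVec u v).charpoly = (vecMulVec u' v').charpoly := by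
  rw [charpoly_vecMulVec, charpoly_vecMulVec, h]

theorem rdiag_single {n : ℕ} (j : Fin n) :
    rdiag (Pi.single j 1) = vecMulVec (Pi.single j 1) (Pi.single j 1) := by
  ext a b
  by_cases hab : a = b
  · subst hab
    by_cases h : a = j
    · subst h; simp [vecMulVec_apply]
    · simp [vecMulVec_apply, h]
  · by_cases h : a = j
    · subst h; simp [vecMulVec_apply, hab, Ne.symm hab]
    · simp [vecMulVec_apply, h, hab]

-- Projective space is itself an orbit: a rank one matrix `u vᵀ` has its characteristic polynomial
-- determined by `u ⬝ᵥ v`.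
open scoped ComplexOrder in
theorem complexProjectiveSpace_eq (j : Fin (m + 1)) :
    complexProjectiveSpace m = {P | UEq P (rdiag (Pi.single j 1))} := by
  ext P
  constructor
  · rintro ⟨ℓ, rfl⟩
    have hne : star ℓ.rep ⬝ᵥ ℓ.rep ≠ 0 := by
      rw [Ne, dotProduct_star_self_eq_zero]; exact ℓ.rep_nonzero
    have hreal : star (star ℓ.rep ⬝ᵥ ℓ.rep) = star ℓ.rep ⬝ᵥ ℓ.rep := by
      rw [← star_dotProduct_star, star_star, dotProduct_comm]
    refine ueq_of_charpoly_eq ?_ (rdiag_isHermitian _) ?_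
    · unfold Matrix.IsHermitian lineProjector
      rw [conjTranspose_smul, conjTranspose_vecMulVec, star_star, star_inv₀, hreal]
    · rw [rdiag_single, lineProjector, ← smul_vecMulVec]
      apply charpoly_vecMulVec_eq
      rw [smul_dotProduct, dotProduct_comm ℓ.rep, smul_eq_mul, inv_mul_cancel₀ hne]
      simp
  · rintro ⟨U, hU, rfl⟩
    set v := U *ᵥ Pi.single j 1 with hv
    have hvv : star v ⬝ᵥ v = 1 := by
      have h1 := star_dotProduct_unitary_mulVec (unitary_conjTranspose hU)
        (Pi.single j 1) (Pi.single j 1)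
      rw [conjTranspose_conjTranspose] at h1
      rw [hv, h1]; simp [Pi.single_apply, dotProduct]
    have hv0 : v ≠ 0 := by
      intro h0; rw [h0] at hvv; simp at hvv
    refine ⟨Projectivization.mk ℂ v hv0, ?_⟩
    obtain ⟨a, ha⟩ := Projectivization.exists_smul_eq_mk_rep ℂ v hv0
    rw [lineProjector, ← ha, rdiag_single, mul_vecMulVec, vecMulVec_mul, ← hv]
    have h2 : (Pi.single j 1 : Fin (m + 1) → ℂ) ᵥ* Uᴴ = star v := by
      rw [hv, star_mulVec]; congr 1; ext i; simp [Pi.single_apply]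
    rw [h2]
    have ha0 : (a : ℂ) ≠ 0 := a.ne_zero
    ext i k
    simp only [Units.smul_def, Matrix.smul_apply, vecMulVec_apply, star_smul, smul_dotProduct,
      dotProduct_smul, hvv, Pi.smul_apply, smul_eq_mul]
    have hs0 : star (a : ℂ) ≠ 0 := by simp
    field_simp

attribute [local instance] Matrix.normedAddCommGroup Matrix.normedSpace

theorem orbitIsProjectiveSpace_of_eq_singleton {n : ℕ} {l : Fin n → ℝ}
    {x : Matrix (Fin n) (Fin n) ℂ} (hx : coadjointOrbit l = {x}) : OrbitIsProjectiveSpace l := by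
  have h1 : complexProjectiveSpace 0 = {1} := by
    rw [complexProjectiveSpace_eq 0]
    have : rdiag (Pi.single (0 : Fin (0 + 1)) 1) = (1 : ℂ) • 1 := by
      ext i j
      rw [Fin.fin_one_eq_zero i, Fin.fin_one_eq_zero j]; simp
    ext P
    rw [this]
    simp only [Set.mem_ofPred_eq, Set.mem_singleton_iff]
    refine ⟨fun h => by simpa using h.smul_one, ?_⟩
    rintro rfl
    rw [one_smul]
    exact UEq.refl 1
  refine ⟨0, fun _ => 1, fun _ => x, contDiff_const.smoothMapOn _, contDiff_const.smoothMapOn _,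
    ?_, ?_, ?_, ?_⟩
  · intro _ _; rw [h1]; rfl
  · intro _ _; rw [hx]; rfl
  · intro y hy; rw [hx] at hy; exact hy.symm
  · intro y hy; rw [h1] at hy; exact hy.symm

theorem coadjointOrbit_const {n : ℕ} {l : Fin n → ℝ} {θ : ℝ} (hl : ∀ i, l i = θ) :
    coadjointOrbit l = {(θ : ℂ) • 1} := by
  have h1 : rdiag l = (θ : ℂ) • 1 := by
    ext i j
    by_cases hij : i = j
    · subst hij; simp [hl]
    · simp [hij]
  ext x
  rw [mem_coadjointOrbit_iff, h1]
  refine ⟨fun h => h.smul_one, ?_⟩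
  rintro rfl
  exact UEq.refl _

theorem UEq.affine {n : ℕ} {x y : Matrix (Fin n) (Fin n) ℂ} (h : UEq x y) (a b : ℝ) :
    UEq (b • (x - a • 1)) (b • (y - a • 1)) := by
  obtain ⟨U, hU, rfl⟩ := h
  refine ⟨U, hU, ?_⟩
  rw [mul_smul_comm, smul_mul_assoc, mul_sub, sub_mul, mul_smul_comm, smul_mul_assoc, mul_one,
    unitary_mul_conjTranspose hU]

theorem orbitIsProjectiveSpace_of_eq_off {l : Fin (m + 1) → ℝ} {θ : ℝ} {j : Fin (m + 1)}
    (hl : ∀ i, i ≠ j → l i = θ) : OrbitIsProjectiveSpace l := by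
  by_cases hj : l j = θ
  · refine orbitIsProjectiveSpace_of_eq_singleton (coadjointOrbit_const (θ := θ) fun i => ?_)
    by_cases h : i = j
    · rw [h, hj]
    · exact hl i h
  set c : ℝ := l j - θ with hc
  have hc0 : c ≠ 0 := sub_ne_zero.2 hj
  have h1 : c⁻¹ • (rdiag l - θ • 1) = rdiag (Pi.single j 1) := by
    ext a b
    by_cases hab : a = b
    · subst hab
      by_cases h : a = j
      · subst h
        have h2 : (l a : ℂ) - θ = (c : ℂ) := by rw [hc]; push_cast; rfl
        have h3 : (c : ℂ) ≠ 0 := by exact_mod_cast hc0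
        simp [h2, h3]
      · simp [h, hl a h]
    · simp [hab]
  -- The inverse `y ↦ c y + θ` is written as a shift followed by a scaling, so that `UEq.affine`
  -- covers both directions.
  have hinv : ∀ x : Matrix (Fin (m + 1)) (Fin (m + 1)) ℂ,
      c • (c⁻¹ • (x - θ • 1) - (-(θ / c)) • 1) = x := fun x => by
    rw [smul_sub, smul_smul, smul_smul, mul_inv_cancel₀ hc0, one_smul, mul_neg,
      mul_div_cancel₀ _ hc0]
    simp
  have h2 : c • (rdiag (Pi.single j 1) - (-(θ / c)) • 1) = rdiag l := by rw [← h1, hinv]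
  have hcd : ∀ a b : ℝ, ContDiff ℝ ∞
      fun x : Matrix (Fin (m + 1)) (Fin (m + 1)) ℂ => b • (x - a • 1) := fun a b =>
    (contDiff_id.sub contDiff_const).const_smul b
  refine ⟨m, fun x => c⁻¹ • (x - θ • 1), fun y => c • (y - (-(θ / c)) • 1),
    (hcd _ _).smoothMapOn _, (hcd _ _).smoothMapOn _, ?_, ?_, ?_, ?_⟩
  · intro x hx
    rw [complexProjectiveSpace_eq j, Set.mem_ofPred_eq, ← h1]
    exact UEq.affine hx _ _
  · intro y hy
    rw [complexProjectiveSpace_eq j, Set.mem_ofPred_eq] at hy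
    rw [mem_coadjointOrbit_iff, ← h2]
    exact hy.affine _ _
  · exact fun x _ => hinv x
  · intro y _
    simp only [smul_sub, smul_smul, inv_mul_cancel₀ hc0, one_smul, neg_smul]
    simp [div_eq_inv_mul]

theorem card_add_two_le_of_not_projective {n : ℕ} {l : Fin n → ℝ}
    (hproj : ¬ OrbitIsProjectiveSpace l) (θ : ℝ) : Fintype.card {i // l i = θ} + 2 ≤ n := by
  by_contra hlt
  apply hproj
  cases n with
  | zero =>
    exact orbitIsProjectiveSpace_of_eq_singleton
      (coadjointOrbit_const (θ := 0) fun i => i.elim0)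
  | succ m =>
    have h1 := Fintype.card_subtype_compl (fun i => l i = θ)
    rw [Fintype.card_fin] at h1
    have h2 : Fintype.card {i // ¬ l i = θ} ≤ 1 := by omega
    rw [Fintype.card_le_one_iff_subsingleton] at h2
    by_cases h3 : ∃ j, l j ≠ θ
    · obtain ⟨j, hj⟩ := h3
      refine orbitIsProjectiveSpace_of_eq_off (θ := θ) (j := j) fun i hij => ?_
      by_contra hi
      exact hij (congrArg Subtype.val
        (Subsingleton.elim (⟨i, hi⟩ : {i // ¬ l i = θ}) ⟨j, hj⟩))
    · push Not at h3
      exact orbitIsProjectiveSpace_of_eq_singleton (coadjointOrbit_const h3)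

end Projective

/-! ### The last column of isospectral bordered matrices -/

section LastColumn

variable {n : ℕ}

theorem eq_of_blk_lcol_trace {x z : Matrix (Fin (n + 1)) (Fin (n + 1)) ℂ} (hx : x.IsHermitian)
    (hz : z.IsHermitian) (hb : blk x = blk z) (hl : lcol x = lcol z) (ht : x.trace = z.trace) :
    x = z := by
  rw [trace_eq_blk, trace_eq_blk z, hb] at ht
  rw [isHermitian_eq_bord hx, isHermitian_eq_bord hz, hb, hl, add_left_cancel ht]

/-- Schur complement of the diagonal block. -/
theorem det_bord_diagonal {d : Fin n → ℂ} (hd : ∀ i, d i ≠ 0) (v w : Fin n → ℂ) (t : ℂ) :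
    (bord (diagonal d) v w t).det = (∏ i, d i) * (t - ∑ i, w i * v i / d i) := by
  let _ : Invertible (diagonal d) := ⟨diagonal fun i => (d i)⁻¹,
    by rw [diagonal_mul_diagonal, ← diagonal_one]; congr 1; ext i; exact inv_mul_cancel₀ (hd i),
    by rw [diagonal_mul_diagonal, ← diagonal_one]; congr 1; ext i; exact mul_inv_cancel₀ (hd i)⟩
  have hinv : ⅟(diagonal d) = diagonal fun i => (d i)⁻¹ := rfl
  have h1 : (bord (diagonal d) v w t).submatrix finSumFinEquiv finSumFinEquiv =
      fromBlocks (diagonal d) (of fun i (_ : Fin 1) => v i) (of fun (_ : Fin 1) j => w j)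
        (of fun _ _ => t) := by
    have hc : ∀ i : Fin n, Fin.castAdd 1 i = i.castSucc := fun _ => rfl
    have hn : ∀ i : Fin 1, Fin.natAdd n i = Fin.last n := fun i => by
      ext; simp
    ext i j
    rcases i with i | i <;> rcases j with j | j <;> simp [hc, hn]
  rw [← det_submatrix_equiv_self finSumFinEquiv, h1, det_fromBlocks₁₁, det_diagonal, hinv,
    det_fin_one]
  congr 1
  rw [Matrix.sub_apply, mul_apply]
  simp only [of_apply, mul_diagonal]
  congr 1
  exact Finset.sum_congr rfl fun i _ => by rw [div_eq_mul_inv]; ring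

/-- The left side is the residue at `θ`: multiply by `z - θ` and let `z → θ`. -/
theorem sum_fiber_eq_zero_of_sum_div {μ c : Fin n → ℝ}
    (H : ∀ z : ℝ, (∀ i, z ≠ μ i) → ∑ i, c i / (z - μ i) = 0) (θ : ℝ) :
    ∑ i with μ i = θ, c i = 0 := by
  have h1 : Filter.Tendsto (fun z : ℝ => ∑ i, c i * ((z - θ) / (z - μ i))) (𝓝[≠] θ)
      (𝓝 (∑ i, if μ i = θ then c i else 0)) := by
    refine tendsto_finsetSum _ fun i _ => ?_
    split_ifs with hi
    · refine tendsto_const_nhds.congr' ?_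
      filter_upwards [self_mem_nhdsWithin] with z hz
      rw [hi, div_self (sub_ne_zero.2 hz), mul_one]
    · have h2 : ContinuousAt (fun z : ℝ => c i * ((z - θ) / (z - μ i))) θ :=
        continuousAt_const.mul ((continuousAt_id.sub continuousAt_const).div
          (continuousAt_id.sub continuousAt_const) (sub_ne_zero.2 (Ne.symm hi)))
      have h3 := h2.tendsto
      simp only [sub_self, zero_div, mul_zero] at h3
      exact h3.mono_left nhdsWithin_le_nhds
  have h2 : ∀ᶠ z in 𝓝[≠] θ, ∑ i, c i * ((z - θ) / (z - μ i)) = 0 := by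
    have h3 : ∀ᶠ z in 𝓝[≠] θ, ∀ i, z ≠ μ i := by
      rw [Filter.eventually_all]
      intro i
      by_cases hi : μ i = θ
      · filter_upwards [self_mem_nhdsWithin] with z hz
        rw [hi]; exact hz
      · exact (isOpen_ne.eventually_mem (Ne.symm hi : θ ≠ μ i)).filter_mono nhdsWithin_le_nhds
    filter_upwards [h3] with z hz
    have h4 := H z hz
    calc ∑ i, c i * ((z - θ) / (z - μ i)) = (z - θ) * ∑ i, c i / (z - μ i) := by
          rw [Finset.mul_sum]; exact Finset.sum_congr rfl fun i _ => by ring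
      _ = 0 := by rw [h4, mul_zero]
  rw [Finset.sum_filter]
  exact (tendsto_nhds_unique (h1.congr' h2) tendsto_const_nhds)

/-- The secular equation. Its residues determine the norms of the components of the last column in
the eigenspaces of the block. -/
theorem eval_charpoly_eq {x : Matrix (Fin (n + 1)) (Fin (n + 1)) ℂ} (hx : x.IsHermitian)
    {U : Matrix (Fin n) (Fin n) ℂ} (hU : U ∈ Matrix.unitaryGroup (Fin n) ℂ) {μ : Fin n → ℝ}
    (hb : blk x = U * rdiag μ * Uᴴ) {z : ℝ} (hz : ∀ i, z ≠ μ i) :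
    x.charpoly.eval (z : ℂ) = (∏ i, ((z : ℂ) - μ i)) *
      (z - x (Fin.last n) (Fin.last n) -
        ((∑ i, ‖(Uᴴ *ᵥ lcol x) i‖ ^ 2 / (z - μ i) : ℝ) : ℂ)) := by
  have h1 : UEq (extOne Uᴴ * x * (extOne Uᴴ)ᴴ) x :=
    UEq.of_conj (extOne_mem (unitary_conjTranspose hU)) x
  have h2 : extOne Uᴴ * x * (extOne Uᴴ)ᴴ = bord (rdiag μ) (Uᴴ *ᵥ lcol x)
      (star (Uᴴ *ᵥ lcol x)) (x (Fin.last n) (Fin.last n)) := by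
    conv_lhs => rw [isHermitian_eq_bord hx, extOne_conj, hb]
    rw [conjTranspose_conjTranspose, unitary_conj_cancel hU, star_mulVec,
      conjTranspose_conjTranspose]
  rw [← h1.charpoly_eq, h2, eval_charpoly]
  set v := Uᴴ *ᵥ lcol x
  have h3 : scalar (Fin (n + 1)) (z : ℂ) - bord (rdiag μ) v (star v)
      (x (Fin.last n) (Fin.last n)) = bord (diagonal fun i => (z : ℂ) - μ i) (-v) (-star v)
      (z - x (Fin.last n) (Fin.last n)) := by
    refine matrix_succ_ext (fun i j => ?_) (fun i => ?_) (fun i => ?_) ?_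
    · by_cases hij : i = j
      · subst hij; simp
      · simp [hij]
    · simp [Fin.castSucc_ne_last]
    · simp [(Fin.castSucc_ne_last i).symm]
    · simp
  rw [h3, det_bord_diagonal fun i => sub_ne_zero.2 (by exact_mod_cast hz i)]
  congr 2
  push_cast
  refine Finset.sum_congr rfl fun i _ => ?_
  rw [← Complex.conj_mul']
  simp

theorem sum_fiber_norm_sq_eq {x h : Matrix (Fin (n + 1)) (Fin (n + 1)) ℂ} (hh : h.IsHermitian)
    (hx : UEq x h) (hb : blk x = blk h) {U : Matrix (Fin n) (Fin n) ℂ}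
    (hU : U ∈ Matrix.unitaryGroup (Fin n) ℂ) {μ : Fin n → ℝ}
    (hbU : blk h = U * rdiag μ * Uᴴ) (θ : ℝ) :
    ∑ i with μ i = θ, ‖(Uᴴ *ᵥ lcol x) i‖ ^ 2 = ∑ i with μ i = θ, ‖(Uᴴ *ᵥ lcol h) i‖ ^ 2 := by
  rw [← sub_eq_zero, ← Finset.sum_sub_distrib]
  refine sum_fiber_eq_zero_of_sum_div (fun z hz => ?_) θ
  have hc : x (Fin.last n) (Fin.last n) = h (Fin.last n) (Fin.last n) := by
    have h1 := hx.trace_eq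
    rw [trace_eq_blk, trace_eq_blk h, hb] at h1
    exact add_left_cancel h1
  have h1 := congrArg (Polynomial.eval (z : ℂ)) hx.charpoly_eq
  rw [eval_charpoly_eq (hx.isHermitian hh) hU (hb.trans hbU) hz, eval_charpoly_eq hh hU hbU hz,
    hc] at h1
  have h2 : (∏ i, ((z : ℂ) - μ i)) ≠ 0 :=
    Finset.prod_ne_zero_iff.2 fun i _ => sub_ne_zero.2 (by exact_mod_cast hz i)
  have h3 := Complex.ofReal_injective (sub_right_injective (mul_left_cancel₀ h2 h1))
  simp only [sub_div, Finset.sum_sub_distrib]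
  rw [h3, sub_self]

/-- Regularity makes every eigenspace of the block that meets the last column nontrivially
one-dimensional (`hsimple`), so equality of the norms of the components is equality entry by entry.
-/
theorem norm_lcol_eq_of_regAt {x h : Matrix (Fin (n + 1)) (Fin (n + 1)) ℂ} (hh : h.IsHermitian)
    (hr : RegAt h) (hx : UEq x h) (hb : blk x = blk h) {U : Matrix (Fin n) (Fin n) ℂ}
    (hU : U ∈ Matrix.unitaryGroup (Fin n) ℂ) {μ : Fin n → ℝ}
    (hbU : blk h = U * rdiag μ * Uᴴ) (i : Fin n) :
    ‖(Uᴴ *ᵥ lcol x) i‖ = ‖(Uᴴ *ᵥ lcol h) i‖ := by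
  set v := Uᴴ *ᵥ lcol h with hv
  have hsimple : ∀ i, v i ≠ 0 → ∀ j, μ j = μ i → j = i := by
    intro i hi j hj
    by_contra hji
    have heig : ∀ u : Fin n → ℂ, (∀ k, μ k ≠ μ i → u k = 0) →
        blk h *ᵥ (U *ᵥ u) = (μ i : ℂ) • (U *ᵥ u) := by
      intro u hu
      have h1 : rdiag μ *ᵥ u = (μ i : ℂ) • u := by
        ext k
        rw [mulVec_diagonal]
        by_cases hk : μ k = μ i
        · simp [hk]
        · simp [hu k hk]
      rw [hbU, mulVec_mulVec, mul_assoc, unitary_conjTranspose_mul hU, mul_one, ← mulVec_mulVec,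
        h1, mulVec_smul]
    have hdot : ∀ u : Fin n → ℂ, star (lcol h) ⬝ᵥ (U *ᵥ u) = star v ⬝ᵥ u := by
      intro u
      rw [← star_dotProduct_unitary_mulVec hU, conjTranspose_mulVec_mulVec hU]
    by_cases h0 : eigSp h (μ i) = ⊥
    · let u : Fin n → ℂ := Pi.single i (star (v j)) - Pi.single j (star (v i))
      have hu : ∀ k, μ k ≠ μ i → u k = 0 := by
        intro k hk
        have h1 : k ≠ i := by rintro rfl; exact hk rfl
        have h2 : k ≠ j := by rintro rfl; exact hk hj
        simp [u, h1, h2]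
      have h1 := snoc_zero_mem_eigSp hh (heig u hu) (by
        rw [hdot]; simp [u, dotProduct_sub, mul_comm])
      have h2 := eigSp_eq_bot_iff.1 h0 _ h1
      have h3 : U *ᵥ u = 0 := by
        ext k; simpa using congrFun h2 k.castSucc
      have h4 : u = 0 := by rw [← conjTranspose_mulVec_mulVec hU u, h3, mulVec_zero]
      have h5 := congrFun h4 j
      simp [u, hji, hi] at h5
    · obtain ⟨p, hp⟩ := hr _ h0
      have h1 := lcol_orthogonal_of_eigenvector hh hp
        (heig (Pi.single i 1) fun k hk => by
          have : k ≠ i := by rintro rfl; exact hk rfl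
          simp [this])
      rw [hdot] at h1
      simp [hi] at h1
  have hsum := sum_fiber_norm_sq_eq hh hx hb hU hbU (μ i)
  rw [← hv] at hsum
  by_cases hi : v i = 0
  · have h1 : ∀ j, μ j = μ i → v j = 0 := by
      intro j hj
      by_contra hne
      have := hsimple j hne i hj.symm
      exact hne (this ▸ hi)
    rw [Finset.sum_eq_zero (s := Finset.univ.filter fun j => μ j = μ i)
      (f := fun j => ‖v j‖ ^ 2) (fun j hj => by
        simp [h1 j (Finset.mem_filter.1 hj).2])] at hsum
    have := (Finset.sum_eq_zero_iff_of_nonneg (fun k _ => by positivity)).1 hsum i (by simp)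
    rw [hi]
    simpa using this
  · have h1 : (Finset.univ.filter fun j => μ j = μ i) = {i} := by
      ext j
      simp only [Finset.mem_filter, Finset.mem_univ, true_and, Finset.mem_singleton]
      exact ⟨hsimple i hi j, fun h => by rw [h]⟩
    rw [h1, Finset.sum_singleton, Finset.sum_singleton] at hsum
    exact (sq_eq_sq₀ (norm_nonneg _) (norm_nonneg _)).1 hsum

end LastColumn

/-! ### Global parametrization of fibers -/

/-- The ambient space of `sphereTorus ι`. -/
abbrev SphereTorusAmbient (ι : Type) : Type := (ℂ × ℂ) × (ι → ℂ)

/-- The product of the three-sphere in `ℂ²` and of the unit circles indexed by `ι`. -/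
def sphereTorus (ι : Type) : Set (SphereTorusAmbient ι) :=
  {m | ‖m.1.1‖ ^ 2 + ‖m.1.2‖ ^ 2 = 1 ∧ ∀ i, ‖m.2 i‖ = 1}

section Parametrization

attribute [local instance] Matrix.normedAddCommGroup Matrix.normedSpace

/-- `G` and `Ψ` provide mutually inverse smooth maps `m ↦ G m * h * (G m)ᴴ` and `Ψ` between
`sphereTorus ι` and `Fib n h`. -/
structure IsFibParam {n : ℕ} (h : Matrix (Fin n) (Fin n) ℂ) (ι : Type) [Fintype ι]
    (G : SphereTorusAmbient ι → Matrix (Fin n) (Fin n) ℂ)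
    (Ψ : Matrix (Fin n) (Fin n) ℂ → SphereTorusAmbient ι) : Prop where
  contDiff_G : EntryContDiff G
  contDiff_Ψ : ContDiff ℝ ∞ Ψ
  unitary : ∀ m ∈ sphereTorus ι, G m ∈ Matrix.unitaryGroup (Fin n) ℂ
  mem_Fib : ∀ m ∈ sphereTorus ι, G m * h * (G m)ᴴ ∈ Fib n h
  left_inv : ∀ m ∈ sphereTorus ι, Ψ (G m * h * (G m)ᴴ) = m
  mapsTo : ∀ x ∈ Fib n h, Ψ x ∈ sphereTorus ι
  right_inv : ∀ x ∈ Fib n h, G (Ψ x) * h * (G (Ψ x))ᴴ = x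

/-- The matrix `[[q₁, -q̄₂], [q₂, q̄₁]]`, an element of `SU(2)` when `q` has norm one. -/
def quatMatrix (q : ℂ × ℂ) : Matrix (Fin 2) (Fin 2) ℂ := !![q.1, -star q.2; q.2, star q.1]

theorem quatMatrix_mem {q : ℂ × ℂ} (hq : ‖q.1‖ ^ 2 + ‖q.2‖ ^ 2 = 1) :
    quatMatrix q ∈ Matrix.unitaryGroup (Fin 2) ℂ := by
  have h1 : star q.1 * q.1 + star q.2 * q.2 = 1 := by
    have h2 : star q.1 * q.1 = ((‖q.1‖ ^ 2 : ℝ) : ℂ) := by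
      push_cast; exact Complex.conj_mul' _
    have h3 : star q.2 * q.2 = ((‖q.2‖ ^ 2 : ℝ) : ℂ) := by
      push_cast; exact Complex.conj_mul' _
    rw [h2, h3]; exact_mod_cast hq
  apply unitary_of_conjTranspose_mul
  ext i j
  fin_cases i <;> fin_cases j <;> simp [quatMatrix, mul_apply, Fin.sum_univ_two] <;>
    simp at h1 <;> first | linear_combination h1 | ring

theorem quatMatrix_mulVec (q : ℂ × ℂ) (s : ℂ) :
    quatMatrix q *ᵥ ![s, 0] = ![q.1 * s, q.2 * s] := by
  ext i; fin_cases i <;> simp [quatMatrix, mulVec, dotProduct, Fin.sum_univ_two]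

/-- The scalar block never moves, so a point of the fiber is a last column in `ℂ²` of fixed norm
`s`. `SU(2)` acts simply transitively on such columns, which makes the parametrization global. -/
theorem exists_isFibParam_three {h : Matrix (Fin 3) (Fin 3) ℂ} (hh : h.IsHermitian)
    (hg : Good 0 h) : ∃ G Ψ, IsFibParam h Empty G Ψ := by
  obtain ⟨⟨c, hc⟩, hv⟩ := hg
  set N : ℝ := ∑ i, ‖lcol h i‖ ^ 2 with hN
  have hNpos : 0 < N := by
    refine lt_of_le_of_ne (Finset.sum_nonneg fun _ _ => by positivity) fun h0 => hv ?_
    ext i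
    have := (Finset.sum_eq_zero_iff_of_nonneg (fun k _ => by positivity)).1 h0.symm i
      (Finset.mem_univ i)
    simpa using this
  set s : ℝ := √N with hs
  have hss : s ^ 2 = N := Real.sq_sqrt hNpos.le
  have hs0 : 0 < s := Real.sqrt_pos.2 hNpos
  have hsc : (s : ℂ) ≠ 0 := by exact_mod_cast hs0.ne'
  have hnorm : ∀ w : Fin 2 → ℂ, ∑ i, ‖w i‖ ^ 2 = N → ‖w 0 / s‖ ^ 2 + ‖w 1 / s‖ ^ 2 = 1 := by
    intro w hw
    rw [Fin.sum_univ_two] at hw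
    have h1 : ‖(s : ℂ)‖ = s := by rw [Complex.norm_real, Real.norm_of_nonneg hs0.le]
    rw [norm_div, norm_div, h1, div_pow, div_pow, ← add_div, hw, hss, div_self hNpos.ne']
  set q₀ : ℂ × ℂ := (lcol h 0 / s, lcol h 1 / s) with hq₀
  have hq₀n : ‖q₀.1‖ ^ 2 + ‖q₀.2‖ ^ 2 = 1 := hnorm _ rfl
  have hq₀u := quatMatrix_mem hq₀n
  have hcol : (quatMatrix q₀)ᴴ *ᵥ lcol h = ![(s : ℂ), 0] := by
    have h1 : lcol h = quatMatrix q₀ *ᵥ ![(s : ℂ), 0] := by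
      rw [quatMatrix_mulVec, hq₀]
      ext i
      fin_cases i <;> simp [div_mul_cancel₀ _ hsc]
    rw [h1, conjTranspose_mulVec_mulVec hq₀u]
  -- The factor `(quatMatrix q₀)ᴴ` first rotates the last column of `h` to `(s, 0)`.
  let G : SphereTorusAmbient Empty → Matrix (Fin 3) (Fin 3) ℂ := fun m =>
    extOne (quatMatrix m.1 * (quatMatrix q₀)ᴴ)
  let Ψ : Matrix (Fin 3) (Fin 3) ℂ → SphereTorusAmbient Empty := fun x =>
    ((lcol x 0 / s, lcol x 1 / s), fun i => i.elim)
  have hGu : ∀ m : SphereTorusAmbient Empty, ‖m.1.1‖ ^ 2 + ‖m.1.2‖ ^ 2 = 1 →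
      quatMatrix m.1 * (quatMatrix q₀)ᴴ ∈ Matrix.unitaryGroup (Fin 2) ℂ := fun m hm =>
    mul_mem (quatMatrix_mem hm) (unitary_conjTranspose hq₀u)
  have hGb : ∀ m : SphereTorusAmbient Empty, ‖m.1.1‖ ^ 2 + ‖m.1.2‖ ^ 2 = 1 →
      blk (G m * h * (G m)ᴴ) = blk h := by
    intro m hm
    rw [blk_extOne_conj, hc, mul_smul_comm, mul_one, smul_mul_assoc,
      unitary_mul_conjTranspose (hGu m hm)]
  have hGl : ∀ m : SphereTorusAmbient Empty, lcol (G m * h * (G m)ᴴ) = ![m.1.1 * s, m.1.2 * s] := by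
    intro m
    rw [lcol_extOne_conj, ← mulVec_mulVec, hcol, quatMatrix_mulVec]
  have hΨ : ∀ x ∈ Fib 3 h, Ψ x ∈ sphereTorus Empty := fun x hx =>
    ⟨hnorm _ (sum_norm_lcol_sq_eq hh hx.1 (UEq.of_mem_Fib hx.2)), fun i => i.elim⟩
  refine ⟨G, Ψ, ?_, ?_, fun m hm => extOne_mem (hGu m hm.1), ?_, ?_, hΨ, ?_⟩
  · refine EntryContDiff.extOne (EntryContDiff.mul ?_ (entryContDiff_const _))
    intro i j
    fin_cases i <;> fin_cases j
    · exact contDiff_fst.comp contDiff_fst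
    · exact (Complex.conjCLE.contDiff.comp (contDiff_snd.comp contDiff_fst)).neg
    · exact contDiff_snd.comp contDiff_fst
    · exact Complex.conjCLE.contDiff.comp (contDiff_fst.comp contDiff_fst)
  · have hent : ∀ i j, ContDiff ℝ ∞ fun x : Matrix (Fin 3) (Fin 3) ℂ => x i j :=
      contDiff_matrix_iff.1 contDiff_id
    exact (((hent _ _).div_const _).prodMk ((hent _ _).div_const _)).prodMk
      (contDiff_pi.2 fun i => i.elim)
  · intro m hm
    refine ⟨UEq.of_conj (extOne_mem (hGu m hm.1)) h, ?_⟩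
    rw [hGb m hm.1]
    exact self_mem_Fib _
  · intro m _
    refine Prod.ext (Prod.ext ?_ ?_) (funext fun i => i.elim)
    · change lcol (G m * h * (G m)ᴴ) 0 / s = m.1.1
      rw [hGl]; simp [mul_div_cancel_right₀ _ hsc]
    · change lcol (G m * h * (G m)ᴴ) 1 / s = m.1.2
      rw [hGl]; simp [mul_div_cancel_right₀ _ hsc]
  · intro x hx
    have hΨx := hΨ x hx
    have hbx : blk x = blk h := by
      have h1 := UEq.of_mem_Fib hx.2
      rw [hc] at h1 ⊢
      exact h1.smul_one
    have hue := UEq.of_conj (extOne_mem (hGu (Ψ x) hΨx.1)) h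
    refine eq_of_blk_lcol_trace (hue.isHermitian hh) (hx.1.isHermitian hh)
      ((hGb _ hΨx.1).trans hbx.symm) ?_ (hue.trace_eq.trans hx.1.trace_eq.symm)
    rw [hGl]
    ext i
    fin_cases i
    · change lcol x 0 / s * s = lcol x 0
      rw [div_mul_cancel₀ _ hsc]
    · change lcol x 1 / s * s = lcol x 1
      rw [div_mul_cancel₀ _ hsc]

theorem diagonal_mem_unitaryGroup {n : ℕ} {d : Fin n → ℂ} (hd : ∀ i, ‖d i‖ = 1) :
    diagonal d ∈ Matrix.unitaryGroup (Fin n) ℂ := by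
  apply unitary_of_conjTranspose_mul
  rw [diagonal_conjTranspose, diagonal_mul_diagonal, ← diagonal_one]
  congr 1
  ext i
  have h1 : star (d i) * d i = 1 := by
    rw [Complex.star_def, Complex.conj_mul', hd i]; simp
  exact h1

/-- The old parameters move the block. The stabilizer of the block contains the phases in its
eigenbasis `U`, which act on the last column; only phases at its nonzero entries are effective, and
by regularity they reach every point over a given block. -/
theorem exists_isFibParam_succ {n : ℕ} {h : Matrix (Fin (n + 1)) (Fin (n + 1)) ℂ}
    (hh : h.IsHermitian) (hr : RegAt h) {ι : Type} [Fintype ι]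
    {G : SphereTorusAmbient ι → Matrix (Fin n) (Fin n) ℂ}
    {Ψ : Matrix (Fin n) (Fin n) ℂ → SphereTorusAmbient ι} (hP : IsFibParam (blk h) ι G Ψ) :
    ∃ (κ : Type) (_ : Fintype κ) (G' : SphereTorusAmbient κ → Matrix (Fin (n + 1)) (Fin (n + 1)) ℂ)
      (Ψ' : Matrix (Fin (n + 1)) (Fin (n + 1)) ℂ → SphereTorusAmbient κ), IsFibParam h κ G' Ψ' := by
  classical
  obtain ⟨μ, U, hU, hbU⟩ := exists_ueq_rdiag (blk_isHermitian hh)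
  set v := Uᴴ *ᵥ lcol h with hv
  let I : Type := {i : Fin n // v i ≠ 0}
  let κ : Type := ι ⊕ I
  let res : SphereTorusAmbient κ → SphereTorusAmbient ι := fun m => (m.1, fun i => m.2 (Sum.inl i))
  let T : SphereTorusAmbient κ → Fin n → ℂ := fun m i =>
    if hi : v i ≠ 0 then m.2 (Sum.inr ⟨i, hi⟩) else 1
  let K : SphereTorusAmbient κ → Matrix (Fin n) (Fin n) ℂ := fun m =>
    G (res m) * (U * diagonal (T m) * Uᴴ)
  -- The last column of `x`, carried back over the base block and written in its eigenbasis.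
  -- Dividing by the entries of `v` reads off the phases.
  let Φ : Matrix (Fin (n + 1)) (Fin (n + 1)) ℂ → Fin n → ℂ := fun x =>
    (Uᴴ * (G (Ψ (blk x)))ᴴ) *ᵥ lcol x
  let Ψ' : Matrix (Fin (n + 1)) (Fin (n + 1)) ℂ → SphereTorusAmbient κ := fun x =>
    ((Ψ (blk x)).1, Sum.elim (Ψ (blk x)).2 fun i => Φ x i.1 / v i.1)
  have hres : ∀ m ∈ sphereTorus κ, res m ∈ sphereTorus ι := fun m hm =>
    ⟨hm.1, fun i => hm.2 (Sum.inl i)⟩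
  have hTu : ∀ m ∈ sphereTorus κ, diagonal (T m) ∈ Matrix.unitaryGroup (Fin n) ℂ := by
    intro m hm
    refine diagonal_mem_unitaryGroup fun i => ?_
    by_cases hi : v i ≠ 0
    · simp only [T, dif_pos hi]; exact hm.2 _
    · simp only [T, dif_neg hi, norm_one]
  have hDu : ∀ m ∈ sphereTorus κ, U * diagonal (T m) * Uᴴ ∈ Matrix.unitaryGroup (Fin n) ℂ :=
    fun m hm => mul_mem (mul_mem hU (hTu m hm)) (unitary_conjTranspose hU)
  have hKu : ∀ m ∈ sphereTorus κ, K m ∈ Matrix.unitaryGroup (Fin n) ℂ := fun m hm =>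
    mul_mem (hP.unitary _ (hres m hm)) (hDu m hm)
  have hDb : ∀ m ∈ sphereTorus κ,
      (U * diagonal (T m) * Uᴴ) * blk h * (U * diagonal (T m) * Uᴴ)ᴴ = blk h := by
    intro m hm
    have h1 : (U * diagonal (T m) * Uᴴ) * blk h = blk h * (U * diagonal (T m) * Uᴴ) := by
      have h2 := conj_bracket_conj hU (diagonal (T m)) (rdiag μ)
      have h3 : ⁅diagonal (T m), rdiag μ⁆ = 0 := by
        rw [Ring.lie_def, diagonal_mul_diagonal, diagonal_mul_diagonal, sub_eq_zero]
        congr 1; ext i; ring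
      rw [h3, ← hbU, Ring.lie_def, mul_zero, zero_mul, sub_eq_zero] at h2
      exact h2
    rw [h1, mul_assoc, unitary_mul_conjTranspose (hDu m hm), mul_one]
  have hblk : ∀ m ∈ sphereTorus κ, blk (extOne (K m) * h * (extOne (K m))ᴴ) =
      G (res m) * blk h * (G (res m))ᴴ := by
    intro m hm
    rw [blk_extOne_conj, conjTranspose_mul]
    calc K m * blk h * ((U * diagonal (T m) * Uᴴ)ᴴ * (G (res m))ᴴ)
        = G (res m) * ((U * diagonal (T m) * Uᴴ) * blk h * (U * diagonal (T m) * Uᴴ)ᴴ) *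
          (G (res m))ᴴ := by simp only [K, mul_assoc]
      _ = _ := by rw [hDb m hm]
  have hlc : ∀ m, lcol (extOne (K m) * h * (extOne (K m))ᴴ) =
      G (res m) *ᵥ (U *ᵥ (diagonal (T m) *ᵥ v)) := by
    intro m
    rw [lcol_extOne_conj, ← mulVec_mulVec, ← mulVec_mulVec, ← mulVec_mulVec]
  have hresΨ : ∀ x, res (Ψ' x) = Ψ (blk x) := fun x => rfl
  have hΦnorm : ∀ x ∈ Fib (n + 1) h, ∀ i, ‖Φ x i‖ = ‖v i‖ := by
    intro x hx i
    set g := G (Ψ (blk x)) with hgdef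
    have hgu : g ∈ Matrix.unitaryGroup (Fin n) ℂ := hP.unitary _ (hP.mapsTo _ hx.2)
    have hbz : blk (extOne gᴴ * x * (extOne gᴴ)ᴴ) = blk h := by
      rw [blk_extOne_conj, ← hP.right_inv _ hx.2, conjTranspose_conjTranspose]
      exact unitary_conj_cancel hgu _
    have hz := UEq.of_conj (extOne_mem (unitary_conjTranspose hgu)) x
    have h1 := norm_lcol_eq_of_regAt hh hr (hz.trans hx.1) hbz hU hbU i
    rw [lcol_extOne_conj, mulVec_mulVec] at h1
    exact h1
  have hΨ' : ∀ x ∈ Fib (n + 1) h, Ψ' x ∈ sphereTorus κ := by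
    intro x hx
    have h1 := hP.mapsTo _ hx.2
    refine ⟨h1.1, fun i => ?_⟩
    rcases i with i | i
    · exact h1.2 i
    · change ‖Φ x i.1 / v i.1‖ = 1
      rw [norm_div, hΦnorm x hx, div_self (norm_ne_zero_iff.2 i.2)]
  refine ⟨κ, inferInstance, fun m => extOne (K m), Ψ', ?_, ?_, fun m hm => extOne_mem (hKu m hm),
    ?_, ?_, hΨ', ?_⟩
  · refine EntryContDiff.extOne (EntryContDiff.mul (fun i j => ?_) (EntryContDiff.mul
      (EntryContDiff.mul (entryContDiff_const _) ?_) (entryContDiff_const _)))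
    · have hresc : ContDiff ℝ ∞ res := contDiff_fst.prodMk
        (contDiff_pi.2 fun i => (contDiff_apply ℝ ℂ (Sum.inl i : κ)).comp contDiff_snd)
      exact (hP.contDiff_G i j).comp hresc
    · intro i j
      by_cases hij : i = j
      · subst hij
        simp only [diagonal_apply_eq]
        by_cases hi : v i ≠ 0
        · simp only [T, dif_pos hi]
          exact (contDiff_apply ℝ ℂ (Sum.inr ⟨i, hi⟩ : κ)).comp contDiff_snd
        · simp only [T, dif_neg hi]
          exact contDiff_const
      · simp only [diagonal_apply_ne _ hij]
        exact contDiff_const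
  · have hent : ∀ i j, ContDiff ℝ ∞ fun x : Matrix (Fin (n + 1)) (Fin (n + 1)) ℂ => x i j :=
      contDiff_matrix_iff.1 contDiff_id
    have hblkc : ContDiff ℝ ∞ fun x : Matrix (Fin (n + 1)) (Fin (n + 1)) ℂ => blk x :=
      contDiff_matrix_iff.2 fun i j => hent _ _
    have hΨc := hP.contDiff_Ψ.comp hblkc
    have hGc : EntryContDiff fun x : Matrix (Fin (n + 1)) (Fin (n + 1)) ℂ =>
        Uᴴ * (G (Ψ (blk x)))ᴴ := by
      refine (entryContDiff_const _).mul (EntryContDiff.conjTranspose fun i j => ?_)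
      exact (hP.contDiff_G i j).comp hΨc
    refine (contDiff_fst.comp hΨc).prodMk (contDiff_pi.2 fun i => ?_)
    rcases i with i | i
    · exact (contDiff_apply ℝ ℂ i).comp (contDiff_snd.comp hΨc)
    · refine ContDiff.div_const (f := fun x => Φ x i.1) ?_ _
      change ContDiff ℝ ∞ fun x => ∑ k, (Uᴴ * (G (Ψ (blk x)))ᴴ) i.1 k * x k.castSucc (Fin.last n)
      exact ContDiff.sum fun k _ => (hGc i.1 k).mul (hent _ _)
  · intro m hm
    refine ⟨UEq.of_conj (extOne_mem (hKu m hm)) h, ?_⟩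
    rw [hblk m hm]
    exact hP.mem_Fib _ (hres m hm)
  · intro m hm
    have h1 : Ψ (blk (extOne (K m) * h * (extOne (K m))ᴴ)) = res m := by
      rw [hblk m hm, hP.left_inv _ (hres m hm)]
    have h2 : Φ (extOne (K m) * h * (extOne (K m))ᴴ) = diagonal (T m) *ᵥ v := by
      simp only [Φ]
      rw [h1, hlc, ← mulVec_mulVec,
        conjTranspose_mulVec_mulVec (hP.unitary _ (hres m hm)), conjTranspose_mulVec_mulVec hU]
    refine Prod.ext ?_ (funext fun i => ?_)
    · have h3 := congrArg Prod.fst h1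
      exact h3
    · rcases i with i | i
      · have h3 := congrFun (congrArg Prod.snd h1) i
        exact h3
      · change Φ (extOne (K m) * h * (extOne (K m))ᴴ) i.1 / v i.1 = m.2 (Sum.inr i)
        rw [h2, mulVec_diagonal, mul_div_cancel_right₀ _ i.2]
        simp only [T, dif_pos i.2]
        rfl
  · intro x hx
    have hm := hΨ' x hx
    have hue := UEq.of_conj (extOne_mem (hKu _ hm)) h
    refine eq_of_blk_lcol_trace (hue.isHermitian hh) (hx.1.isHermitian hh) ?_ ?_
      (hue.trace_eq.trans hx.1.trace_eq.symm)
    · rw [hblk _ hm, hresΨ, hP.right_inv _ hx.2]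
    · rw [hlc, hresΨ]
      have h1 : diagonal (T (Ψ' x)) *ᵥ v = Φ x := by
        ext i
        rw [mulVec_diagonal]
        by_cases hi : v i ≠ 0
        · simp only [T, dif_pos hi]
          change Φ x i / v i * v i = Φ x i
          rw [div_mul_cancel₀ _ hi]
        · push Not at hi
          have := hΦnorm x hx i
          rw [hi, norm_zero, norm_eq_zero] at this
          rw [hi, this, mul_zero]
      rw [h1]
      simp only [Φ]
      rw [← mulVec_mulVec, mulVec_conjTranspose_mulVec hU,
        mulVec_conjTranspose_mulVec (hP.unitary _ (hP.mapsTo _ hx.2))]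

theorem exists_isFibParam : ∀ {k : ℕ} {h : Matrix (Fin (k + 3)) (Fin (k + 3)) ℂ}, h.IsHermitian →
    Good k h → ∃ (ι : Type) (_ : Fintype ι)
      (G : SphereTorusAmbient ι → Matrix (Fin (k + 3)) (Fin (k + 3)) ℂ)
      (Ψ : Matrix (Fin (k + 3)) (Fin (k + 3)) ℂ → SphereTorusAmbient ι), IsFibParam h ι G Ψ
  | 0, _, hh, hg => ⟨Empty, inferInstance, exists_isFibParam_three hh hg⟩
  | _ + 1, _, hh, ⟨hg, hr⟩ => by
    obtain ⟨ι, _, G, Ψ, hP⟩ := exists_isFibParam (blk_isHermitian hh) hg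
    exact exists_isFibParam_succ hh hr hP

end Parametrization

/-! ### Charts of the product of a three-sphere and a torus -/

section Charts

/-- Left multiplication by the conjugate of the quaternion `a`. -/
def quatConjMul (a q : ℂ × ℂ) : ℂ × ℂ := (star a.1 * q.1 + star a.2 * q.2, a.1 * q.2 - a.2 * q.1)

/-- Left multiplication by the quaternion `a`. -/
def quatMul (a p : ℂ × ℂ) : ℂ × ℂ := (a.1 * p.1 - star a.2 * p.2, a.2 * p.1 + star a.1 * p.2)

theorem complex_sq_norm (z : ℂ) : ‖z‖ ^ 2 = z.re ^ 2 + z.im ^ 2 := by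
  rw [Complex.sq_norm, Complex.normSq_apply]; ring

theorem star_mul_add_star_mul {a : ℂ × ℂ} (ha : ‖a.1‖ ^ 2 + ‖a.2‖ ^ 2 = 1) :
    star a.1 * a.1 + star a.2 * a.2 = 1 := by
  have h2 : star a.1 * a.1 = ((‖a.1‖ ^ 2 : ℝ) : ℂ) := by push_cast; exact Complex.conj_mul' _
  have h3 : star a.2 * a.2 = ((‖a.2‖ ^ 2 : ℝ) : ℂ) := by push_cast; exact Complex.conj_mul' _
  rw [h2, h3]; exact_mod_cast ha

theorem quatMul_quatConjMul {a : ℂ × ℂ} (ha : ‖a.1‖ ^ 2 + ‖a.2‖ ^ 2 = 1) (q : ℂ × ℂ) :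
    quatMul a (quatConjMul a q) = q := by
  have h1 := star_mul_add_star_mul ha
  refine Prod.ext ?_ ?_
  · simp only [quatMul, quatConjMul]; linear_combination q.1 * h1
  · simp only [quatMul, quatConjMul]; linear_combination q.2 * h1

theorem quatConjMul_quatMul {a : ℂ × ℂ} (ha : ‖a.1‖ ^ 2 + ‖a.2‖ ^ 2 = 1) (p : ℂ × ℂ) :
    quatConjMul a (quatMul a p) = p := by
  have h1 := star_mul_add_star_mul ha
  refine Prod.ext ?_ ?_
  · simp only [quatMul, quatConjMul]; linear_combination p.1 * h1
  · simp only [quatMul, quatConjMul]; linear_combination p.2 * h1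

theorem norm_quatMul {a : ℂ × ℂ} (ha : ‖a.1‖ ^ 2 + ‖a.2‖ ^ 2 = 1) (p : ℂ × ℂ) :
    ‖(quatMul a p).1‖ ^ 2 + ‖(quatMul a p).2‖ ^ 2 = ‖p.1‖ ^ 2 + ‖p.2‖ ^ 2 := by
  simp only [complex_sq_norm] at ha ⊢
  simp only [quatMul, Complex.star_def, Complex.add_re, Complex.add_im, Complex.sub_re,
    Complex.sub_im, Complex.mul_re, Complex.mul_im, Complex.conj_re, Complex.conj_im]
  linear_combination (p.1.re ^ 2 + p.1.im ^ 2 + (p.2.re ^ 2 + p.2.im ^ 2)) * ha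

theorem norm_quatConjMul {a : ℂ × ℂ} (ha : ‖a.1‖ ^ 2 + ‖a.2‖ ^ 2 = 1) (q : ℂ × ℂ) :
    ‖(quatConjMul a q).1‖ ^ 2 + ‖(quatConjMul a q).2‖ ^ 2 = ‖q.1‖ ^ 2 + ‖q.2‖ ^ 2 := by
  rw [← norm_quatMul ha, quatMul_quatConjMul ha]

theorem contDiff_quatConjMul (a : ℂ × ℂ) : ContDiff ℝ ∞ (quatConjMul a) :=
  ((contDiff_const.mul contDiff_fst).add (contDiff_const.mul contDiff_snd)).prodMk
    ((contDiff_const.mul contDiff_snd).sub (contDiff_const.mul contDiff_fst))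

theorem contDiff_quatMul (a : ℂ × ℂ) : ContDiff ℝ ∞ (quatMul a) :=
  ((contDiff_const.mul contDiff_fst).sub (contDiff_const.mul contDiff_snd)).prodMk
    ((contDiff_const.mul contDiff_fst).add (contDiff_const.mul contDiff_snd))

variable {ι : Type}

/-- Coordinates on `sphereTorus ι` near the point `m`. -/
def sphereTorusChart (m x : SphereTorusAmbient ι) : Fin 3 ⊕ ι → ℝ :=
  Sum.elim ![(quatConjMul m.1 x.1).1.im, (quatConjMul m.1 x.1).2.re, (quatConjMul m.1 x.1).2.im]
    fun i => (star (m.2 i) * x.2 i).im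

/-- The inverse of `sphereTorusChart m`. -/
noncomputable def sphereTorusChartInv (m : SphereTorusAmbient ι) (w : Fin 3 ⊕ ι → ℝ) : SphereTorusAmbient ι :=
  (quatMul m.1 ((√(1 - (w (Sum.inl 0) ^ 2 + w (Sum.inl 1) ^ 2 + w (Sum.inl 2) ^ 2)) : ℝ) +
      (w (Sum.inl 0) : ℂ) * Complex.I, (w (Sum.inl 1) : ℂ) + (w (Sum.inl 2) : ℂ) * Complex.I),
    fun i => m.2 i * ((√(1 - w (Sum.inr i) ^ 2) : ℝ) + (w (Sum.inr i) : ℂ) * Complex.I))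

/-- The domain of `sphereTorusChart m`. -/
def sphereTorusDomain (m : SphereTorusAmbient ι) : Set (SphereTorusAmbient ι) :=
  {x | 0 < (quatConjMul m.1 x.1).1.re ∧ ∀ i, 0 < (star (m.2 i) * x.2 i).re}

/-- The range of `sphereTorusChart m`. -/
def sphereTorusRange (ι : Type) : Set (Fin 3 ⊕ ι → ℝ) :=
  {w | w (Sum.inl 0) ^ 2 + w (Sum.inl 1) ^ 2 + w (Sum.inl 2) ^ 2 < 1 ∧ ∀ i, w (Sum.inr i) ^ 2 < 1}

theorem contDiff_sphereTorusChart [Fintype ι] (m : SphereTorusAmbient ι) (k : Fin 3 ⊕ ι) :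
    ContDiff ℝ ∞ fun x => sphereTorusChart m x k := by
  have h1 : ContDiff ℝ ∞ fun x : SphereTorusAmbient ι => quatConjMul m.1 x.1 :=
    (contDiff_quatConjMul m.1).comp contDiff_fst
  have hre : ContDiff ℝ ∞ Complex.re := Complex.reCLM.contDiff
  have him : ContDiff ℝ ∞ Complex.im := Complex.imCLM.contDiff
  rcases k with k | i
  · fin_cases k
    · exact him.comp (contDiff_fst.comp h1)
    · exact hre.comp (contDiff_snd.comp h1)
    · exact him.comp (contDiff_snd.comp h1)
  · exact him.comp (contDiff_const.mul ((contDiff_apply ℝ ℂ i).comp contDiff_snd))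

theorem isOpen_sphereTorusDomain [Fintype ι] (m : SphereTorusAmbient ι) : IsOpen (sphereTorusDomain m) := by
  refine IsOpen.inter ?_ ?_
  · exact isOpen_lt continuous_const (Complex.continuous_re.comp (continuous_fst.comp
      ((contDiff_quatConjMul m.1).continuous.comp continuous_fst)))
  · have h1 : {x : SphereTorusAmbient ι | ∀ i, 0 < (star (m.2 i) * x.2 i).re} =
        ⋂ i, {x : SphereTorusAmbient ι | 0 < (star (m.2 i) * x.2 i).re} := by ext; simp
    change IsOpen {x : SphereTorusAmbient ι | ∀ i, 0 < (star (m.2 i) * x.2 i).re}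
    rw [h1]
    exact isOpen_iInter_of_finite fun i => isOpen_lt continuous_const
      (Complex.continuous_re.comp (continuous_const.mul
        ((continuous_apply i).comp continuous_snd)))

theorem isOpen_sphereTorusRange [Fintype ι] : IsOpen (sphereTorusRange ι) := by
  have h0 : ∀ k : Fin 3 ⊕ ι, Continuous fun w : Fin 3 ⊕ ι → ℝ => w k ^ 2 := fun k =>
    (continuous_apply k).pow 2
  refine IsOpen.inter (isOpen_lt (((h0 _).add (h0 _)).add (h0 _)) continuous_const) ?_
  have h1 : {w : Fin 3 ⊕ ι → ℝ | ∀ i, w (Sum.inr i) ^ 2 < 1} =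
      ⋂ i, {w : Fin 3 ⊕ ι → ℝ | w (Sum.inr i) ^ 2 < 1} := by ext; simp
  change IsOpen {w : Fin 3 ⊕ ι → ℝ | ∀ i, w (Sum.inr i) ^ 2 < 1}
  rw [h1]
  exact isOpen_iInter_of_finite fun i => isOpen_lt (h0 _) continuous_const

theorem contDiffOn_sphereTorusChartInv [Fintype ι] (m : SphereTorusAmbient ι) :
    ContDiffOn ℝ ∞ (sphereTorusChartInv m) (sphereTorusRange ι) := by
  have hw : ∀ k : Fin 3 ⊕ ι, ContDiffOn ℝ ∞ (fun w : Fin 3 ⊕ ι → ℝ => w k) (sphereTorusRange ι) :=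
    fun k => (contDiff_apply ℝ ℝ k).contDiffOn
  have hc : ∀ f : (Fin 3 ⊕ ι → ℝ) → ℝ, ContDiffOn ℝ ∞ f (sphereTorusRange ι) →
      ContDiffOn ℝ ∞ (fun w => (f w : ℂ)) (sphereTorusRange ι) := fun f hf =>
    Complex.ofRealCLM.contDiff.comp_contDiffOn hf
  have h1 : ContDiffOn ℝ ∞ (fun w : Fin 3 ⊕ ι → ℝ =>
      √(1 - (w (Sum.inl 0) ^ 2 + w (Sum.inl 1) ^ 2 + w (Sum.inl 2) ^ 2))) (sphereTorusRange ι) :=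
    ContDiffOn.sqrt (contDiffOn_const.sub ((((hw _).pow 2).add ((hw _).pow 2)).add ((hw _).pow 2)))
      fun w hw => by have := hw.1; intro h; linarith
  have h2 : ∀ i, ContDiffOn ℝ ∞ (fun w : Fin 3 ⊕ ι → ℝ => √(1 - w (Sum.inr i) ^ 2))
      (sphereTorusRange ι) := fun i =>
    ContDiffOn.sqrt (contDiffOn_const.sub ((hw _).pow 2))
      fun w hw => by have := hw.2 i; intro h; linarith
  refine ContDiffOn.prodMk ?_ (contDiffOn_pi.2 fun i => ?_)
  · refine (contDiff_quatMul m.1).comp_contDiffOn (ContDiffOn.prodMk ?_ ?_)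
    · exact (hc _ h1).add ((hc _ (hw _)).mul contDiffOn_const)
    · exact (hc _ (hw _)).add ((hc _ (hw _)).mul contDiffOn_const)
  · exact contDiffOn_const.mul ((hc _ (h2 i)).add ((hc _ (hw _)).mul contDiffOn_const))

theorem self_mem_sphereTorusDomain {m : SphereTorusAmbient ι} (hm : m ∈ sphereTorus ι) :
    m ∈ sphereTorusDomain m := by
  refine ⟨?_, fun i => ?_⟩
  · have : (quatConjMul m.1 m.1).1 = 1 := star_mul_add_star_mul hm.1
    rw [this]; simp
  · rw [Complex.star_def, Complex.conj_mul', hm.2 i]; simp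

theorem star_mul_self_of_norm {z : ℂ} (hz : ‖z‖ = 1) : star z * z = 1 := by
  rw [Complex.star_def, Complex.conj_mul', hz]; simp

theorem sphereTorusChart_mem {m x : SphereTorusAmbient ι} (hm : m ∈ sphereTorus ι)
    (hx : x ∈ sphereTorus ι) (hd : x ∈ sphereTorusDomain m) :
    sphereTorusChart m x ∈ sphereTorusRange ι := by
  refine ⟨?_, fun i => ?_⟩
  · have h1 := norm_quatConjMul hm.1 x.1
    rw [hx.1, complex_sq_norm, complex_sq_norm] at h1
    have h2 := pow_pos hd.1 2
    simp only [sphereTorusChart, Sum.elim_inl]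
    simp
    linarith
  · have h1 : ‖star (m.2 i) * x.2 i‖ ^ 2 = 1 := by
      rw [norm_mul, norm_star, hm.2, hx.2]; norm_num
    rw [complex_sq_norm] at h1
    have h2 := pow_pos (hd.2 i) 2
    simp only [sphereTorusChart, Sum.elim_inr]
    linarith

/-- Translation by the conjugate of `m` moves `m` to the identity. Where the real part is positive,
it is the square root determined by the other coordinates. -/
theorem sphereTorusChartInv_chart {m x : SphereTorusAmbient ι} (hm : m ∈ sphereTorus ι)
    (hx : x ∈ sphereTorus ι) (hd : x ∈ sphereTorusDomain m) :
    sphereTorusChartInv m (sphereTorusChart m x) = x := by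
  refine Prod.ext ?_ (funext fun i => ?_)
  · have h1 := norm_quatConjMul hm.1 x.1
    rw [hx.1, complex_sq_norm, complex_sq_norm] at h1
    set p := quatConjMul m.1 x.1 with hp
    have h2 : √(1 - (p.1.im ^ 2 + p.2.re ^ 2 + p.2.im ^ 2)) = p.1.re := by
      rw [show 1 - (p.1.im ^ 2 + p.2.re ^ 2 + p.2.im ^ 2) = p.1.re ^ 2 by linarith,
        Real.sqrt_sq hd.1.le]
    conv_rhs => rw [← quatMul_quatConjMul hm.1 x.1]
    change quatMul m.1 ((√(1 - (p.1.im ^ 2 + p.2.re ^ 2 + p.2.im ^ 2)) : ℝ) +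
      (p.1.im : ℂ) * Complex.I, (p.2.re : ℂ) + (p.2.im : ℂ) * Complex.I) = quatMul m.1 p
    rw [h2, Complex.re_add_im, Complex.re_add_im]
  · set z := star (m.2 i) * x.2 i with hz
    have h1 : ‖z‖ ^ 2 = 1 := by
      rw [hz, norm_mul, norm_star, hm.2, hx.2]; norm_num
    rw [complex_sq_norm] at h1
    change m.2 i * ((√(1 - z.im ^ 2) : ℝ) + (z.im : ℂ) * Complex.I) = x.2 i
    rw [show 1 - z.im ^ 2 = z.re ^ 2 by linarith, Real.sqrt_sq (hd.2 i).le, Complex.re_add_im,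
      ← mul_assoc, mul_comm (m.2 i), star_mul_self_of_norm (hm.2 i), one_mul]

theorem sphereTorusChartInv_mem {m : SphereTorusAmbient ι} (hm : m ∈ sphereTorus ι)
    {w : Fin 3 ⊕ ι → ℝ} (hw : w ∈ sphereTorusRange ι) :
    sphereTorusChartInv m w ∈ sphereTorus ι := by
  refine ⟨?_, fun i => ?_⟩
  · have h1 : 0 ≤ 1 - (w (Sum.inl 0) ^ 2 + w (Sum.inl 1) ^ 2 + w (Sum.inl 2) ^ 2) := by
      linarith [hw.1]
    rw [sphereTorusChartInv]
    simp only
    rw [norm_quatMul hm.1, complex_sq_norm, complex_sq_norm]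
    simp [Real.sq_sqrt h1]
    ring
  · have h1 : 0 ≤ 1 - w (Sum.inr i) ^ 2 := by linarith [hw.2 i]
    simp only [sphereTorusChartInv]
    rw [norm_mul, hm.2 i, one_mul, ← sq_eq_sq₀ (norm_nonneg _) zero_le_one, complex_sq_norm]
    simp [Real.sq_sqrt h1]

theorem quatConjMul_sphereTorusChartInv {m : SphereTorusAmbient ι} (hm : m ∈ sphereTorus ι)
    (w : Fin 3 ⊕ ι → ℝ) : quatConjMul m.1 (sphereTorusChartInv m w).1 =
      ((√(1 - (w (Sum.inl 0) ^ 2 + w (Sum.inl 1) ^ 2 + w (Sum.inl 2) ^ 2)) : ℝ) +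
        (w (Sum.inl 0) : ℂ) * Complex.I, (w (Sum.inl 1) : ℂ) + (w (Sum.inl 2) : ℂ) * Complex.I) :=
  quatConjMul_quatMul hm.1 _

theorem star_mul_sphereTorusChartInv {m : SphereTorusAmbient ι} (hm : m ∈ sphereTorus ι)
    (w : Fin 3 ⊕ ι → ℝ) (i : ι) : star (m.2 i) * (sphereTorusChartInv m w).2 i =
      (√(1 - w (Sum.inr i) ^ 2) : ℝ) + (w (Sum.inr i) : ℂ) * Complex.I := by
  simp only [sphereTorusChartInv]
  rw [← mul_assoc, star_mul_self_of_norm (hm.2 i), one_mul]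

theorem sphereTorusChartInv_mem_domain {m : SphereTorusAmbient ι} (hm : m ∈ sphereTorus ι)
    {w : Fin 3 ⊕ ι → ℝ} (hw : w ∈ sphereTorusRange ι) :
    sphereTorusChartInv m w ∈ sphereTorusDomain m := by
  refine ⟨?_, fun i => ?_⟩
  · rw [quatConjMul_sphereTorusChartInv hm]
    simpa using hw.1
  · rw [star_mul_sphereTorusChartInv hm]
    simpa using hw.2 i

theorem sphereTorusChart_chartInv {m : SphereTorusAmbient ι} (hm : m ∈ sphereTorus ι)
    (w : Fin 3 ⊕ ι → ℝ) : sphereTorusChart m (sphereTorusChartInv m w) = w := by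
  ext k
  rcases k with k | i
  · simp only [sphereTorusChart, quatConjMul_sphereTorusChartInv hm, Sum.elim_inl]
    fin_cases k <;> simp
  · simp only [sphereTorusChart, star_mul_sphereTorusChartInv hm, Sum.elim_inr]
    simp

attribute [local instance] Matrix.normedAddCommGroup Matrix.normedSpace

theorem IsFibParam.isSubmanifold [Fintype ι] {n : ℕ} {h : Matrix (Fin n) (Fin n) ℂ}
    {G : SphereTorusAmbient ι → Matrix (Fin n) (Fin n) ℂ}
    {Ψ : Matrix (Fin n) (Fin n) ℂ → SphereTorusAmbient ι} (hP : IsFibParam h ι G Ψ) :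
    IsSubmanifold (Fib n h) (3 + Fintype.card ι) := by
  intro x₀ hx₀
  set m := Ψ x₀ with hm_def
  have hm : m ∈ sphereTorus ι := hP.mapsTo _ hx₀
  let e : Fin 3 ⊕ ι ≃ Fin (3 + Fintype.card ι) :=
    (Equiv.sumCongr (Equiv.refl _) (Fintype.equivFin ι)).trans finSumFinEquiv
  let r : EuclideanSpace ℝ (Fin (3 + Fintype.card ι)) → Fin 3 ⊕ ι → ℝ := fun w k => w (e k)
  have hr : ContDiff ℝ ∞ r := contDiff_pi.2 fun k => contDiff_euclidean.1 contDiff_id (e k)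
  let f : Matrix (Fin n) (Fin n) ℂ → EuclideanSpace ℝ (Fin (3 + Fintype.card ι)) := fun x =>
    WithLp.toLp 2 fun k => sphereTorusChart m (Ψ x) (e.symm k)
  let g : EuclideanSpace ℝ (Fin (3 + Fintype.card ι)) → Matrix (Fin n) (Fin n) ℂ := fun w =>
    G (sphereTorusChartInv m (r w)) * h * (G (sphereTorusChartInv m (r w)))ᴴ
  have hrf : ∀ x, r (f x) = sphereTorusChart m (Ψ x) := fun x => by
    ext k; simp [r, f]
  have hGc : ContDiff ℝ ∞ fun y => G y * h * (G y)ᴴ := contDiff_matrix_iff.2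
    ((hP.contDiff_G.mul (entryContDiff_const h)).mul hP.contDiff_G.conjTranspose)
  have hWo : IsOpen (r ⁻¹' sphereTorusRange ι) := isOpen_sphereTorusRange.preimage hr.continuous
  have hmem : ∀ x ∈ Fib n h ∩ Ψ ⁻¹' sphereTorusDomain m,
      sphereTorusChart m (Ψ x) ∈ sphereTorusRange ι := fun x hx =>
    sphereTorusChart_mem hm (hP.mapsTo _ hx.1) hx.2
  have hΨg : ∀ w ∈ r ⁻¹' sphereTorusRange ι, Ψ (g w) = sphereTorusChartInv m (r w) := fun w hw =>
    hP.left_inv _ (sphereTorusChartInv_mem hm hw)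
  refine ⟨Ψ ⁻¹' sphereTorusDomain m,
    (isOpen_sphereTorusDomain m).preimage hP.contDiff_Ψ.continuous,
    self_mem_sphereTorusDomain hm, r ⁻¹' sphereTorusRange ι, hWo, f, g, ?_, ?_, ?_, ?_, ?_, ?_⟩
  · refine ContDiff.smoothMapOn (contDiff_euclidean.2 fun k => ?_) _
    exact (contDiff_sphereTorusChart m (e.symm k)).comp hP.contDiff_Ψ
  · refine fun w hw => ⟨r ⁻¹' sphereTorusRange ι, hWo, hw, g, ?_, fun _ _ => rfl⟩
    exact hGc.comp_contDiffOn
      ((contDiffOn_sphereTorusChartInv m).comp hr.contDiffOn fun _ h => h)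
  · intro x hx
    rw [Set.mem_preimage, hrf]
    exact hmem x hx
  · intro w hw
    refine ⟨hP.mem_Fib _ (sphereTorusChartInv_mem hm hw), ?_⟩
    rw [Set.mem_preimage, hΨg w hw]
    exact sphereTorusChartInv_mem_domain hm hw
  · intro x hx
    simp only [g]
    rw [hrf, sphereTorusChartInv_chart hm (hP.mapsTo _ hx.1) hx.2, hP.right_inv _ hx.1]
  · intro w hw
    ext k
    simp only [f]
    rw [hΨg w hw, sphereTorusChart_chartInv hm]
    simp [r]

/-- The homeomorphism between `sphereTorus ι` and a parametrized fiber. -/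
def IsFibParam.homeomorph [Fintype ι] {n : ℕ} {h : Matrix (Fin n) (Fin n) ℂ}
    {G : SphereTorusAmbient ι → Matrix (Fin n) (Fin n) ℂ}
    {Ψ : Matrix (Fin n) (Fin n) ℂ → SphereTorusAmbient ι} (hP : IsFibParam h ι G Ψ) :
    sphereTorus ι ≃ₜ Fib n h where
  toFun m := ⟨G m * h * (G m)ᴴ, hP.mem_Fib _ m.2⟩
  invFun x := ⟨Ψ x, hP.mapsTo _ x.2⟩
  left_inv m := Subtype.ext (hP.left_inv _ m.2)
  right_inv x := Subtype.ext (hP.right_inv _ x.2)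
  continuous_toFun := by
    have hGc : ContDiff ℝ ∞ fun y => G y * h * (G y)ᴴ := contDiff_matrix_iff.2
      ((hP.contDiff_G.mul (entryContDiff_const h)).mul hP.contDiff_G.conjTranspose)
    exact (hGc.continuous.comp continuous_subtype_val).subtype_mk _
  continuous_invFun := (hP.contDiff_Ψ.continuous.comp continuous_subtype_val).subtype_mk _

end Charts

/-! ### Logarithms of circle-valued maps on the three-sphere times a Euclidean space. -/

section NonTorus

open unitInterval

theorem Circle.exists_log_of_homotopy {A : Type*} [TopologicalSpace A] (H : I × A → Circle)
    (hH : Continuous H) (c : Circle) (h0 : ∀ a, H (0, a) = c) :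
    ∃ φ : A → ℝ, Continuous φ ∧ ∀ a, Circle.exp (φ a) = H (1, a) := by
  obtain ⟨t, ht⟩ := Circle.exp_surjective c
  let G := Circle.isCoveringMap_exp.liftHomotopy ⟨H, hH⟩ (.const A t)
    (fun a => by simp [h0, ht])
  refine ⟨fun a => G (1, a), by fun_prop, fun a => ?_⟩
  exact congr_fun (Circle.isCoveringMap_exp.liftHomotopy_lifts ⟨H, hH⟩ (.const A t) _) (1, a)

theorem Circle.log_unique {A : Type*} [TopologicalSpace A] [PreconnectedSpace A]
    {φ ψ : A → ℝ} (hφ : Continuous φ) (hψ : Continuous ψ)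
    (h : ∀ a, Circle.exp (φ a) = Circle.exp (ψ a)) :
    ∃ m : ℤ, ∀ a, φ a = ψ a + m * (2 * Real.pi) := by
  rcases isEmpty_or_nonempty A with hA | ⟨⟨a⟩⟩
  · exact ⟨0, fun a => hA.elim a⟩
  obtain ⟨m, hm⟩ := Circle.exp_eq_exp.1 (h a)
  refine ⟨m, fun b => congr_fun (Circle.isCoveringMap_exp.eq_of_comp_eq hφ
    (g₂ := fun b => ψ b + m * (2 * Real.pi)) (by fun_prop) ?_ a hm) b⟩
  funext b
  simp only [Function.comp_apply, h b]
  exact Circle.exp_eq_exp.2 ⟨-m, by push_cast; ring⟩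

theorem Circle.not_exists_continuous_sqrt :
    ¬ ∃ k : Circle → Circle, Continuous k ∧ ∀ w, k w ^ 2 = w := by
  rintro ⟨k, hk, hk2⟩
  -- Contracting the line gives a logarithm `ψ` of `k ∘ Circle.exp`. Twice `ψ` is the identity up to
  -- a constant, so `ψ` grows by `π` over one period, although `k` returns to its value.
  obtain ⟨ψ, hψ, hψk⟩ := Circle.exists_log_of_homotopy
    (fun p : I × ℝ => k (Circle.exp (p.1 * p.2))) (by fun_prop) (k 1) (by simp)
  obtain ⟨m, hm⟩ := Circle.log_unique (φ := fun t => ψ t + ψ t) (ψ := fun t : ℝ => t)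
    (by fun_prop) (by fun_prop) (fun t => by
      rw [Circle.exp_add, hψk, ← sq, hk2]; simp)
  have h0 := hm 0
  have h1 := hm (2 * Real.pi)
  simp only [zero_add] at h0
  have h2 : ψ (2 * Real.pi) = Real.pi + ψ 0 := by linarith
  have h3 := hψk (2 * Real.pi)
  have h4 := hψk 0
  simp only [Set.Icc.coe_one, one_mul, Circle.exp_two_pi, Circle.exp_zero] at h3 h4
  rw [h2, Circle.exp_add, h4] at h3
  exact Circle.exp_pi_ne_one (mul_eq_right.1 h3)

/-- The unit sphere in `ℂ²`. -/
abbrev ThreeSphere : Type := {q : ℂ × ℂ // ‖q.1‖ ^ 2 + ‖q.2‖ ^ 2 = 1}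

namespace ThreeSphere

/-- The point on the half sphere `0 ≤ ε * Re q₁` obtained from `q` by reflection. -/
def fold (ε : ℝ) (hε : ε ^ 2 = 1) (q : ThreeSphere) : ThreeSphere :=
  ⟨(((ε * |q.1.1.re| : ℝ) : ℂ) + ((q.1.1.im : ℝ) : ℂ) * Complex.I, q.1.2), by
    have := q.2
    simp only [complex_sq_norm] at this ⊢
    simp only [Complex.add_re, Complex.ofReal_re, Complex.mul_re, Complex.I_re, mul_zero,
      Complex.ofReal_im, Complex.I_im, mul_one, sub_self, add_zero, Complex.add_im,
      Complex.mul_im, zero_add, mul_pow, hε, sq_abs, one_mul, this]⟩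

theorem continuous_fold (ε : ℝ) (hε : ε ^ 2 = 1) : Continuous (fold ε hε) := by
  unfold fold
  fun_prop

theorem fold_eq_self (ε : ℝ) (hε : ε ^ 2 = 1) (q : ThreeSphere) (hq : 0 ≤ ε * q.1.1.re) :
    fold ε hε q = q := by
  have h1 : ε * |q.1.1.re| = q.1.1.re := by
    have h2 : |ε| = 1 := by
      rwa [← sq_eq_sq₀ (abs_nonneg _) zero_le_one, sq_abs, one_pow]
    have h3 : |q.1.1.re| = ε * q.1.1.re := by
      rw [← abs_of_nonneg hq, abs_mul, h2, one_mul]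
    rw [h3, ← mul_assoc, ← sq, hε, one_mul]
  apply Subtype.ext
  simp only [fold, h1]
  exact Prod.ext (Complex.re_add_im _) rfl

/-- The segment from `(ε, 0)` to `fold ε q`, before projecting to the sphere. -/
def foldSegment (ε : ℝ) (hε : ε ^ 2 = 1) (p : I × ThreeSphere) : ℂ × ℂ :=
  ((((1 - p.1) * ε : ℝ) : ℂ) + ((p.1 : ℝ) : ℂ) * (fold ε hε p.2).1.1,
    ((p.1 : ℝ) : ℂ) * (fold ε hε p.2).1.2)

theorem continuous_foldSegment (ε : ℝ) (hε : ε ^ 2 = 1) : Continuous (foldSegment ε hε) := by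
  have := continuous_fold ε hε
  unfold foldSegment
  fun_prop

/-- The unit vectors at the two ends have nonnegative inner product, so at time `s` the squared norm
is at least `(1 - s)² + s²`. -/
theorem foldSegment_pos (ε : ℝ) (hε : ε ^ 2 = 1) (p : I × ThreeSphere) :
    0 < ‖(foldSegment ε hε p).1‖ ^ 2 + ‖(foldSegment ε hε p).2‖ ^ 2 := by
  have h := (fold ε hε p.2).2
  have h1 : (fold ε hε p.2).1.1.re = ε * |p.2.1.1.re| := by simp [fold]
  have h2 := abs_nonneg p.2.1.1.re
  have hs0 := p.1.2.1
  have hs1 := p.1.2.2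
  simp only [complex_sq_norm] at h ⊢
  simp only [foldSegment, Complex.add_re, Complex.add_im, Complex.mul_re, Complex.mul_im,
    Complex.ofReal_re, Complex.ofReal_im, zero_mul, sub_zero, add_zero, zero_add]
  generalize (p.1 : ℝ) = s at *
  set a := (fold ε hε p.2).1.1.re
  have h3 : 0 ≤ ε * a := by
    rw [h1, ← mul_assoc, ← sq, hε, one_mul]; exact h2
  have h4 : 0 ≤ s * (1 - s) * (ε * a) := mul_nonneg (mul_nonneg hs0 (by linarith)) h3
  have h5 : ((1 - s) * ε + s * a) ^ 2 = (1 - s) ^ 2 + s ^ 2 * a ^ 2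
      + 2 * (s * (1 - s) * (ε * a)) := by linear_combination (1 - s) ^ 2 * hε
  rw [h5]
  set b := (fold ε hε p.2).1.1.im
  have h6 : 0 < (1 - s) ^ 2 + s ^ 2 := by nlinarith [sq_nonneg (2 * s - 1)]
  nlinarith

/-- Contracts the half sphere to the point `(ε, 0)`. -/
noncomputable def contract (ε : ℝ) (hε : ε ^ 2 = 1) (p : I × ThreeSphere) : ThreeSphere :=
  let v := foldSegment ε hε p
  let r : ℝ := (Real.sqrt (‖v.1‖ ^ 2 + ‖v.2‖ ^ 2))⁻¹
  ⟨((r : ℂ) * v.1, (r : ℂ) * v.2), by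
    have h := foldSegment_pos ε hε p
    simp only [norm_mul, mul_pow, Complex.norm_real, r, Real.norm_eq_abs, sq_abs, inv_pow]
    rw [Real.sq_sqrt h.le, ← mul_add, inv_mul_cancel₀ h.ne']⟩

theorem continuous_contract (ε : ℝ) (hε : ε ^ 2 = 1) : Continuous (contract ε hε) := by
  have h := continuous_foldSegment ε hε
  have h1 : Continuous fun p => (Real.sqrt (‖(foldSegment ε hε p).1‖ ^ 2
      + ‖(foldSegment ε hε p).2‖ ^ 2))⁻¹ :=
    Continuous.inv₀ (by fun_prop) fun p => (Real.sqrt_pos.2 (foldSegment_pos ε hε p)).ne'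
  exact Continuous.subtype_mk (by fun_prop) _

theorem contract_zero (ε : ℝ) (hε : ε ^ 2 = 1) (q q' : ThreeSphere) :
    contract ε hε (0, q) = contract ε hε (0, q') := by
  simp [contract, foldSegment]

theorem contract_one (ε : ℝ) (hε : ε ^ 2 = 1) (q : ThreeSphere) :
    contract ε hε (1, q) = fold ε hε q := by
  have h := (fold ε hε q).2
  apply Subtype.ext
  simp only [contract, foldSegment, Set.Icc.coe_one, sub_self, zero_mul, Complex.ofReal_zero,
    zero_add, Complex.ofReal_one, one_mul, h, Real.sqrt_one, inv_one]

/-- Parametrizes the equator `Re q₁ = 0`. -/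
def equator (y : Metric.sphere (0 : EuclideanSpace ℝ (Fin 3)) 1) : ThreeSphere :=
  ⟨(⟨0, y.1 0⟩, ⟨y.1 1, y.1 2⟩), by
    have h := mem_sphere_zero_iff_norm.1 y.2
    rw [EuclideanSpace.norm_eq, Real.sqrt_eq_one, Fin.sum_univ_three] at h
    simp only [complex_sq_norm, Real.norm_eq_abs, sq_abs] at h ⊢
    linarith⟩

/-- Parametrizes the sphere. -/
def ofReal (y : Metric.sphere (0 : EuclideanSpace ℝ (Fin 4)) 1) : ThreeSphere :=
  ⟨(⟨y.1 0, y.1 1⟩, ⟨y.1 2, y.1 3⟩), by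
    have h := mem_sphere_zero_iff_norm.1 y.2
    rw [EuclideanSpace.norm_eq, Real.sqrt_eq_one, Fin.sum_univ_four] at h
    simp only [complex_sq_norm, Real.norm_eq_abs, sq_abs] at h ⊢
    linarith⟩

theorem continuous_complex_mk {A : Type*} [TopologicalSpace A] {f g : A → ℝ}
    (hf : Continuous f) (hg : Continuous g) : Continuous fun a => (⟨f a, g a⟩ : ℂ) :=
  Complex.equivRealProdCLM.symm.continuous.comp (hf.prodMk hg)

theorem continuous_equator : Continuous equator :=
  ((continuous_complex_mk (by fun_prop) (by fun_prop)).prodMk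
    (continuous_complex_mk (by fun_prop) (by fun_prop))).subtype_mk _

theorem continuous_ofReal : Continuous ofReal :=
  ((continuous_complex_mk (by fun_prop) (by fun_prop)).prodMk
    (continuous_complex_mk (by fun_prop) (by fun_prop))).subtype_mk _

theorem exists_equator_eq (q : ThreeSphere) (hq : q.1.1.re = 0) : ∃ y, equator y = q := by
  refine ⟨⟨!₂[q.1.1.im, q.1.2.re, q.1.2.im], ?_⟩, ?_⟩
  · have h := q.2
    rw [mem_sphere_zero_iff_norm, EuclideanSpace.norm_eq, Real.sqrt_eq_one, Fin.sum_univ_three]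
    simp only [complex_sq_norm, hq] at h
    simp
    linarith
  · exact Subtype.ext (Prod.ext (Complex.ext hq.symm rfl) (Complex.ext rfl rfl))

theorem surjective_ofReal : Function.Surjective ofReal := by
  refine fun q => ⟨⟨!₂[q.1.1.re, q.1.1.im, q.1.2.re, q.1.2.im], ?_⟩, ?_⟩
  · have h := q.2
    rw [mem_sphere_zero_iff_norm, EuclideanSpace.norm_eq, Real.sqrt_eq_one, Fin.sum_univ_four]
    simp only [complex_sq_norm] at h
    simp
    linarith
  · exact Subtype.ext (Prod.ext (Complex.ext rfl rfl) (Complex.ext rfl rfl))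

theorem preconnectedSpace_sphere (m : ℕ) :
    PreconnectedSpace (Metric.sphere (0 : EuclideanSpace ℝ (Fin (m + 2))) 1) := by
  refine isPreconnected_iff_preconnectedSpace.1 (isPreconnected_sphere ?_ 0 1)
  rw [← Module.finrank_eq_rank, finrank_euclideanSpace_fin]
  exact_mod_cast (by omega : 1 < m + 2)

instance : PreconnectedSpace ThreeSphere :=
  have := preconnectedSpace_sphere 2
  surjective_ofReal.denseRange.preconnectedSpace continuous_ofReal

/-- Logarithms exist over the two contractible half spheres. Over the connected equator they differ
by a constant multiple of `2π`, and after this correction they glue. -/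
theorem exists_log {ι : Type*} (f : ThreeSphere × (ι → ℝ) → Circle) (hf : Continuous f) :
    ∃ φ : ThreeSphere × (ι → ℝ) → ℝ, Continuous φ ∧ ∀ x, Circle.exp (φ x) = f x := by
  -- Folding the sphere onto a half makes `φ` continuous everywhere, though it is a logarithm of `f`
  -- only on that half.
  have key (ε : ℝ) (hε : ε ^ 2 = 1) : ∃ φ : ThreeSphere × (ι → ℝ) → ℝ, Continuous φ ∧
      ∀ x, 0 ≤ ε * x.1.1.1.re → Circle.exp (φ x) = f x := by
    have hc := continuous_contract ε hε
    obtain ⟨φ, hφ, h⟩ := Circle.exists_log_of_homotopy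
      (fun p : I × (ThreeSphere × (ι → ℝ)) =>
        f (contract ε hε (p.1, p.2.1), fun i => p.1 * p.2.2 i)) (by fun_prop)
      (f (contract ε hε (0, ⟨(1, 0), by simp⟩), 0)) (fun x => by
        simp only [contract_zero ε hε x.1 ⟨(1, 0), by simp⟩, Set.Icc.coe_zero, zero_mul]
        rfl)
    refine ⟨φ, hφ, fun x hx => ?_⟩
    rw [h, contract_one, fold_eq_self ε hε _ hx]
    simp
  obtain ⟨φ, hφ, hφf⟩ := key 1 (by norm_num)
  obtain ⟨ψ, hψ, hψf⟩ := key (-1) (by norm_num)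
  have := preconnectedSpace_sphere 1
  have he := continuous_equator
  obtain ⟨m, hm⟩ := Circle.log_unique
    (A := Metric.sphere (0 : EuclideanSpace ℝ (Fin 3)) 1 × (ι → ℝ))
    (φ := fun y => φ (equator y.1, y.2)) (ψ := fun y => ψ (equator y.1, y.2))
    (by fun_prop) (by fun_prop) (fun y => by
      rw [hφf _ (by simp [equator]), hψf _ (by simp [equator])])
  refine ⟨fun x => if 0 ≤ x.1.1.1.re then φ x else ψ x + m * (2 * Real.pi), ?_, fun x => ?_⟩
  · refine Continuous.if_le hφ (by fun_prop) (by fun_prop) (by fun_prop) fun x hx => ?_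
    obtain ⟨y, hy⟩ := exists_equator_eq x.1 hx.symm
    simpa [hy] using hm (y, x.2)
  · dsimp only
    split_ifs with hx
    · exact hφf x (by simpa using hx)
    · rw [Circle.exp_add, Circle.exp_int_mul_two_pi, mul_one]
      exact hψf x (by linarith)

end ThreeSphere
end NonTorus

/-! ### Comparison of the three-sphere times circles with tori. -/

section NonTorus

open ThreeSphere

variable {ι : Type}

theorem Circle.continuous_mk_of_norm {A : Type*} [TopologicalSpace A] {f : A → ℂ}
    (hf : Continuous f) (h : ∀ a, ‖f a‖ = 1) :
    Continuous fun a => (⟨f a, mem_sphere_zero_iff_norm.2 (h a)⟩ : Circle) :=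
  Continuous.subtype_mk hf _

/-- The ambient description of the product of a 3-sphere and circles. -/
def sphereTorusHomeomorph (ι : Type) : sphereTorus ι ≃ₜ ThreeSphere × (ι → Circle) where
  toFun m := (⟨m.1.1, m.2.1⟩, fun i => ⟨m.1.2 i, mem_sphere_zero_iff_norm.2 (m.2.2 i)⟩)
  invFun p := ⟨(p.1.1, fun i => p.2 i), p.1.2, fun i => (p.2 i).norm_coe⟩
  left_inv _ := rfl
  right_inv _ := rfl
  continuous_toFun := (Continuous.subtype_mk (by fun_prop) _).prodMk
    (continuous_pi fun i => Circle.continuous_mk_of_norm (by fun_prop) fun m => m.2.2 i)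
  continuous_invFun := Continuous.subtype_mk (by fun_prop) _

/-- The universal covering of `S³ × (S¹)^ι`. -/
noncomputable def sphereTorusCover (ι : Type) (x : ThreeSphere × (ι → ℝ)) :
    ThreeSphere × (ι → Circle) :=
  (x.1, fun i => Circle.exp (x.2 i))

theorem isOpenQuotientMap_sphereTorusCover : IsOpenQuotientMap (sphereTorusCover ι) :=
  IsOpenQuotientMap.id.prodMap (IsOpenQuotientMap.piMap fun _ =>
    ⟨Circle.exp_surjective, Circle.exp.continuous, isLocalHomeomorph_circleExp.isOpenMap⟩)

theorem exists_sqrt_of_even_periods [Fintype ι] [DecidableEq ι]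
    (f : ThreeSphere × (ι → Circle) → Circle) (φ : ThreeSphere × (ι → ℝ) → ℝ)
    (hφ : Continuous φ) (hφf : ∀ x, Circle.exp (φ x) = f (sphereTorusCover ι x))
    (heven : ∀ i, ∃ n : ℤ, ∀ x, φ (x.1, x.2 + Pi.single i (2 * Real.pi))
      = φ x + (2 * n) * (2 * Real.pi)) :
    ∃ g : ThreeSphere × (ι → Circle) → Circle, Continuous g ∧ ∀ y, g y ^ 2 = f y := by
  let G : ThreeSphere × (ι → ℝ) → Circle := fun x => Circle.exp (φ x / 2)
  have hG : Continuous G := by fun_prop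
  -- The periods of `exp (φ / 2)` form a group. Even periods of `φ` put the generators of the deck
  -- group in it, so the function descends.
  let P : AddSubgroup (ι → ℝ) :=
    { carrier := {w | ∀ x, G (x.1, x.2 + w) = G x}
      zero_mem' := fun x => by simp
      add_mem' := fun {v w} hv hw x => by
        rw [← add_assoc, ← hv x]
        exact hw (x.1, x.2 + v)
      neg_mem' := fun {w} hw x => by
        rw [← hw (x.1, x.2 + -w)]
        simp }
  have hP (i : ι) : (Pi.single i (2 * Real.pi) : ι → ℝ) ∈ P := fun x => by
    obtain ⟨n, hn⟩ := heven i
    simp only [G, hn]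
    exact Circle.exp_eq_exp.2 ⟨n, by ring⟩
  have hinv (x x') (h : sphereTorusCover ι x = sphereTorusCover ι x') : G x = G x' := by
    obtain ⟨h1, h2⟩ := Prod.ext_iff.1 h
    have h3 (i : ι) := Circle.exp_eq_exp.1 (congr_fun h2 i)
    choose m hm using h3
    have h4 : x.2 = x'.2 + ∑ i, m i • (Pi.single i (2 * Real.pi) : ι → ℝ) := by
      funext j
      simp [Finset.sum_apply, Pi.single_apply, hm j]
    have h5 : (∑ i, m i • (Pi.single i (2 * Real.pi) : ι → ℝ)) ∈ P :=
      sum_mem fun i _ => zsmul_mem (hP i) _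
    rw [← h5 x', ← h4]
    exact congrArg G (Prod.ext h1 rfl)
  have hq := isOpenQuotientMap_sphereTorusCover (ι := ι)
  refine ⟨G ∘ Function.surjInv hq.surjective, ?_, fun y => ?_⟩
  · rw [hq.isQuotientMap.continuous_iff]
    exact hG.congr fun x => (hinv _ _ (Function.surjInv_eq hq.surjective _)).symm
  · simp only [Function.comp_apply, G]
    rw [sq, ← Circle.exp_add, add_halves, hφf, Function.surjInv_eq hq.surjective]

theorem isEmpty_homeomorph_torus [Fintype ι] {d : ℕ} (hd : Fintype.card ι < d) :
    IsEmpty (ThreeSphere × (ι → Circle) ≃ₜ (Fin d → Circle)) := by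
  classical
  refine ⟨fun Θ => ?_⟩
  have hΘ := Θ.continuous
  have hcov := (isOpenQuotientMap_sphereTorusCover (ι := ι)).continuous
  have h1 (j : Fin d) := ThreeSphere.exists_log
    (fun x : ThreeSphere × (ι → ℝ) => Θ (sphereTorusCover ι x) j) (by fun_prop)
  choose φ hφ hφf using h1
  have h2 (j : Fin d) (i : ι) : ∃ n : ℤ, ∀ x : ThreeSphere × (ι → ℝ),
      φ j (x.1, x.2 + Pi.single i (2 * Real.pi)) = φ j x + n * (2 * Real.pi) := by
    refine Circle.log_unique (by fun_prop) (hφ j) fun x => ?_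
    rw [hφf, hφf]
    suffices h : sphereTorusCover ι (x.1, x.2 + Pi.single i (2 * Real.pi))
        = sphereTorusCover ι x by rw [h]
    refine Prod.ext_iff.2 ⟨rfl, funext fun k => ?_⟩
    rcases eq_or_ne k i with rfl | hk
    · simp [sphereTorusCover]
    · simp [sphereTorusCover, hk]
  choose n hn using h2
  -- The `d` rows of periods modulo two live in dimension `Fintype.card ι < d`. A relation between
  -- them selects the coordinates whose product has even periods.
  have hdep : ¬ LinearIndependent (ZMod 2) (fun j i => (n j i : ZMod 2)) := fun h => by
    have := h.fintype_card_le_finrank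
    rw [Module.finrank_fintype_fun_eq_card, Fintype.card_fin] at this
    omega
  obtain ⟨c, hc, j₀, hj₀⟩ := Fintype.not_linearIndependent_iff.1 hdep
  let B : Finset (Fin d) := {j | c j ≠ 0}
  have hB (i : ι) : Even (∑ j ∈ B, n j i) := by
    rw [← ZMod.intCast_eq_zero_iff_even]
    have := congr_fun hc i
    rw [Finset.sum_apply] at this
    rw [Int.cast_sum, Finset.sum_filter]
    refine Eq.trans (Finset.sum_congr rfl fun j _ => ?_) this
    have : ∀ a : ZMod 2, a ≠ 0 → a = 1 := by decide
    by_cases hcj : c j = 0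
    · simp [hcj]
    · simp [this _ hcj]
  obtain ⟨g, hg, hgf⟩ := exists_sqrt_of_even_periods (fun y => ∏ j ∈ B, Θ y j)
    (fun x => ∑ j ∈ B, φ j x) (by fun_prop)
    (fun x => by
      rw [show Circle.exp (∑ j ∈ B, φ j x) = ∏ j ∈ B, Circle.exp (φ j x) from
        map_sum Circle.expHom _ _]
      exact Finset.prod_congr rfl fun j _ => hφf j x)
    (fun i => by
      obtain ⟨m, hm⟩ := hB i
      refine ⟨m, fun x => ?_⟩
      have hm' : (∑ j ∈ B, (n j i : ℝ)) = m + m := by exact_mod_cast hm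
      simp only [hn, Finset.sum_add_distrib, ← Finset.sum_mul, hm']
      ring)
  -- On the circle where every coordinate except `j₀` equals `1`, the product over `B` is just `w`.
  refine Circle.not_exists_continuous_sqrt
    ⟨fun w => g (Θ.symm (Function.update 1 j₀ w)), by fun_prop, fun w => ?_⟩
  rw [hgf, Homeomorph.apply_symm_apply,
    Finset.prod_update_of_mem (by simpa [B] using hj₀)]
  simp

theorem not_homeomorph_torus_of_sphereTorus [Fintype ι] {d : ℕ} (hd : Fintype.card ι < d)
    (Θ : sphereTorus ι ≃ₜ (Fin d → Circle)) : False :=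
  (isEmpty_homeomorph_torus hd).false ((sphereTorusHomeomorph ι).symm.trans Θ)

end NonTorus

/-! ### Assembly of the theorem. -/

theorem mainTheorem11 (n : ℕ) (l : Fin n → ℝ) (hl : Antitone l)
    (hproj : ¬ OrbitIsProjectiveSpace l) :
    ∃ (u : GCIndex n → ℝ) (d : ℕ),
      (gcFiber l u).Nonempty ∧ IsLagrangianIn l (gcFiber l u) d ∧
        ¬ Nonempty (gcFiber l u ≃ₜ (Fin d → Circle)) := by
  have hcard := card_add_two_le_of_not_projective hproj
  -- An eigenvalue that occurs has multiplicity at least one, so the bound forces `n ≥ 3`; it fails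
  -- outright for `n = 0`.
  obtain ⟨k, rfl⟩ : ∃ k, n = k + 3 := by
    rcases n with _ | n
    · exact absurd (hcard 0) (by simp)
    · have h1 := hcard (l 0)
      have h2 : 0 < Fintype.card {i // l i = l 0} := Fintype.card_pos_iff.2 ⟨⟨0, rfl⟩⟩
      exact ⟨n - 2, by omega⟩
  obtain ⟨h, hU, hG⟩ := exists_good k l hcard
  have hh : h.IsHermitian := hU.isHermitian (rdiag_isHermitian l)
  have hmem : h ∈ coadjointOrbit l := mem_coadjointOrbit_iff.2 hU
  obtain ⟨ι, _, G, Ψ, hP⟩ := exists_isFibParam hh hG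
  refine ⟨gelfandCetlin l ⟨h, hmem⟩, 3 + Fintype.card ι, ?_⟩
  rw [gcFiber_eq_Fib hmem]
  refine ⟨⟨h, self_mem_Fib h⟩, ⟨fun x hx => ?_, hP.isSubmanifold, fun x hx X hX => ?_⟩, ?_⟩
  · exact mem_coadjointOrbit_iff.2 ((UEq.of_mem_Fib hx).trans hU)
  · have hxh : x.IsHermitian := (UEq.of_mem_Fib hx).isHermitian hh
    -- Any point of the fiber can serve as its base point, so the tangent space at `x` is computed
    -- from `x` itself.
    have hxe : Fib (k + 3) h = Fib (k + 3) x := Set.ext fun y =>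
      ⟨fun hy => mem_Fib_trans hy (mem_Fib_symm hx), fun hy => mem_Fib_trans hy hx⟩
    rw [hxe]
    exact lagrangian_condition_Fib hxh ((hG.of_mem_Fib hh hx).nondeg hxh) hX
  · rintro ⟨Θ⟩
    exact not_homeomorph_torus_of_sphereTorus (by omega) (hP.homeomorph.trans Θ)
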